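/- **Conventions.** All categories have hom-sets in one fixed universe of (small) sets. Composition is written $gf = g\circ f$. A *restriction category* is a category with an operation assigning to each $f\colon A\to B$ a map $\bar f\colon A\to A$ such that $f\bar f=f$, $\bar f\bar g=\bar g\bar f$ and $\overline{g\bar f}=\bar g\bar f$ for $f,g$ with common domain, and $\bar g f=f\,\overline{gf}$ for composable $f,g$. Maps of the form $\bar f$ are *restriction idempotents*; $\mathcal O(A)$ is the set of those on $A$. A map $f\colon A\to B$ is *total* if $\bar f=1_A$. On parallel maps, $f\leqslant g$ means $f=g\bar f$, and $f,g$ are *compatible* if $f\bar g=g\bar f$. A *partial inverse* of $p\colon A\to X$ is a map $s\colon X\to A$ with $sp=\bar p$ and $ps=\bar s$; $p$ is a *partial isomorphism* if it has one. A *join restriction category* is a restriction category in which each pairwise compatible family of parallel maps has a join for $\leqslant$, preserved by precomposition with any map. A *restriction functor* is a functor preserving $f\mapsto\bar f$; a restriction functor $P\colon\mathcal A\to\mathcal C$ is *hyperconnected* if each $\mathcal O(A)\to\mathcal O(PA)$ is bijective. Let $\mathcal C$ be a join restriction category. A *local homeomorphism* is a total map which is a join of partial isomorphisms. A *local atlas*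 on $X\in\mathcal C$ is a set $I$ with restriction idempotents $\varphi_{ij}\in\mathcal O(X)$ ($i,j\in I$) such that $\varphi_{ij}=\varphi_{ji}$ and $\varphi_{jk}\varphi_{ij}\leqslant\varphi_{ik}$. A *glueing* of it is a total map $p\colon A\to X$ which is a join $\bigvee_{i\in I}p_i$ of maps with partial inverses $s_i\colon X\to A$ such that $p_js_i=\varphi_{ij}$. $\mathcal C$ *has local glueings* if every local atlas (indexed by a small set) has a glueing. A *partial section* of a total map $p\colon A\to X$ is a map $s\colon X\to A$ with $ps=\bar s$. **The category $\mathrm{rCat}/\!/\mathcal C$.** Objects are pairs of a restriction category $\mathcal A$ and a restriction functor $P\colon\mathcal A\to\mathcal C$. A map $(\mathcal A,P)\to(\mathcal B,Q)$ is a *lax-commutative triangle* $(F,\alpha)$: a restriction functor $F\colon\mathcal A\to\mathcal B$ and a natural transformation $\alpha\colon QF\Rightarrow P$ with total components. Composition is by pasting. $\mathrm{jrCat}/\!/_h\mathcal C$ is the full subcategory on those $P\colon\mathcal A\to\mathcal C$ for which $\mathcal A$ is a join restriction category and $P$ is hyperconnected. **The category $\mathrm{pCat}_c(\mathcal C)$.**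 A *partite internal category* $\mathbb A$ in $\mathcal C$ comprises a set $I$ of components; objects $A_i$ and $A_{ij}$ of $\mathcal C$ for $i,j\in I$; total maps $\sigma_{ij}\colon A_{ij}\to A_i$ and $\tau_{ij}\colon A_{ij}\to A_j$, where each $\sigma_{ij}$ admits a pullback along every total map; maps $\eta_i\colon A_i\to A_{ii}$ with $\sigma_{ii}\eta_i=1=\tau_{ii}\eta_i$; and maps $\mu_{ijk}\colon A_{jk}\times_{A_j}A_{ij}\to A_{ik}$ with $\sigma_{ik}\mu_{ijk}=\sigma_{ij}\pi_2$ and $\tau_{ik}\mu_{ijk}=\tau_{jk}\pi_1$, satisfying the unit laws $\mu_{iij}(1,\eta_i\sigma_{ij})=1=\mu_{ijj}(\eta_j\tau_{ij},1)$ and the associativity law $\mu_{ik\ell}(1\times\mu_{ijk})=\mu_{ij\ell}(\mu_{jk\ell}\times1)$. It is *source-étale* if all $\sigma_{ij}$ are local homeomorphisms. A *partite cofunctor* $F\colon\mathbb A\rightsquigarrow\mathbb B$ comprises a function $i\mapsto Fi$ on components, total maps $F_i\colon B_{Fi}\to A_i$, and total maps $F_{ij}\colon A_{ij}\times_{A_i}B_{Fi}\to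 B_{Fi,Fj}$ with $\sigma_{Fi,Fj}F_{ij}=\pi_2$, such that (target) $F_j\,\tau_{Fi,Fj}\,F_{ij}=\tau_{ij}\pi_1$; (identity) $F_{ii}(\eta_iF_i,1)=\eta_{Fi}$; and (composition), as maps $A_{jk}\times_{A_j}A_{ij}\times_{A_i}B_{Fi}\to B_{Fi,Fk}$ and in terms of generalised elements, $F_{ik}(\mu_{ijk}(a',a),b)=\mu_{Fi,Fj,Fk}\bigl(F_{jk}(a',\tau_{Fi,Fj}F_{ij}(a,b)),\,F_{ij}(a,b)\bigr)$. The identity has $F_i=1$ and $F_{ij}=\pi_1$; the composite of $F\colon\mathbb A\rightsquigarrow\mathbb B$ and $G\colon\mathbb B\rightsquigarrow\mathbb D$ has $(GF)i=G(Fi)$, $(GF)_i=F_iG_{Fi}$ and $(GF)_{ij}(a,c)=G_{Fi,Fj}\bigl(F_{ij}(a,G_{Fi}c),c\bigr)$. These form the category $\mathrm{pCat}_c(\mathcal C)$; $\mathrm{peCat}_c(\mathcal C)$ is its full subcategory on the source-étale partite internal categories. **Externalisation.** The functor $\Phi\colon\mathrm{pCat}_c(\mathcal C)\to\mathrm{rCat}/\!/\mathcal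 C$ sends $\mathbb A$ to $\pi_{\mathbb A}\colon\Phi\mathbb A\to\mathcal C$. The objects of $\Phi\mathbb A$ are the components of $\mathbb A$; the maps $i\to j$ are the partial sections of $\sigma_{ij}$; the identity of $i$ is $\eta_i$; the composite of $s\colon i\to j$ and $t\colon j\to k$ is $\mu_{ijk}\,\tau_{ij}^*(t)\,s$, where $\tau_{ij}^*(t)=(t\tau_{ij},\overline{t\tau_{ij}})\colon A_{ij}\to A_{jk}\times_{A_j}A_{ij}$; the restriction of $s$ is $\eta_i\bar s$; and $\pi_{\mathbb A}(i)=A_i$, $\pi_{\mathbb A}(s)=\tau_{ij}s$. A cofunctor $F$ is sent to the functor $i\mapsto Fi$, $s\mapsto F_{ij}\,(sF_i,\overline{sF_i})$, with the natural transformation whose components are the $F_i$. **Internalisation.** For $P\colon\mathcal A\to\mathcal C$ in $\mathrm{rCat}/\!/\mathcal C$ and $f,g\colon i\to j$ in $\mathcal A$, put $$[\![f=g]\!]_P=\bigvee\{\,P(e): e\in\mathcal O(i),\ e\leqslant\bar f\bar g,\ fe=ge\,\}\in\mathcal O(Pi).$$ For fixed $i,j$ these form a local atlas on $Pi$ indexed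 by $\mathcal A(i,j)$. An *internalisation* of $P$ is a partite internal category $\Psi P$ whose components are the objects of $\mathcal A$, with $(\Psi P)_i=Pi$ and with $\sigma_{ij}\colon(\Psi P)_{ij}\to Pi$ a glueing of this atlas, with partial sections $(s_f)_{f\in\mathcal A(i,j)}$ as in the definition of a glueing; its targets, identities and composition are determined by $\tau_{ij}s_f=Pf$, $\eta_i=s_{1_i}$ and $s_{gf}=\mu_{ijk}\,\tau_{ij}^*(s_g)\,s_f$. **Theorem.** Let $\mathcal C$ be a join restriction category with local glueings. The functor $\Phi\colon\mathrm{pCat}_c(\mathcal C)\to\mathrm{rCat}/\!/\mathcal C$ has a left adjoint $\Psi$ which sends each $P$ to an internalisation of $P$, up to isomorphism, the unit $P\to\Phi\Psi P$ being the map which sends an arrow $f$ of $\mathcal A$ to $s_f$. Moreover: 1. the unit $P\to\Phi\Psi P$ is invertible if and only if $P\in\mathrm{jrCat}/\!/_h\mathcal C$; 2. the counit $\Psi\Phi\mathbb A\to\mathbb A$ is invertible if and only if $\mathbb A$ is source-étale; 3. each $\Psi P$ is source-étale, each $\Phi\mathbb A$ lies in $\mathrm{jrCat}/\!/_h\mathcal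 C$, and $\Phi$, $\Psi$ with the unit and counit of the adjunction restrict to an equivalence of categories $$\mathrm{peCat}_c(\mathcal C)\;\simeq\;\mathrm{jrCat}/\!/_h\mathcal C ;$$ 4. the adjunction is *Galois*: the counit is invertible at every $\Psi P$, and the unit is invertible at every $\Phi\mathbb A$. Consequently $\mathrm{jrCat}/\!/_h\mathcal C$ is reflective in $\mathrm{rCat}/\!/\mathcal C$ via $\Phi\Psi$, with the unit of $\Psi\dashv\Phi$ as reflection, and $\mathrm{peCat}_c(\mathcal C)$ is coreflective in $\mathrm{pCat}_c(\mathcal C)$ via $\Psi\Phi$, with the counit of $\Psi\dashv\Phi$ as coreflection. -/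

import Mathlib

open CategoryTheory CategoryTheory.Limits

universe w v u

namespace JoinRestriction

/-! Composition is written in diagrammatic order: `f ≫ g` is the composite `g ∘ f`. -/

/-! ### Maps into pullbacks -/

section Lift

variable {C : Type u} [Category.{v} C]

theorem comp_lift {A B X Y Z : C} (f : A ⟶ X) (g : B ⟶ X) [HasPullback f g] (c : Z ⟶ Y)
    (a : Y ⟶ A) (b : Y ⟶ B) (h : a ≫ f = b ≫ g) :
    c ≫ pullback.lift a b h =
      pullback.lift (c ≫ a) (c ≫ b) (by rw [Category.assoc, h, Category.assoc]) := by
  apply pullback.hom_ext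
  · rw [Category.assoc, pullback.lift_fst, pullback.lift_fst]
  · rw [Category.assoc, pullback.lift_snd, pullback.lift_snd]

theorem comp_lift_assoc {A B X Y Z W : C} (f : A ⟶ X) (g : B ⟶ X) [HasPullback f g] (c : Z ⟶ Y)
    (a : Y ⟶ A) (b : Y ⟶ B) (h : a ≫ f = b ≫ g) (k : pullback f g ⟶ W) :
    c ≫ pullback.lift a b h ≫ k =
      pullback.lift (c ≫ a) (c ≫ b) (by rw [Category.assoc, h, Category.assoc]) ≫ k := by
  rw [← comp_lift, Category.assoc]

theorem lift_fst_snd {A B X Y : C} (f : A ⟶ X) (g : B ⟶ X) [HasPullback f g]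
    (c : Y ⟶ pullback f g) : pullback.lift (c ≫ pullback.fst f g) (c ≫ pullback.snd f g)
      (by rw [Category.assoc, pullback.condition, Category.assoc]) = c := by
  apply pullback.hom_ext
  · rw [pullback.lift_fst]
  · rw [pullback.lift_snd]

end Lift

/-! ### Restriction categories -/

/-- A restriction category: `rest f : A ⟶ A` is the restriction of `f : A ⟶ B`. -/
class RestrictionCategory (C : Type u) [Category.{v} C] where
  rest : ∀ {A B : C}, (A ⟶ B) → (A ⟶ A)
  rest_comp : ∀ {A B : C} (f : A ⟶ B), rest f ≫ f = f
  rest_comm : ∀ {A B B' : C} (f : A ⟶ B) (g : A ⟶ B'), rest g ≫ rest f = rest f ≫ rest g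
  rest_rest_comp : ∀ {A B B' : C} (f : A ⟶ B) (g : A ⟶ B'),
    rest (rest f ≫ g) = rest f ≫ rest g
  comp_rest : ∀ {A B B' : C} (f : A ⟶ B) (g : B ⟶ B'), f ≫ rest g = rest (f ≫ g) ≫ f

open RestrictionCategory

section Basic

variable {C : Type u} [Category.{v} C] [RestrictionCategory C]

theorem rest_idem {A B : C} (f : A ⟶ B) : rest f ≫ rest f = rest f := by
  rw [← rest_rest_comp, rest_comp]

theorem rest_id (A : C) : rest (𝟙 A) = 𝟙 A := by
  have h := rest_comp (𝟙 A)
  rwa [Category.comp_id] at h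

theorem rest_rest {A B : C} (f : A ⟶ B) : rest (rest f) = rest f := by
  have h := rest_rest_comp f (𝟙 A)
  rwa [rest_id, Category.comp_id] at h

/-- `rest (f ≫ g) = rest (f ≫ rest g)`. -/
theorem rest_comp_rest {A B B' : C} (f : A ⟶ B) (g : B ⟶ B') :
    rest (f ≫ rest g) = rest (f ≫ g) := by
  have h : rest (f ≫ g) ≫ rest f = rest (f ≫ g) := by
    rw [rest_comm, ← rest_rest_comp, ← Category.assoc, rest_comp]
  rw [comp_rest, rest_rest_comp, h]

/-- The domain of definition of `f ≫ g` is contained in that of `f`. -/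
theorem rest_comp_rest_left {A B B' : C} (f : A ⟶ B) (g : B ⟶ B') :
    rest (f ≫ g) ≫ rest f = rest (f ≫ g) := by
  rw [rest_comm, ← rest_rest_comp, ← Category.assoc, rest_comp]

/-- A map is a restriction idempotent when it is the restriction of some map. -/
def IsRestIdem {A : C} (e : A ⟶ A) : Prop := ∃ (B : C) (f : A ⟶ B), rest f = e

theorem isRestIdem_iff {A : C} (e : A ⟶ A) : IsRestIdem e ↔ rest e = e :=
  ⟨fun ⟨_, f, hf⟩ => by rw [← hf, rest_rest], fun h => ⟨A, e, h⟩⟩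

/-- The set `𝒪(A)` of restriction idempotents of `A`. -/
abbrev RestIdem (A : C) : Type v := {e : A ⟶ A // IsRestIdem e}

/-- Total maps. -/
class IsTotal {A B : C} (f : A ⟶ B) : Prop where
  rest_eq : rest f = 𝟙 A

/-- The canonical partial order on hom-sets: `f ≤ g` when `f` is the restriction of `g` to the
domain of definition of `f`. -/
instance homPartialOrder (A B : C) : PartialOrder (A ⟶ B) where
  le f g := f = rest f ≫ g
  le_refl f := (rest_comp f).symm
  le_trans f g h hfg hgh := by
    have h1 : rest f = rest f ≫ rest g := by
      conv_lhs => rw [hfg]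
      exact rest_rest_comp f g
    change f = rest f ≫ h
    conv_lhs => rw [hfg, hgh]
    rw [← Category.assoc, ← h1]
  le_antisymm f g hfg hgf := by
    have h1 : rest f = rest f ≫ rest g := by
      conv_lhs => rw [hfg]
      exact rest_rest_comp f g
    have h2 : rest g = rest g ≫ rest f := by
      conv_lhs => rw [hgf]
      exact rest_rest_comp g f
    have h3 : rest f = rest g := h1.trans ((rest_comm f g).symm.trans h2.symm)
    rw [hfg, h3, rest_comp]

theorem hom_le_iff {A B : C} (f g : A ⟶ B) : f ≤ g ↔ f = rest f ≫ g := Iff.rfl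

/-- The compatibility relation on parallel maps. -/
def Compatible {A B : C} (f g : A ⟶ B) : Prop := rest g ≫ f = rest f ≫ g

/-- `s'` is a partial inverse of `s`. -/
def IsPartialInverse {A B : C} (s : A ⟶ B) (s' : B ⟶ A) : Prop :=
  s ≫ s' = rest s ∧ s' ≫ s = rest s'

/-- Partial isomorphisms. -/
def IsPartialIso {A B : C} (s : A ⟶ B) : Prop := ∃ s' : B ⟶ A, IsPartialInverse s s'

instance isTotal_id (A : C) : IsTotal (𝟙 A) := ⟨rest_id A⟩

theorem rest_comp_total {A B B' : C} (f : A ⟶ B) (g : B ⟶ B') [IsTotal g] :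
    rest (f ≫ g) = rest f := by
  rw [← rest_comp_rest, IsTotal.rest_eq (f := g), Category.comp_id]

instance isTotal_comp {A B B' : C} (f : A ⟶ B) (g : B ⟶ B') [IsTotal f] [IsTotal g] :
    IsTotal (f ≫ g) :=
  ⟨by rw [rest_comp_total, IsTotal.rest_eq]⟩

theorem IsTotal.of_comp {A B B' : C} (f : A ⟶ B) (g : B ⟶ B') (h : IsTotal (f ≫ g)) :
    IsTotal f :=
  ⟨by
    have h1 := rest_comp_rest_left f g
    rwa [h.rest_eq, Category.id_comp] at h1⟩

/-- The projections of a pullback of total maps are total. -/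
instance isTotal_pullback_fst {A B X : C} (f : A ⟶ X) (g : B ⟶ X) [HasPullback f g]
    [IsTotal f] [IsTotal g] : IsTotal (pullback.fst f g) := by
  have h : rest (pullback.fst f g) = rest (pullback.snd f g) := by
    rw [← rest_comp_total (pullback.fst f g) f, pullback.condition, rest_comp_total]
  refine ⟨pullback.hom_ext ?_ ?_⟩
  · rw [rest_comp, Category.id_comp]
  · rw [h, rest_comp, Category.id_comp]

instance isTotal_pullback_snd {A B X : C} (f : A ⟶ X) (g : B ⟶ X) [HasPullback f g]
    [IsTotal f] [IsTotal g] : IsTotal (pullback.snd f g) := by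
  have h : rest (pullback.fst f g) = rest (pullback.snd f g) := by
    rw [← rest_comp_total (pullback.fst f g) f, pullback.condition, rest_comp_total]
  exact ⟨by rw [← h, IsTotal.rest_eq]⟩

end Basic

/-- Restriction functors between restriction categories. -/
def IsRestrictionFunctor {A : Type w} [Category.{v} A] [RestrictionCategory A]
    {C : Type u} [Category.{v} C] [RestrictionCategory C] (F : A ⥤ C) : Prop :=
  ∀ {X Y : A} (f : X ⟶ Y), F.map (rest f) = rest (F.map f)

/-- The function `𝒪(X) → 𝒪(F X)` induced by a restriction functor `F`. -/
def mapRestIdem {A : Type w} [Category.{v} A] [RestrictionCategory A]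
    {C : Type u} [Category.{v} C] [RestrictionCategory C] (F : A ⥤ C)
    (hF : IsRestrictionFunctor F) (X : A) (e : RestIdem X) : RestIdem (F.obj X) :=
  ⟨F.map e.1, by
    obtain ⟨_, B, f, rfl⟩ := e
    exact ⟨F.obj B, F.map f, (hF f).symm⟩⟩

/-! ### Join restriction categories and local glueings -/

/-- A restriction category is a join restriction category when every pairwise compatible family
of parallel maps has a join for the canonical order, and these joins are preserved by
precomposition. -/
class IsJoinRestrictionCategory (C : Type u) [Category.{v} C] [RestrictionCategory C] : Prop where
  exists_join : ∀ {A B : C} (S : Set (A ⟶ B)),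
    (∀ f ∈ S, ∀ g ∈ S, Compatible f g) → ∃ h : A ⟶ B, IsLUB S h
  precomp_join : ∀ {A' A B : C} (g : A' ⟶ A) (S : Set (A ⟶ B)) (h : A ⟶ B),
    (∀ f ∈ S, ∀ f' ∈ S, Compatible f f') → IsLUB S h →
      IsLUB ((fun f : A ⟶ B => g ≫ f) '' S) (g ≫ h)

section Local

variable {C : Type u} [Category.{v} C] [RestrictionCategory C]

/-- Local homeomorphisms: total maps which are joins of partial isomorphisms. -/
def IsLocalHomeo {A X : C} (p : A ⟶ X) : Prop :=
  IsTotal p ∧ ∃ S : Set (A ⟶ X), (∀ q ∈ S, IsPartialIso q) ∧ IsLUB S p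

/-- A local atlas on `X` with index set `I`. -/
structure LocalAtlas (X : C) (I : Type w) where
  φ : I → I → (X ⟶ X)
  restIdem : ∀ i j, IsRestIdem (φ i j)
  symm : ∀ i j, φ i j = φ j i
  trans : ∀ i j k, φ i j ≫ φ j k ≤ φ i k

/-- The total map `p : A ⟶ X` is a join of partial isomorphisms `q i` with partial inverses
`s i`, and the local atlas `s i ≫ q j` which it induces is `φ`. -/
def IsGlueingWith {X : C} {I : Type w} (φ : LocalAtlas X I) {A : C} (p : A ⟶ X)
    (s : I → (X ⟶ A)) : Prop :=
  IsTotal p ∧ ∃ q : I → (A ⟶ X), (∀ i, IsPartialInverse (q i) (s i)) ∧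
    IsLUB (Set.range q) p ∧ ∀ i j, φ.φ i j = s i ≫ q j

/-- `p : A ⟶ X` is a glueing of the local atlas `φ`. -/
def IsGlueing {X : C} {I : Type w} (φ : LocalAtlas X I) {A : C} (p : A ⟶ X) : Prop :=
  ∃ s : I → (X ⟶ A), IsGlueingWith φ p s

end Local

/-- `C` has local glueings: every local atlas, indexed by a set of the size of the hom-sets
of `C`, has a glueing. -/
class HasLocalGlueings (C : Type u) [Category.{v} C] [RestrictionCategory C] : Prop where
  exists_glueing : ∀ (X : C) (I : Type v) (φ : LocalAtlas X I),
    ∃ (A : C) (p : A ⟶ X), IsGlueing φ p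

/-! ### Restriction categories over a base -/

/-- A restriction category together with a restriction functor to `C`. -/
structure RCatOver (C : Type u) [Category.{v} C] [RestrictionCategory C] where
  carrier : Type w
  [category : Category.{v} carrier]
  [restrictionCategory : RestrictionCategory carrier]
  proj : carrier ⥤ C
  map_rest : IsRestrictionFunctor proj

attribute [instance] RCatOver.category RCatOver.restrictionCategory

namespace RCatOver

variable {C : Type u} [Category.{v} C] [RestrictionCategory C]

/-- A lax-commutative triangle: a restriction functor over `C` up to a total natural
transformation. -/
structure Hom (P Q : RCatOver.{w} C) where
  functor : P.carrier ⥤ Q.carrier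
  map_rest : IsRestrictionFunctor functor
  trans : functor ⋙ Q.proj ⟶ P.proj
  isTotal : ∀ i, IsTotal (trans.app i)

/-- The identity triangle. -/
def Hom.id (P : RCatOver.{w} C) : Hom P P where
  functor := 𝟭 P.carrier
  map_rest _ := rfl
  trans := 𝟙 P.proj
  isTotal i := isTotal_id (P.proj.obj i)

/-- Composition of lax-commutative triangles by pasting. -/
def Hom.comp {P Q R : RCatOver.{w} C} (F : Hom P Q) (G : Hom Q R) : Hom P R where
  functor := F.functor ⋙ G.functor
  map_rest f := by
    rw [Functor.comp_map, F.map_rest, G.map_rest, Functor.comp_map]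
  trans := Functor.whiskerLeft F.functor G.trans ≫ F.trans
  isTotal i := by
    have := F.isTotal i
    have := G.isTotal (F.functor.obj i)
    exact isTotal_comp (G.trans.app (F.functor.obj i)) (F.trans.app i)

theorem Hom.ext_of {P Q : RCatOver.{w} C} {F G : Hom P Q} (h : F.functor = G.functor)
    (e : ∀ i, HEq (F.trans.app i) (G.trans.app i)) : F = G := by
  obtain ⟨F, hF, s, hs⟩ := F
  obtain ⟨G, hG, t, ht⟩ := G
  obtain rfl : F = G := h
  obtain rfl : s = t := NatTrans.ext (funext fun i => eq_of_heq (e i))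
  rfl

/-- The category of restriction categories over `C` and lax-commutative triangles. -/
instance : Category (RCatOver.{w} C) where
  Hom := Hom
  id := Hom.id
  comp := Hom.comp
  id_comp F := Hom.ext_of rfl fun i => heq_of_eq (Category.comp_id (F.trans.app i))
  comp_id F := Hom.ext_of rfl fun i => heq_of_eq (Category.id_comp (F.trans.app i))
  assoc F G H := Hom.ext_of rfl fun i => heq_of_eq (Category.assoc
    (H.trans.app (G.functor.obj (F.functor.obj i))) (G.trans.app (F.functor.obj i))
    (F.trans.app i)).symm

end RCatOver

/-- The objects `P : 𝒜 → C` of `RCatOver C` for which `𝒜` is a join restriction category and `P`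
is hyperconnected: it induces bijections `𝒪(i) → 𝒪(P i)`. -/
def isHyperconnectedJoin (C : Type u) [Category.{v} C] [RestrictionCategory C] :
    ObjectProperty (RCatOver.{w} C) := fun P =>
  IsJoinRestrictionCategory P.carrier ∧
    ∀ i : P.carrier, Function.Bijective (mapRestIdem P.proj P.map_rest i)

/-! ### Partite internal categories and cofunctors -/

/-- The underlying graph of a partite internal category: objects of objects, objects of arrows,
and total source and target maps, the source maps having pullbacks along all total maps. -/
structure PartiteGraph (C : Type u) [Category.{v} C] [RestrictionCategory C] where
  I : Type w
  obj : I → C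
  arr : I → I → C
  src : ∀ i j, arr i j ⟶ obj i
  tgt : ∀ i j, arr i j ⟶ obj j
  src_total : ∀ i j, IsTotal (src i j)
  tgt_total : ∀ i j, IsTotal (tgt i j)
  hasPullback : ∀ (i j : I) {X : C} (f : X ⟶ obj i), IsTotal f → HasPullback (src i j) f

section Partite

variable {C : Type u} [Category.{v} C] [RestrictionCategory C]

instance (G : PartiteGraph.{w} C) (i j : G.I) : IsTotal (G.src i j) := G.src_total i j

instance (G : PartiteGraph.{w} C) (i j : G.I) : IsTotal (G.tgt i j) := G.tgt_total i j

instance (G : PartiteGraph.{w} C) (i j : G.I) {X : C} (f : X ⟶ G.obj i) [h : IsTotal f] :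
    HasPullback (G.src i j) f := G.hasPullback i j f h

/-- An `I`-partite internal category in `C`. The fibre product of the arrows from `j` to `k` and
the arrows from `i` to `j` is `pullback (src j k) (tgt i j)`. In the associativity axiom, the
triple fibre product is the pullback of `src k l` along the target map of the binary one. -/
structure PartiteCat (C : Type u) [Category.{v} C] [RestrictionCategory C] where
  G : PartiteGraph.{w} C
  one : ∀ i, G.obj i ⟶ G.arr i i
  one_src : ∀ i, one i ≫ G.src i i = 𝟙 (G.obj i)
  one_tgt : ∀ i, one i ≫ G.tgt i i = 𝟙 (G.obj i)
  comp : ∀ i j k, pullback (G.src j k) (G.tgt i j) ⟶ G.arr i k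
  comp_src : ∀ i j k, comp i j k ≫ G.src i k = pullback.snd _ _ ≫ G.src i j
  comp_tgt : ∀ i j k, comp i j k ≫ G.tgt i k = pullback.fst _ _ ≫ G.tgt j k
  comp_one : ∀ i j, pullback.lift (𝟙 (G.arr i j)) (G.src i j ≫ one i)
    (by rw [Category.assoc, one_tgt, Category.comp_id, Category.id_comp]) ≫ comp i i j =
      𝟙 (G.arr i j)
  one_comp : ∀ i j, pullback.lift (G.tgt i j ≫ one j) (𝟙 (G.arr i j))
    (by rw [Category.assoc, one_src, Category.comp_id, Category.id_comp]) ≫ comp i j j =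
      𝟙 (G.arr i j)
  assoc : ∀ i j k l,
    pullback.lift (f := G.src k l) (g := G.tgt i k)
      (pullback.fst (G.src k l) (pullback.fst (G.src j k) (G.tgt i j) ≫ G.tgt j k))
      (pullback.snd (G.src k l) (pullback.fst (G.src j k) (G.tgt i j) ≫ G.tgt j k) ≫
        comp i j k)
      (by rw [pullback.condition, Category.assoc, comp_tgt]) ≫ comp i k l =
    pullback.lift (f := G.src j l) (g := G.tgt i j)
      (pullback.lift (f := G.src k l) (g := G.tgt j k)
        (pullback.fst (G.src k l) (pullback.fst (G.src j k) (G.tgt i j) ≫ G.tgt j k))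
        (pullback.snd (G.src k l) (pullback.fst (G.src j k) (G.tgt i j) ≫ G.tgt j k) ≫
          pullback.fst (G.src j k) (G.tgt i j))
        (by rw [pullback.condition, Category.assoc]) ≫ comp j k l)
      (pullback.snd (G.src k l) (pullback.fst (G.src j k) (G.tgt i j) ≫ G.tgt j k) ≫
        pullback.snd (G.src j k) (G.tgt i j))
      (by
        rw [Category.assoc, comp_src, pullback.lift_snd_assoc, Category.assoc, Category.assoc,
          pullback.condition]) ≫ comp i j l

namespace PartiteCat

/-- The composite of generalised arrows `f` and `g` (first `f`, then `g`). -/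
noncomputable def mul (A : PartiteCat.{w} C) {i j k : A.G.I} {X : C} (g : X ⟶ A.G.arr j k)
    (f : X ⟶ A.G.arr i j) (h : g ≫ A.G.src j k = f ≫ A.G.tgt i j) : X ⟶ A.G.arr i k :=
  pullback.lift g f h ≫ A.comp i j k

variable (A : PartiteCat.{w} C) {i j k l : A.G.I} {X : C}

theorem mul_src (g : X ⟶ A.G.arr j k) (f : X ⟶ A.G.arr i j) (h) :
    A.mul g f h ≫ A.G.src i k = f ≫ A.G.src i j := by
  rw [mul, Category.assoc, A.comp_src, pullback.lift_snd_assoc]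

theorem mul_tgt (g : X ⟶ A.G.arr j k) (f : X ⟶ A.G.arr i j) (h) :
    A.mul g f h ≫ A.G.tgt i k = g ≫ A.G.tgt j k := by
  rw [mul, Category.assoc, A.comp_tgt, pullback.lift_fst_assoc]

theorem comp_mul {Y : C} (a : Y ⟶ X) (g : X ⟶ A.G.arr j k) (f : X ⟶ A.G.arr i j) (h) :
    a ≫ A.mul g f h = A.mul (a ≫ g) (a ≫ f) (by rw [Category.assoc, h, Category.assoc]) := by
  simp only [mul, comp_lift_assoc]

theorem mul_congr {g g' : X ⟶ A.G.arr j k} {f f' : X ⟶ A.G.arr i j} (hg : g = g') (hf : f = f')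
    (h) : A.mul g f h = A.mul g' f' (by rw [← hg, ← hf, h]) := by
  subst hg hf
  rfl

theorem mul_one (g : X ⟶ A.G.arr i j) (h) :
    A.mul g ((g ≫ A.G.src i j) ≫ A.one i) h = g := by
  have e := congrArg (fun z => g ≫ z) (A.comp_one i j)
  simp only [comp_lift_assoc, Category.comp_id] at e
  simpa only [mul, Category.assoc] using e

theorem one_mul (g : X ⟶ A.G.arr i j) (h) :
    A.mul ((g ≫ A.G.tgt i j) ≫ A.one j) g h = g := by
  have e := congrArg (fun z => g ≫ z) (A.one_comp i j)
  simp only [comp_lift_assoc, Category.comp_id] at e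
  simpa only [mul, Category.assoc] using e

theorem mul_assoc (c : X ⟶ A.G.arr k l) (b : X ⟶ A.G.arr j k) (a : X ⟶ A.G.arr i j)
    (h : b ≫ A.G.src j k = a ≫ A.G.tgt i j) (h' : c ≫ A.G.src k l = b ≫ A.G.tgt j k) :
    A.mul c (A.mul b a h) (by rw [h', mul_tgt]) =
      A.mul (A.mul c b h') a (by rw [mul_src, h]) := by
  have e := congrArg (fun z => pullback.lift (f := A.G.src k l)
    (g := pullback.fst (A.G.src j k) (A.G.tgt i j) ≫ A.G.tgt j k) c (pullback.lift b a h)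
      (by rw [h', pullback.lift_fst_assoc]) ≫ z) (A.assoc i j k l)
  simp only [comp_lift_assoc, pullback.lift_fst, pullback.lift_snd, pullback.lift_snd_assoc] at e
  simpa only [mul] using e

theorem isTotal_comp (i j k : A.G.I) : IsTotal (A.comp i j k) := by
  refine IsTotal.of_comp _ (A.G.src i k) ?_
  rw [A.comp_src]
  infer_instance

theorem isTotal_one (i : A.G.I) : IsTotal (A.one i) := by
  refine IsTotal.of_comp _ (A.G.src i i) ?_
  rw [A.one_src]
  infer_instance

theorem rest_mul (g : X ⟶ A.G.arr j k) (f : X ⟶ A.G.arr i j) (h) :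
    rest (A.mul g f h) = rest g := by
  have := A.isTotal_comp i j k
  rw [mul, rest_comp_total, ← rest_comp_total _ (pullback.fst (A.G.src j k) (A.G.tgt i j)),
    pullback.lift_fst]

end PartiteCat

/-- A partite cofunctor from `A` to `B`. The object of pairs of an arrow `a` of `A` from `i` to
`j` and an object `b` of `B` with `F b = src a` is `pullback (src i j) (onObj i)`. In the
composition axiom, the triple fibre product is the pullback of `src j k` along the target map of
this pullback. -/
structure Cofunctor (A B : PartiteCat.{w} C) where
  onI : A.G.I → B.G.I
  onObj : ∀ i, B.G.obj (onI i) ⟶ A.G.obj i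
  [onObj_total : ∀ i, IsTotal (onObj i)]
  onArr : ∀ i j, pullback (A.G.src i j) (onObj i) ⟶ B.G.arr (onI i) (onI j)
  onArr_total : ∀ i j, IsTotal (onArr i j)
  onArr_src : ∀ i j, onArr i j ≫ B.G.src (onI i) (onI j) = pullback.snd _ _
  onArr_tgt : ∀ i j, onArr i j ≫ B.G.tgt (onI i) (onI j) ≫ onObj j =
    pullback.fst _ _ ≫ A.G.tgt i j
  onArr_one : ∀ i, pullback.lift (onObj i ≫ A.one i) (𝟙 (B.G.obj (onI i)))
    (by rw [Category.assoc, A.one_src, Category.comp_id, Category.id_comp]) ≫ onArr i i =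
      B.one (onI i)
  onArr_comp : ∀ i j k,
    pullback.lift (f := B.G.src (onI j) (onI k)) (g := B.G.tgt (onI i) (onI j))
      (pullback.lift (f := A.G.src j k) (g := onObj j)
        (pullback.fst (A.G.src j k) (pullback.fst (A.G.src i j) (onObj i) ≫ A.G.tgt i j))
        (pullback.snd (A.G.src j k) (pullback.fst (A.G.src i j) (onObj i) ≫ A.G.tgt i j) ≫
          onArr i j ≫ B.G.tgt (onI i) (onI j))
        (by rw [pullback.condition, Category.assoc, Category.assoc, onArr_tgt]) ≫ onArr j k)
      (pullback.snd (A.G.src j k) (pullback.fst (A.G.src i j) (onObj i) ≫ A.G.tgt i j) ≫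
        onArr i j)
      (by rw [Category.assoc, onArr_src, pullback.lift_snd, Category.assoc]) ≫
        B.comp (onI i) (onI j) (onI k) =
    pullback.lift (f := A.G.src i k) (g := onObj i)
      (pullback.lift (f := A.G.src j k) (g := A.G.tgt i j)
        (pullback.fst (A.G.src j k) (pullback.fst (A.G.src i j) (onObj i) ≫ A.G.tgt i j))
        (pullback.snd (A.G.src j k) (pullback.fst (A.G.src i j) (onObj i) ≫ A.G.tgt i j) ≫
          pullback.fst (A.G.src i j) (onObj i))
        (by rw [pullback.condition, Category.assoc]) ≫ A.comp i j k)
      (pullback.snd (A.G.src j k) (pullback.fst (A.G.src i j) (onObj i) ≫ A.G.tgt i j) ≫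
        pullback.snd (A.G.src i j) (onObj i))
      (by
        rw [Category.assoc, A.comp_src, pullback.lift_snd_assoc, Category.assoc, Category.assoc,
          pullback.condition]) ≫ onArr i k

attribute [instance] Cofunctor.onObj_total

namespace Cofunctor

/-- The action of a cofunctor on a generalised arrow `a` of `A` and a generalised object `b` of
`B` lying over its source. -/
noncomputable def act {A B : PartiteCat.{w} C} (F : Cofunctor A B) {i j : A.G.I} {X : C}
    (a : X ⟶ A.G.arr i j) (b : X ⟶ B.G.obj (F.onI i)) (h : a ≫ A.G.src i j = b ≫ F.onObj i) :
    X ⟶ B.G.arr (F.onI i) (F.onI j) :=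
  pullback.lift a b h ≫ F.onArr i j

section

variable {A B : PartiteCat.{w} C} (F : Cofunctor A B) {i j k : A.G.I} {X : C}

theorem act_src (a : X ⟶ A.G.arr i j) (b : X ⟶ B.G.obj (F.onI i)) (h) :
    F.act a b h ≫ B.G.src _ _ = b := by
  rw [act, Category.assoc, F.onArr_src, pullback.lift_snd]

theorem act_tgt (a : X ⟶ A.G.arr i j) (b : X ⟶ B.G.obj (F.onI i)) (h) :
    F.act a b h ≫ B.G.tgt _ _ ≫ F.onObj j = a ≫ A.G.tgt i j := by
  rw [act, Category.assoc, F.onArr_tgt, pullback.lift_fst_assoc]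

theorem comp_act {Y : C} (c : Y ⟶ X) (a : X ⟶ A.G.arr i j) (b : X ⟶ B.G.obj (F.onI i)) (h) :
    c ≫ F.act a b h = F.act (c ≫ a) (c ≫ b) (by rw [Category.assoc, h, Category.assoc]) := by
  simp only [act, comp_lift_assoc]

theorem act_congr {a a' : X ⟶ A.G.arr i j} {b b' : X ⟶ B.G.obj (F.onI i)} (ha : a = a')
    (hb : b = b') (h) : F.act a b h = F.act a' b' (by rw [← ha, ← hb, h]) := by
  subst ha hb
  rfl

theorem act_one (b : X ⟶ B.G.obj (F.onI i)) (h) :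
    F.act ((b ≫ F.onObj i) ≫ A.one i) b h = b ≫ B.one (F.onI i) := by
  have e := congrArg (fun z => b ≫ z) (F.onArr_one i)
  simp only [comp_lift_assoc, Category.comp_id] at e
  simpa only [act, Category.assoc] using e

theorem act_mul (a' : X ⟶ A.G.arr j k) (a : X ⟶ A.G.arr i j) (b : X ⟶ B.G.obj (F.onI i))
    (h : a' ≫ A.G.src j k = a ≫ A.G.tgt i j) (h' : a ≫ A.G.src i j = b ≫ F.onObj i) :
    F.act (A.mul a' a h) b (by rw [A.mul_src, h']) =
      B.mul (F.act a' (F.act a b h' ≫ B.G.tgt _ _)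
        (by rw [h, Category.assoc, act_tgt])) (F.act a b h') (by rw [act_src]) := by
  have e := congrArg (fun z => pullback.lift (f := A.G.src j k)
    (g := pullback.fst (A.G.src i j) (F.onObj i) ≫ A.G.tgt i j) a' (pullback.lift a b h')
      (by rw [h, pullback.lift_fst_assoc]) ≫ z) (F.onArr_comp i j k)
  simp only [comp_lift_assoc, pullback.lift_fst, pullback.lift_snd, pullback.lift_snd_assoc] at e
  simpa only [act, PartiteCat.mul, Category.assoc] using e.symm

theorem rest_act (a : X ⟶ A.G.arr i j) (b : X ⟶ B.G.obj (F.onI i)) (h) :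
    rest (F.act a b h) = rest b := by
  have := F.onArr_total i j
  rw [act, rest_comp_total, ← rest_comp_total _ (pullback.snd (A.G.src i j) (F.onObj i)),
    pullback.lift_snd]

end

/-- Cofunctors with the same function on components agree as soon as their actions on objects and
on arrows agree. -/
theorem ext_of {A B : PartiteCat.{w} C} {f : A.G.I → B.G.I}
    {o o' : ∀ i, B.G.obj (f i) ⟶ A.G.obj i} {ot : ∀ i, IsTotal (o i)}
    {ot' : ∀ i, IsTotal (o' i)} (ho : ∀ i, o i = o' i)
    {m m' t t' s s' g g' n n' c c'}
    (hm : ∀ i j, m i j = (pullback.lift (pullback.fst _ _) (pullback.snd _ _)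
      (pullback.condition.trans (congrArg (fun z => pullback.snd _ _ ≫ z) (ho i)))) ≫ m' i j) :
    (Cofunctor.mk (A := A) (B := B) f o (onObj_total := ot) m t s g n c) =
      Cofunctor.mk f o' (onObj_total := ot') m' t' s' g' n' c' := by
  obtain rfl : o = o' := funext ho
  have : m = m' := by
    funext i j
    rw [hm]
    conv_rhs => rw [← Category.id_comp (m' i j)]
    congr 1
    have e := lift_fst_snd (A.G.src i j) (o i) (𝟙 _)
    simpa only [Category.id_comp] using e
  subst this
  rfl

/-- The identity cofunctor. -/
noncomputable def id (A : PartiteCat.{w} C) : Cofunctor A A where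
  onI i := i
  onObj i := 𝟙 (A.G.obj i)
  onArr i j := pullback.fst (A.G.src i j) (𝟙 (A.G.obj i))
  onArr_total i j := inferInstance
  onArr_src i j := by rw [pullback.condition, Category.comp_id]
  onArr_tgt i j := by rw [Category.comp_id]
  onArr_one i := by rw [pullback.lift_fst, Category.id_comp]
  onArr_comp i j k := by simp only [pullback.lift_fst]

section

variable {A B D : PartiteCat.{w} C} (F : Cofunctor A B) (G : Cofunctor B D)

/-- The action on arrows of a composite cofunctor. -/
noncomputable def compArr (i j : A.G.I) :
    pullback (A.G.src i j) (G.onObj (F.onI i) ≫ F.onObj i) ⟶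
      D.G.arr (G.onI (F.onI i)) (G.onI (F.onI j)) :=
  G.act (F.act (pullback.fst _ _) (pullback.snd _ _ ≫ G.onObj (F.onI i))
    (by rw [pullback.condition, Category.assoc])) (pullback.snd _ _) (by rw [act_src])

theorem lift_compArr {i j : A.G.I} {X : C} (a : X ⟶ A.G.arr i j)
    (c : X ⟶ D.G.obj (G.onI (F.onI i)))
    (h : a ≫ A.G.src i j = c ≫ G.onObj (F.onI i) ≫ F.onObj i) :
    pullback.lift a c h ≫ compArr F G i j =
      G.act (F.act a (c ≫ G.onObj (F.onI i)) (by rw [h, Category.assoc])) c (by rw [act_src]) := by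
  simp only [compArr, comp_act, pullback.lift_fst, pullback.lift_snd, pullback.lift_snd_assoc]

theorem act_act_mul {i j k : A.G.I} {X : C} (a' : X ⟶ A.G.arr j k) (a : X ⟶ A.G.arr i j)
    (c : X ⟶ D.G.obj (G.onI (F.onI i))) (h : a' ≫ A.G.src j k = a ≫ A.G.tgt i j)
    (h' : a ≫ A.G.src i j = (c ≫ G.onObj (F.onI i)) ≫ F.onObj i)
    (d : X ⟶ D.G.arr (G.onI (F.onI i)) (G.onI (F.onI j)))
    (hd : d = G.act (F.act a (c ≫ G.onObj (F.onI i)) h') c (by rw [act_src]))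
    (e : X ⟶ D.G.obj (G.onI (F.onI j))) (he : e = d ≫ D.G.tgt _ _) (h1) (h2) :
    D.mul (G.act (F.act a' (e ≫ G.onObj (F.onI j)) h1) e (by rw [act_src])) d
        (by rw [act_src, he]) =
      G.act (F.act (A.mul a' a h) (c ≫ G.onObj (F.onI i)) h2) c (by rw [act_src]) := by
  subst hd he
  rw [G.act_congr (F.act_mul a' a (c ≫ G.onObj (F.onI i)) h h') rfl,
    G.act_mul _ _ _ _ (by rw [act_src])]
  refine D.mul_congr (G.act_congr (F.act_congr rfl ?_ _) rfl _) rfl _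
  rw [Category.assoc, act_tgt]

/-- The composite of two cofunctors. -/
noncomputable def comp : Cofunctor A D where
  onI i := G.onI (F.onI i)
  onObj i := G.onObj (F.onI i) ≫ F.onObj i
  onArr i j := compArr F G i j
  onArr_total i j := by
    refine IsTotal.of_comp _ (D.G.src _ _) ?_
    rw [compArr, act_src]
    infer_instance
  onArr_src i j := by rw [compArr, act_src]
  onArr_tgt i j := by
    have e : compArr F G i j ≫ D.G.tgt _ _ ≫ G.onObj (F.onI j) ≫ F.onObj j =
        (compArr F G i j ≫ D.G.tgt _ _ ≫ G.onObj (F.onI j)) ≫ F.onObj j := by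
      simp only [Category.assoc]
    rw [e, compArr, act_tgt, Category.assoc, act_tgt]
  onArr_one i := by
    rw [lift_compArr]
    have h1 := F.act_one (G.onObj (F.onI i)) (by simp only [Category.assoc, A.one_src,
      Category.comp_id])
    have h2 := G.act_one (𝟙 (D.G.obj (G.onI (F.onI i)))) (by simp only [Category.assoc, B.one_src,
      Category.comp_id, Category.id_comp])
    simp only [Category.id_comp] at h2
    rw [← h2]
    refine act_congr _ ?_ rfl _
    rw [← h1]
    exact act_congr _ rfl (Category.id_comp _) _
  onArr_comp i j k := by
    simp only [lift_compArr]
    have hd : pullback.snd (A.G.src j k) (pullback.fst (A.G.src i j)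
        (G.onObj (F.onI i) ≫ F.onObj i) ≫ A.G.tgt i j) ≫ compArr F G i j = _ :=
      (comp_act G _ _ _ _).trans (G.act_congr ((comp_act F _ _ _ _).trans
        (F.act_congr rfl (Category.assoc _ _ _).symm _)) rfl _)
    exact act_act_mul F G _ _ _ (by rw [pullback.condition, Category.assoc])
      (by simp only [Category.assoc, pullback.condition]) _ hd _
      (Category.assoc _ _ _).symm _ _

end

theorem id_act {A : PartiteCat.{w} C} {i j : A.G.I} {X : C} (a : X ⟶ A.G.arr i j)
    (b : X ⟶ A.G.obj i) (h) : (Cofunctor.id A).act a b h = a :=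
  pullback.lift_fst (f := A.G.src i j) (g := 𝟙 (A.G.obj i)) a b h

theorem act_comp {A B D : PartiteCat.{w} C} (F : Cofunctor A B) (G : Cofunctor B D)
    {i j : A.G.I} {X : C} (a : X ⟶ A.G.arr i j) (c : X ⟶ D.G.obj (G.onI (F.onI i))) (h) :
    (F.comp G).act a c h = G.act (F.act a (c ≫ G.onObj (F.onI i))
      (h.trans (Category.assoc _ _ _).symm)) c (by rw [act_src]) :=
  lift_compArr F G a c h

end Cofunctor

/-- The category of partite internal categories in `C` and partite cofunctors. -/
noncomputable instance : Category (PartiteCat.{w} C) where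
  Hom := Cofunctor
  id := Cofunctor.id
  comp := Cofunctor.comp
  id_comp F := Cofunctor.ext_of (fun i => Category.comp_id (F.onObj i)) fun i j =>
    F.act_congr (Cofunctor.id_act _ _ _) rfl _
  comp_id F := Cofunctor.ext_of (fun i => Category.id_comp (F.onObj i)) fun i j =>
    (Cofunctor.id_act _ _ _).trans (F.act_congr rfl (Category.comp_id _) _)
  assoc F G H := Cofunctor.ext_of (fun i => (Category.assoc _ _ _).symm) fun i j => by
    refine Eq.trans ?_ (Cofunctor.lift_compArr F (G.comp H) _ _ _).symm
    refine H.act_congr ((Cofunctor.act_comp F G _ _ _).trans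
      (G.act_congr (F.act_congr rfl ?_ _) rfl _)) rfl _ |>.trans
        (Cofunctor.act_comp G H _ _ _).symm
    exact Category.assoc _ _ _

/-- The source-étale partite internal categories: all source maps are local homeomorphisms. -/
def isSourceEtale (C : Type u) [Category.{v} C] [RestrictionCategory C] :
    ObjectProperty (PartiteCat.{w} C) := fun A => ∀ i j, IsLocalHomeo (A.G.src i j)

/-! ### Externalisation -/

/-- Partial sections of a map. -/
@[ext]
structure PartialSection {A X : C} (p : A ⟶ X) : Type v where
  hom : X ⟶ A
  comp_eq : hom ≫ p = rest hom

/-- The pullback `(s f, rest (s f))` of a partial section `s` of `p` along `f`. -/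
noncomputable def pullbackSection {A X Y : C} {p : A ⟶ X} (s : PartialSection p) (f : Y ⟶ X)
    [HasPullback p f] : Y ⟶ pullback p f :=
  pullback.lift (f ≫ s.hom) (rest (f ≫ s.hom)) (by rw [Category.assoc, s.comp_eq, comp_rest])

namespace PartiteCat

variable (A : PartiteCat.{w} C)

/-- The composite of partial sections `s` and then `t`. -/
noncomputable def sectionComp {i j k : A.G.I} (s : PartialSection (A.G.src i j))
    (t : PartialSection (A.G.src j k)) : A.G.obj i ⟶ A.G.arr i k :=
  s.hom ≫ pullbackSection t (A.G.tgt i j) ≫ A.comp i j k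

theorem sectionComp_cond {i j k : A.G.I} (s : PartialSection (A.G.src i j))
    (t : PartialSection (A.G.src j k)) :
    (s.hom ≫ A.G.tgt i j ≫ t.hom) ≫ A.G.src j k =
      (rest (s.hom ≫ A.G.tgt i j ≫ t.hom) ≫ s.hom) ≫ A.G.tgt i j := by
  simp only [Category.assoc, t.comp_eq]
  rw [← Category.assoc, comp_rest, Category.assoc]

theorem sectionComp_eq {i j k : A.G.I} (s : PartialSection (A.G.src i j))
    (t : PartialSection (A.G.src j k)) :
    A.sectionComp s t = A.mul (s.hom ≫ A.G.tgt i j ≫ t.hom)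
      (rest (s.hom ≫ A.G.tgt i j ≫ t.hom) ≫ s.hom) (A.sectionComp_cond s t) := by
  simp only [sectionComp, pullbackSection, comp_lift_assoc, comp_rest, mul]

theorem comp_sectionComp_cond {i j k : A.G.I} {X : C} (h : X ⟶ A.G.obj i)
    (s : PartialSection (A.G.src i j)) (t : PartialSection (A.G.src j k)) :
    (h ≫ s.hom ≫ A.G.tgt i j ≫ t.hom) ≫ A.G.src j k =
      (rest (h ≫ s.hom ≫ A.G.tgt i j ≫ t.hom) ≫ h ≫ s.hom) ≫ A.G.tgt i j := by
  have e := comp_rest (h ≫ s.hom ≫ A.G.tgt i j) t.hom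
  simp only [Category.assoc] at e
  simp only [Category.assoc, t.comp_eq, e]

theorem comp_sectionComp {i j k : A.G.I} {X : C} (h : X ⟶ A.G.obj i)
    (s : PartialSection (A.G.src i j)) (t : PartialSection (A.G.src j k)) :
    h ≫ A.sectionComp s t = A.mul (h ≫ s.hom ≫ A.G.tgt i j ≫ t.hom)
      (rest (h ≫ s.hom ≫ A.G.tgt i j ≫ t.hom) ≫ h ≫ s.hom)
      (A.comp_sectionComp_cond h s t) := by
  rw [sectionComp_eq, comp_mul]
  refine A.mul_congr rfl ?_ _
  rw [← Category.assoc, comp_rest, Category.assoc]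

theorem rest_sectionComp {i j k : A.G.I} (s : PartialSection (A.G.src i j))
    (t : PartialSection (A.G.src j k)) :
    rest (A.sectionComp s t) = rest (s.hom ≫ A.G.tgt i j ≫ t.hom) := by
  rw [sectionComp_eq, rest_mul]

theorem sectionComp_tgt {i j k : A.G.I} (s : PartialSection (A.G.src i j))
    (t : PartialSection (A.G.src j k)) :
    A.sectionComp s t ≫ A.G.tgt i k = s.hom ≫ A.G.tgt i j ≫ t.hom ≫ A.G.tgt j k := by
  rw [sectionComp_eq, mul_tgt]
  simp only [Category.assoc]

theorem sectionComp_src {i j k : A.G.I} (s : PartialSection (A.G.src i j))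
    (t : PartialSection (A.G.src j k)) :
    A.sectionComp s t ≫ A.G.src i k = rest (A.sectionComp s t) := by
  rw [rest_sectionComp, sectionComp_eq, mul_src, Category.assoc, s.comp_eq, rest_comp_rest_left]

theorem one_section (i : A.G.I) : A.one i ≫ A.G.src i i = rest (A.one i) := by
  rw [A.one_src, (A.isTotal_one i).rest_eq]

/-- The composite of partial sections `s` and then `t`, as a partial section. -/
noncomputable def extComp {i j k : A.G.I} (s : PartialSection (A.G.src i j))
    (t : PartialSection (A.G.src j k)) : PartialSection (A.G.src i k) :=
  ⟨A.sectionComp s t, A.sectionComp_src s t⟩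

@[simp]
theorem extComp_hom {i j k : A.G.I} (s : PartialSection (A.G.src i j))
    (t : PartialSection (A.G.src j k)) : (A.extComp s t).hom = A.sectionComp s t := rfl

/-- The identity partial section. -/
def extId (i : A.G.I) : PartialSection (A.G.src i i) := ⟨A.one i, A.one_section i⟩

/-- The restriction of the partial section `s`, as a partial section. -/
def extRest {i j : A.G.I} (s : PartialSection (A.G.src i j)) : PartialSection (A.G.src i i) :=
  ⟨rest s.hom ≫ A.one i, by
    have := A.isTotal_one i
    rw [Category.assoc, A.one_src, Category.comp_id, rest_comp_total, rest_rest]⟩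

theorem extRest_comp {i j k : A.G.I} (t : PartialSection (A.G.src i j))
    (s : PartialSection (A.G.src i k)) : A.sectionComp (A.extRest t) s = rest t.hom ≫ s.hom := by
  have h : (A.extRest t).hom ≫ A.G.tgt i i ≫ s.hom = rest t.hom ≫ s.hom := by
    simp only [extRest, Category.assoc, ← Category.assoc (A.one i), A.one_tgt, Category.id_comp]
  rw [sectionComp_eq, ← A.mul_one (rest t.hom ≫ s.hom) (by
    simp only [Category.assoc, A.one_tgt, Category.comp_id])]
  refine A.mul_congr h ?_ _
  rw [h, Category.assoc, Category.assoc, reassoc_of% s.comp_eq]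
  simp only [extRest]
  rw [rest_rest_comp, ← Category.assoc, Category.assoc (rest t.hom),
    rest_comm, ← Category.assoc, rest_idem, Category.assoc]

theorem comp_extRest {i j k : A.G.I} (s : PartialSection (A.G.src i j))
    (t : PartialSection (A.G.src j k)) :
    A.sectionComp s (A.extRest t) = rest (s.hom ≫ A.G.tgt i j ≫ t.hom) ≫ s.hom := by
  have := A.isTotal_one j
  have h : s.hom ≫ A.G.tgt i j ≫ (A.extRest t).hom =
      (rest (s.hom ≫ A.G.tgt i j ≫ t.hom) ≫ s.hom ≫ A.G.tgt i j) ≫ A.one j := by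
    simp only [extRest, ← Category.assoc]
    rw [comp_rest (s.hom ≫ A.G.tgt i j) t.hom]
    simp only [Category.assoc]
  have h' : rest (s.hom ≫ A.G.tgt i j ≫ (A.extRest t).hom) = rest (s.hom ≫ A.G.tgt i j ≫ t.hom) := by
    simp only [extRest, ← Category.assoc]
    rw [rest_comp_total, rest_comp_rest]
  rw [sectionComp_eq, ← A.one_mul (rest (s.hom ≫ A.G.tgt i j ≫ t.hom) ≫ s.hom) (by
    simp only [Category.assoc, A.one_src, Category.comp_id])]
  refine A.mul_congr ?_ ?_ _
  · rw [h]
    simp only [Category.assoc]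
  · rw [h']

theorem extId_comp {i j : A.G.I} (s : PartialSection (A.G.src i j)) :
    A.sectionComp (A.extId i) s = s.hom := by
  have h : (A.extId i).hom ≫ A.G.tgt i i ≫ s.hom = s.hom := by
    simp only [extId, ← Category.assoc, A.one_tgt, Category.id_comp]
  rw [sectionComp_eq]
  conv_rhs => rw [← A.mul_one s.hom (by simp only [Category.assoc, A.one_tgt, Category.comp_id])]
  refine A.mul_congr h ?_ _
  rw [h, s.comp_eq, extId]

theorem comp_extId {i j : A.G.I} (s : PartialSection (A.G.src i j)) :
    A.sectionComp s (A.extId j) = s.hom := by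
  have := A.isTotal_one j
  rw [sectionComp_eq]
  conv_rhs => rw [← A.one_mul s.hom (by simp only [Category.assoc, A.one_src, Category.comp_id])]
  refine A.mul_congr ?_ ?_ _
  · simp only [extId, Category.assoc]
  · simp only [extId]
    rw [rest_comp_total, rest_comp]

theorem ext_assoc {i j k l : A.G.I} (s : PartialSection (A.G.src i j))
    (t : PartialSection (A.G.src j k)) (r : PartialSection (A.G.src k l)) :
    A.sectionComp (A.extComp s t) r = A.sectionComp s (A.extComp t r) := by
  have ht : A.sectionComp s t ≫ A.G.tgt i k ≫ r.hom =
      s.hom ≫ A.G.tgt i j ≫ t.hom ≫ A.G.tgt j k ≫ r.hom := by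
    have e := congrArg (fun z => z ≫ r.hom) (A.sectionComp_tgt s t)
    simpa only [Category.assoc] using e
  have hl : s.hom ≫ A.G.tgt i j ≫ A.sectionComp t r = _ :=
    (Category.assoc _ _ _).symm.trans (A.comp_sectionComp (s.hom ≫ A.G.tgt i j) t r)
  have hx : rest (s.hom ≫ A.G.tgt i j ≫ t.hom ≫ A.G.tgt j k ≫ r.hom) ≫
      rest (s.hom ≫ A.G.tgt i j ≫ t.hom) =
        rest (s.hom ≫ A.G.tgt i j ≫ t.hom ≫ A.G.tgt j k ≫ r.hom) := by
    have e := rest_comp_rest_left (s.hom ≫ A.G.tgt i j ≫ t.hom) (A.G.tgt j k ≫ r.hom)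
    simpa only [Category.assoc] using e
  have hr : rest (s.hom ≫ A.G.tgt i j ≫ A.sectionComp t r) =
      rest (s.hom ≫ A.G.tgt i j ≫ t.hom ≫ A.G.tgt j k ≫ r.hom) := by
    rw [hl, rest_mul]
    simp only [Category.assoc]
  rw [sectionComp_eq, sectionComp_eq A s]
  simp only [extComp_hom, ht, hr]
  rw [A.mul_congr rfl ((congrArg _ (A.sectionComp_eq s t)).trans (A.comp_mul _ _ _ _)),
    A.mul_congr hl rfl, ← A.mul_assoc]
  · refine A.mul_congr ?_ (A.mul_congr ?_ ?_ _) _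
    · simp only [Category.assoc]
    · simp only [Category.assoc]
    · rw [← Category.assoc, hx]

/-- The set of objects of the externalisation of `A` is the set of components of `A`. -/
structure Ext : Type w where
  idx : A.G.I

/-- The category of components and partial sections of the source maps. -/
noncomputable instance : Category.{v} A.Ext where
  Hom i j := PartialSection (A.G.src i.idx j.idx)
  id i := A.extId i.idx
  comp s t := A.extComp s t
  id_comp s := PartialSection.ext (A.extId_comp s)
  comp_id s := PartialSection.ext (A.comp_extId s)
  assoc s t r := PartialSection.ext (A.ext_assoc s t r)

theorem Ext.hom_ext {i j : A.Ext} {s t : i ⟶ j} (h : s.hom = t.hom) : s = t :=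
  PartialSection.ext h

theorem Ext.comp_hom {i j k : A.Ext} (s : i ⟶ j) (t : j ⟶ k) :
    (s ≫ t).hom = A.sectionComp s t := rfl

theorem Ext.id_hom (i : A.Ext) : PartialSection.hom (𝟙 i) = A.one i.idx := rfl

noncomputable instance : RestrictionCategory A.Ext where
  rest s := A.extRest s
  rest_comp s := Ext.hom_ext A ((A.extRest_comp s s).trans (rest_comp s.hom))
  rest_comm s t := Ext.hom_ext A <| by
    refine (A.extRest_comp t (A.extRest s)).trans
      (Eq.trans ?_ (A.extRest_comp s (A.extRest t)).symm)
    simp only [extRest]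
    rw [← Category.assoc, ← Category.assoc, rest_comm]
  rest_rest_comp s t := Ext.hom_ext A <| by
    refine Eq.trans ?_ (A.extRest_comp s (A.extRest t)).symm
    change rest (A.sectionComp (A.extRest s) t) ≫ A.one _ = rest s.hom ≫ rest t.hom ≫ A.one _
    rw [extRest_comp, rest_rest_comp, Category.assoc]
  comp_rest s t := Ext.hom_ext A <| by
    refine (A.comp_extRest s t).trans (Eq.trans ?_ (A.extRest_comp (A.extComp s t) s).symm)
    rw [extComp_hom, rest_sectionComp]

theorem Ext.rest_hom {i j : A.Ext} (s : i ⟶ j) : (rest s).hom = rest s.hom ≫ A.one i.idx := rfl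

/-- The projection of the externalisation of `A` to `C`. -/
noncomputable def extProj : A.Ext ⥤ C where
  obj i := A.G.obj i.idx
  map {i j} s := s.hom ≫ A.G.tgt i.idx j.idx
  map_id i := A.one_tgt i.idx
  map_comp {i j k} s t := by
    rw [Ext.comp_hom, sectionComp_tgt]
    simp only [Category.assoc]

/-- The externalisation of `A`, as a restriction category over `C`. -/
noncomputable def externalisation : RCatOver.{w} C where
  carrier := A.Ext
  proj := A.extProj
  map_rest {i j} s := by
    simp only [extProj, Ext.rest_hom, Category.assoc, A.one_tgt, Category.comp_id,
      rest_comp_total]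

end PartiteCat

namespace Cofunctor

variable {A B D : PartiteCat.{w} C} (F : Cofunctor A B)

/-- The action of a cofunctor on partial sections. -/
noncomputable def sectionMap {i j : A.G.I} (s : PartialSection (A.G.src i j)) :
    B.G.obj (F.onI i) ⟶ B.G.arr (F.onI i) (F.onI j) :=
  pullbackSection s (F.onObj i) ≫ F.onArr i j

theorem sectionMap_eq {i j : A.G.I} (s : PartialSection (A.G.src i j)) :
    F.sectionMap s = F.act (F.onObj i ≫ s.hom) (rest (F.onObj i ≫ s.hom))
      (by rw [Category.assoc, s.comp_eq, comp_rest]) := rfl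

theorem rest_sectionMap {i j : A.G.I} (s : PartialSection (A.G.src i j)) :
    rest (F.sectionMap s) = rest (F.onObj i ≫ s.hom) := by
  rw [sectionMap_eq, rest_act, rest_rest]

/-- The image of a partial section under a cofunctor, as a partial section. -/
noncomputable def extMap {i j : A.G.I} (s : PartialSection (A.G.src i j)) :
    PartialSection (B.G.src (F.onI i) (F.onI j)) :=
  ⟨F.sectionMap s, by rw [rest_sectionMap, sectionMap_eq, act_src]⟩

theorem sectionMap_tgt {i j : A.G.I} (s : PartialSection (A.G.src i j)) :
    F.sectionMap s ≫ B.G.tgt _ _ ≫ F.onObj j = F.onObj i ≫ s.hom ≫ A.G.tgt i j := by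
  rw [sectionMap_eq, act_tgt, Category.assoc]

theorem sectionMap_id (i : A.G.I) : F.sectionMap (A.extId i) = B.one (F.onI i) := by
  have := A.isTotal_one i
  have h : rest (F.onObj i ≫ A.one i) = 𝟙 _ := IsTotal.rest_eq
  rw [sectionMap_eq]
  refine Eq.trans (F.act_congr ?_ h _) ((F.act_one (𝟙 _) ?_).trans (Category.id_comp _))
  · rw [Category.id_comp]
    rfl
  · simp only [Category.assoc, A.one_src, Category.comp_id]

theorem comp_sectionMap {i j : A.G.I} {X : C} (h : X ⟶ B.G.obj (F.onI i))
    (s : PartialSection (A.G.src i j)) : h ≫ F.sectionMap s =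
      F.act (h ≫ F.onObj i ≫ s.hom) (h ≫ rest (F.onObj i ≫ s.hom))
        (by
          simp only [Category.assoc, s.comp_eq]
          rw [comp_rest (F.onObj i)]) := by
  rw [sectionMap_eq, comp_act]

theorem sectionMap_comp {i j k : A.G.I} (s : PartialSection (A.G.src i j))
    (t : PartialSection (A.G.src j k)) :
    F.sectionMap (A.extComp s t) = B.sectionComp (F.extMap s) (F.extMap t) := by
  have hl := A.comp_sectionComp (F.onObj i) s t
  have hr : rest (F.onObj i ≫ A.sectionComp s t) =
      rest (F.onObj i ≫ s.hom ≫ A.G.tgt i j ≫ t.hom) := by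
    rw [hl, A.rest_mul]
  have hz : (F.sectionMap s ≫ B.G.tgt _ _) ≫ F.onObj j ≫ t.hom =
      F.onObj i ≫ s.hom ≫ A.G.tgt i j ≫ t.hom := by
    have e := congrArg (fun z => z ≫ t.hom) (F.sectionMap_tgt s)
    simpa only [Category.assoc] using e
  have hzr : rest ((F.sectionMap s ≫ B.G.tgt _ _) ≫ F.sectionMap t) =
      rest (F.onObj i ≫ s.hom ≫ A.G.tgt i j ≫ t.hom) := by
    rw [← rest_comp_rest, rest_sectionMap, rest_comp_rest, hz]
  have hy : rest (F.onObj i ≫ s.hom ≫ A.G.tgt i j ≫ t.hom) ≫ rest (F.onObj i ≫ s.hom) =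
      rest (F.onObj i ≫ s.hom ≫ A.G.tgt i j ≫ t.hom) := by
    have e := rest_comp_rest_left (F.onObj i ≫ s.hom) (A.G.tgt i j ≫ t.hom)
    simpa only [Category.assoc] using e
  have hc : (rest (F.onObj i ≫ s.hom ≫ A.G.tgt i j ≫ t.hom) ≫ F.onObj i ≫ s.hom) ≫
      A.G.src i j = rest (F.onObj i ≫ s.hom ≫ A.G.tgt i j ≫ t.hom) ≫ F.onObj i := by
    rw [Category.assoc, Category.assoc, s.comp_eq, comp_rest, ← Category.assoc, hy]
  have hS : F.act (rest (F.onObj i ≫ s.hom ≫ A.G.tgt i j ≫ t.hom) ≫ F.onObj i ≫ s.hom)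
      (rest (F.onObj i ≫ s.hom ≫ A.G.tgt i j ≫ t.hom)) hc =
      rest (F.onObj i ≫ s.hom ≫ A.G.tgt i j ≫ t.hom) ≫ F.sectionMap s := by
    rw [comp_sectionMap]
    exact F.act_congr rfl hy.symm _
  have hL : F.sectionMap (A.extComp s t) = F.act _ _ _ := F.act_congr hl hr _
  have h1 : (F.extMap s).hom ≫ B.G.tgt _ _ ≫ (F.extMap t).hom =
      (F.sectionMap s ≫ B.G.tgt _ _) ≫ F.sectionMap t := (Category.assoc _ _ _).symm
  rw [hL, F.act_mul _ _ _ (A.comp_sectionComp_cond _ s t) hc, B.sectionComp_eq]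
  refine B.mul_congr ?_ ?_ _
  · rw [h1, comp_sectionMap]
    refine F.act_congr hz.symm ?_ _
    rw [hS, comp_rest, hz, Category.assoc]
  · rw [hS, h1, hzr]
    rfl

theorem sectionMap_rest {i j : A.G.I} (s : PartialSection (A.G.src i j)) :
    F.sectionMap (A.extRest s) = rest (F.sectionMap s) ≫ B.one (F.onI i) := by
  have := A.isTotal_one i
  have h : F.onObj i ≫ (A.extRest s).hom =
      (rest (F.onObj i ≫ s.hom) ≫ F.onObj i) ≫ A.one i := by
    rw [← comp_rest, Category.assoc]
    rfl
  have h' : rest (F.onObj i ≫ (A.extRest s).hom) = rest (F.onObj i ≫ s.hom) := by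
    rw [h, rest_comp_total, rest_comp_total, rest_rest]
  rw [rest_sectionMap]
  refine (F.act_congr h h' _).trans (F.act_one _ ?_)
  simp only [Category.assoc, A.one_src, Category.comp_id]

theorem sectionMap_sectionMap (G : Cofunctor B D) {i j : A.G.I}
    (s : PartialSection (A.G.src i j)) :
    (F.comp G).sectionMap s = G.sectionMap (F.extMap s) := by
  have h : (G.onObj (F.onI i) ≫ F.onObj i) ≫ s.hom =
      G.onObj (F.onI i) ≫ F.onObj i ≫ s.hom := Category.assoc _ _ _
  have h2 : rest (G.onObj (F.onI i) ≫ F.sectionMap s) =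
      rest (G.onObj (F.onI i) ≫ F.onObj i ≫ s.hom) := by
    rw [← rest_comp_rest, rest_sectionMap, rest_comp_rest]
  refine ((F.comp G).act_congr h (congrArg rest h) _).trans ((act_comp F G _ _ _).trans
    (G.act_congr ?_ h2.symm _))
  refine Eq.trans ?_ (F.comp_sectionMap _ s).symm
  exact F.act_congr rfl (comp_rest _ _).symm _

theorem id_sectionMap {i j : A.G.I} (s : PartialSection (A.G.src i j)) :
    (Cofunctor.id A).sectionMap s = s.hom :=
  (id_act _ _ _).trans (Category.id_comp _)

/-- The action of externalisation on cofunctors. -/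
noncomputable def externalisation : RCatOver.Hom A.externalisation B.externalisation where
  functor :=
    { obj := fun i => ⟨F.onI i.idx⟩
      map := fun s => F.extMap s
      map_id := fun i => PartialSection.ext (F.sectionMap_id i.idx)
      map_comp := fun s t => PartialSection.ext (F.sectionMap_comp s t) }
  map_rest s := PartialSection.ext (F.sectionMap_rest s)
  trans :=
    { app := fun i => F.onObj i.idx
      naturality := fun _ _ s => (Category.assoc _ _ _).trans (F.sectionMap_tgt s) }
  isTotal i := F.onObj_total i.idx

end Cofunctor

end Partite

/-- The functor `Φ` sending a partite internal category in `C` to its externalisation, a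
restriction category over `C`. -/
noncomputable def Phi (C : Type u) [Category.{v} C] [RestrictionCategory C] :
    PartiteCat.{w} C ⥤ RCatOver.{w} C where
  obj A := A.externalisation
  map F := Cofunctor.externalisation F
  map_id _ := RCatOver.Hom.ext_of
    (Functor.hext (fun _ => rfl) fun _ _ s =>
      heq_of_eq (PartialSection.ext (Cofunctor.id_sectionMap s)))
    fun _ => HEq.rfl
  map_comp F G := RCatOver.Hom.ext_of
    (Functor.hext (fun _ => rfl) fun _ _ s =>
      heq_of_eq (PartialSection.ext (Cofunctor.sectionMap_sectionMap F G s)))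
    fun _ => HEq.rfl

/-! ### Internalisation -/

section Internalisation

variable {C : Type u} [Category.{v} C] [RestrictionCategory C]

/-- `x` is the equality `⟦f = g⟧` of the parallel maps `f` and `g` with values in `𝒪(P i)`: the
join of the `P e` for `e` a restriction idempotent contained in the domains of `f` and `g` on
which `f` and `g` agree. -/
def IsValuedEquality (P : RCatOver.{w} C) {i j : P.carrier} (f g : i ⟶ j)
    (x : P.proj.obj i ⟶ P.proj.obj i) : Prop :=
  IsLUB {y | ∃ e : i ⟶ i, IsRestIdem e ∧ e ≤ rest f ≫ rest g ∧ e ≫ f = e ≫ g ∧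
    P.proj.map e = y} x

/-- The partite internal category `A` is an internalisation of `P : 𝒜 → C`, the section `s_f`
attached to a map `f` of `𝒜` being `u f`. Its components are the objects of `𝒜` and its objects of
objects are the `P i`, up to the isomorphisms `u.trans`; its source maps are glueings of the
local atlases `⟦f = g⟧` on `P i`, with partial sections `s_f`. The identities `s_f ≫ τ = P f`,
`s_{𝟙} = η` and `s_{f ≫ g} = s_f ≫ τ^*(s_g) ≫ μ`, which then determine the rest of the structure
of `A`, hold because `u` is a map of restriction categories over `C`. -/
structure IsInternalisation (P : RCatOver.{w} C) (A : PartiteCat.{w} C)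
    (u : RCatOver.Hom P A.externalisation) : Prop where
  bijective_obj : Function.Bijective fun i : P.carrier => (u.functor.obj i).idx
  isIso_trans : ∀ i, IsIso (u.trans.app i)
  glueing : ∀ i j : P.carrier, ∃ φ : LocalAtlas (P.proj.obj i) (i ⟶ j),
    (∀ f g : i ⟶ j, IsValuedEquality P f g (φ.φ f g)) ∧
    IsGlueingWith φ
      (A.G.src (u.functor.obj i).idx (u.functor.obj j).idx ≫ u.trans.app i)
      (fun f => inv (u.trans.app i) ≫ (u.functor.map f).hom)

end Internalisation

end JoinRestriction

open JoinRestriction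

/-!
A total map `p : A ⟶ X` is a local homeomorphism exactly when `A` is covered by the images of
partial sections of `p` (`IsSectionCover`), and the overlaps of these images, read on `X`, form a
local atlas of which `p` is a glueing. Maps out of `A`, or out of fibre products over `X`, can then
be compared and defined section by section, since joins are preserved by composition on both sides
(`IsCover.ext`, `exists_glue`). In particular local homeomorphisms have pullbacks along total maps,
which are glueings of the pulled back atlases (`IsSectionCover.hasPullback`).

Let `P : 𝒜 → C`. Glueing the atlases `⟦f = g⟧` gives a graph whose source maps are covered by the
sections `s_f`, and the composition of `𝒜` respects the overlaps of these sections
(`RCatOver.sec_comp_congr`), so that it induces the structure of a partite internal category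
(`GraphSections.toPartiteCat`): the internalisation of `P`. A cofunctor out of a partite internal
category which is covered by a system of sections closed under identities and composition amounts
to its values on objects and on these sections (`Cofunctor.ext_sections`,
`SectionAction.toCofunctor`). For the sections `s_f` the data are those of a map from `P` to an
externalisation: this is the universal property of the unit `f ↦ s_f`
(`RCatOver.bijective_toPhi_comp`), whence the adjunction `psiAdj`. For the system of all partial
sections of a source-étale `A` the data are those of a map out of the externalisation of `A`, so
that `Phi C` is bijective on maps out of `A` (`isSourceEtale.bijective_map`), and this says that
the counit at `A` is invertible. Conversely, internalisations are source-étale, and being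
source-étale is invariant under isomorphism, because the actions on objects and on arrows of an
invertible cofunctor are invertible (`Cofunctor.isIso_onObj_onArr`).

Joins of partial sections are computed in `C`, and restriction idempotents on a component `i`
of `A` correspond to those on `A_i`, so that externalisations are hyperconnected join restriction
categories. If conversely `P` is one, then restriction idempotents and joins in `C` lift to `𝒜`:
maps with the same section are equal on a cover of their domain, and a partial section is a join
of restrictions of sections `s_f`. Hence the unit at `P` is fully faithful and so invertible
(`RCatOver.sec_injective`, `RCatOver.sec_surjective`). The remaining claims hold for every
adjunction whose unit and counit are invertible at the values of the two functors.
-/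

namespace JoinRestriction

open RestrictionCategory

/-! ### Joins of parallel maps -/

section Joins

variable {C : Type u} [Category.{v} C] [RestrictionCategory C]

theorem IsRestIdem.rest_eq {A : C} {e : A ⟶ A} (h : IsRestIdem e) : rest e = e :=
  (isRestIdem_iff e).1 h

theorem isRestIdem_rest {A B : C} (f : A ⟶ B) : IsRestIdem (rest f) := ⟨B, f, rfl⟩

theorem IsRestIdem.of_rest_eq {A : C} {e : A ⟶ A} (h : rest e = e) : IsRestIdem e := ⟨A, e, h⟩

theorem comp_rest_assoc' {A B B' D : C} (f : A ⟶ B) (g : B ⟶ B') (k : B ⟶ D) :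
    f ≫ rest g ≫ k = rest (f ≫ g) ≫ f ≫ k := by
  rw [← Category.assoc, comp_rest, Category.assoc]

theorem rest_comp_assoc' {A B D : C} (f : A ⟶ B) (k : B ⟶ D) : rest f ≫ f ≫ k = f ≫ k := by
  rw [← Category.assoc, rest_comp]

theorem rest_comp_le {A B D : C} (d : A ⟶ D) (g : A ⟶ B) : rest d ≫ g ≤ g := by
  rw [hom_le_iff, rest_rest_comp, Category.assoc, rest_comp]

theorem le_of_eq_rest_comp {A B D : C} {f g : A ⟶ B} (d : A ⟶ D) (h : f = rest d ≫ g) : f ≤ g := by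
  rw [h]
  exact rest_comp_le d g

theorem rest_comp_of_le {A B : C} {f g : A ⟶ B} (h : f ≤ g) : rest f ≫ g = f :=
  ((hom_le_iff f g).1 h).symm

theorem rest_le_rest {A B : C} {f g : A ⟶ B} (h : f ≤ g) : rest f ≤ rest g := by
  refine le_of_eq_rest_comp f ?_
  conv_lhs => rw [← rest_comp_of_le h]
  rw [rest_rest_comp]

theorem comp_le_comp_left {A B D : C} {f g : A ⟶ B} (k : D ⟶ A) (h : f ≤ g) : k ≫ f ≤ k ≫ g := by
  rw [← rest_comp_of_le h, comp_rest_assoc']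
  exact rest_comp_le _ _

theorem comp_le_comp_right {A B D : C} {f g : A ⟶ B} (h : f ≤ g) (k : B ⟶ D) : f ≫ k ≤ g ≫ k := by
  rw [← rest_comp_of_le h, Category.assoc]
  exact rest_comp_le _ _

theorem rest_le_id {A B : C} (f : A ⟶ B) : rest f ≤ 𝟙 A :=
  le_of_eq_rest_comp f (Category.comp_id _).symm

theorem rest_eq_of_le_id {A : C} {e : A ⟶ A} (h : e ≤ 𝟙 A) : rest e = e := by
  rw [← rest_comp_of_le h, Category.comp_id, rest_rest]

/-- On restriction idempotents, `e ≤ rest f` says that `e` is absorbed by `rest f`. -/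
theorem le_rest_iff {A B D : C} (e : A ⟶ D) (f : A ⟶ B) :
    rest e ≤ rest f ↔ rest e ≫ rest f = rest e := by
  rw [hom_le_iff, rest_rest, eq_comm]

theorem rest_comp_le_rest {A B D : C} (f : A ⟶ B) (g : B ⟶ D) : rest (f ≫ g) ≤ rest f :=
  (le_rest_iff _ _).2 (rest_comp_rest_left f g)

theorem compatible_of_le {A B : C} {f g h : A ⟶ B} (hf : f ≤ h) (hg : g ≤ h) :
    Compatible f g := by
  unfold Compatible
  rw [← rest_comp_of_le hf, ← rest_comp_of_le hg]
  simp only [rest_rest_comp, ← Category.assoc]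
  congr 1
  rw [Category.assoc, Category.assoc, rest_comm f h, rest_comm g h, ← Category.assoc,
    rest_comm f g, Category.assoc]

theorem eq_of_le_of_rest_eq {A B : C} {f g : A ⟶ B} (h : f ≤ g) (hr : rest f = rest g) :
    f = g := by
  rw [← rest_comp_of_le h, hr, rest_comp]

theorem IsPartialInverse.comp_eq_right {A X : C} {q : A ⟶ X} {s : X ⟶ A}
    (h : IsPartialInverse q s) : s ≫ rest q = s := by
  rw [← h.1, ← Category.assoc, h.2, rest_comp]

/-- A family of restriction idempotents with join the identity: an open cover of `Z`. -/
structure IsCover {K : Type*} {Z : C} (d : K → (Z ⟶ Z)) : Prop where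
  rest_eq : ∀ k, rest (d k) = d k
  isLUB : IsLUB (Set.range d) (𝟙 Z)

theorem IsCover.isTotal_of_le {K : Type*} {Z Y : C} {d : K → (Z ⟶ Z)} (h : IsCover d) {n : Z ⟶ Y}
    (hn : ∀ k, d k ≤ rest n) : IsTotal n :=
  ⟨le_antisymm (rest_le_id n) (h.isLUB.2 (by rintro _ ⟨k, rfl⟩; exact hn k))⟩

variable [IsJoinRestrictionCategory C]

theorem isLUB_comp_left {A B D : C} {S : Set (A ⟶ B)} {h : A ⟶ B} (hS : IsLUB S h) (g : D ⟶ A) :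
    IsLUB ((fun f => g ≫ f) '' S) (g ≫ h) :=
  IsJoinRestrictionCategory.precomp_join g S h
    (fun _ hf _ hg => compatible_of_le (hS.1 hf) (hS.1 hg)) hS

/-- Taking restrictions preserves joins: if `e` is the join of the restrictions of the members of
`S`, then `e ≫ h` is an upper bound of `S`. -/
theorem isLUB_rest {A B : C} {S : Set (A ⟶ B)} {h : A ⟶ B} (hS : IsLUB S h) :
    IsLUB (rest '' S) (rest h) := by
  have hc : ∀ e ∈ rest '' S, ∀ e' ∈ rest '' S, Compatible e e' := by
    rintro _ ⟨f, hf, rfl⟩ _ ⟨g, hg, rfl⟩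
    exact compatible_of_le (rest_le_rest (hS.1 hf)) (rest_le_rest (hS.1 hg))
  obtain ⟨e, he⟩ := IsJoinRestrictionCategory.exists_join (rest '' S) hc
  have h1 : e ≤ rest h := he.2 (by
    rintro _ ⟨f, hf, rfl⟩
    exact rest_le_rest (hS.1 hf))
  have hre : rest e = e := rest_eq_of_le_id (h1.trans (rest_le_id h))
  have h2 : h ≤ e ≫ h := hS.2 fun f hf => by
    have h3 : rest f ≫ e = rest f := by
      have := rest_comp_of_le (he.1 ⟨f, hf, rfl⟩ : rest f ≤ e)
      rwa [rest_rest] at this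
    refine le_of_eq_rest_comp f ?_
    rw [← Category.assoc, h3, rest_comp_of_le (hS.1 hf)]
  have h4 : h = e ≫ h := le_antisymm h2 (by rw [← hre]; exact rest_comp_le e h)
  have h5 : rest h = e := by
    refine le_antisymm ?_ h1
    rw [h4, ← hre, rest_rest_comp, ← rest_comm]
    exact rest_comp_le h (rest e)
  rwa [h5]

/-- A bounded set of maps whose domains cover that of its bound has this bound as join. -/
theorem isLUB_of_rest {A B : C} {S : Set (A ⟶ B)} {h : A ⟶ B} (hS : ∀ f ∈ S, f ≤ h)
    (hr : IsLUB (rest '' S) (rest h)) : IsLUB S h := by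
  obtain ⟨k, hk⟩ := IsJoinRestrictionCategory.exists_join S
    (fun f hf g hg => compatible_of_le (hS f hf) (hS g hg))
  have h1 : k ≤ h := hk.2 hS
  rwa [← eq_of_le_of_rest_eq h1 ((isLUB_rest hk).unique hr)]

/-- Joins are preserved by postcomposition; preservation by precomposition is an axiom. -/
theorem isLUB_comp_right {A B D : C} {S : Set (A ⟶ B)} {h : A ⟶ B} (hS : IsLUB S h) (g : B ⟶ D) :
    IsLUB ((fun f => f ≫ g) '' S) (h ≫ g) := by
  refine isLUB_of_rest ?_ ?_
  · rintro _ ⟨f, hf, rfl⟩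
    exact comp_le_comp_right (hS.1 hf) g
  · have h1 := isLUB_comp_left (isLUB_rest hS) (rest (h ≫ g))
    rw [rest_comp_rest_left, Set.image_image] at h1
    rw [Set.image_image]
    convert h1 using 1
    refine Set.image_congr fun f hf => ?_
    conv_lhs => rw [← rest_comp_of_le (hS.1 hf)]
    rw [Category.assoc, rest_rest_comp, rest_comm]

/-- Maps which agree after precomposition with the members of `S` agree after precomposition with
the join of `S`. -/
theorem eq_of_isLUB {A B D : C} {S : Set (A ⟶ B)} {h : A ⟶ B} (hS : IsLUB S h) {m m' : B ⟶ D}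
    (hm : ∀ f ∈ S, f ≫ m = f ≫ m') : h ≫ m = h ≫ m' := by
  refine (isLUB_comp_right hS m).unique ?_
  rw [Set.image_congr hm]
  exact isLUB_comp_right hS m'

/-- Maps which agree on an open cover are equal. -/
theorem IsCover.ext {K : Type*} {Z Y : C} {d : K → (Z ⟶ Z)} (h : IsCover d) {m m' : Z ⟶ Y}
    (hm : ∀ k, d k ≫ m = d k ≫ m') : m = m' := by
  rw [← Category.id_comp m, ← Category.id_comp m']
  refine eq_of_isLUB h.isLUB ?_
  rintro _ ⟨k, rfl⟩
  exact hm k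

/-- The pullback of an open cover along a total map. -/
theorem IsCover.pull {K : Type*} {Y Z : C} {d : K → (Z ⟶ Z)} (h : IsCover d) (a : Y ⟶ Z)
    [IsTotal a] : IsCover (fun k => rest (a ≫ d k)) where
  rest_eq k := rest_rest _
  isLUB := by
    have h1 := isLUB_rest (isLUB_comp_left h.isLUB a)
    rwa [Category.comp_id, IsTotal.rest_eq (f := a), ← Set.range_comp, ← Set.range_comp] at h1

/-- Maps `m k`, given on restriction idempotents `d k` and agreeing on overlaps, glue together. The
domain of the glued map is the join of those of the `d k ≫ m k`. -/
theorem exists_glue {K : Type*} {Z Y : C} {d : K → (Z ⟶ Z)} (hd : ∀ k, rest (d k) = d k)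
    (m : K → (Z ⟶ Y)) (hm : ∀ k l, d k ≫ d l ≫ m k = d k ≫ d l ≫ m l) :
    ∃ n : Z ⟶ Y, IsLUB (Set.range fun k => d k ≫ m k) n ∧ ∀ k, d k ≫ n = d k ≫ m k := by
  have hr : ∀ k, rest (d k ≫ m k) = d k ≫ rest (m k) := fun k => by
    conv_lhs => rw [← hd k, rest_rest_comp, hd]
  have hcd : ∀ k l, d k ≫ d l = d l ≫ d k := fun k l => by
    rw [← hd k, ← hd l, rest_comm]
  have hcr : ∀ k {W : C} (f : Z ⟶ W), rest f ≫ d k = d k ≫ rest f := fun k W f => by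
    rw [← hd k, rest_comm]
  have hsw : ∀ k l, d k ≫ d l ≫ rest (m k) = d k ≫ d l ≫ rest (m l) := fun k l => by
    have e := congrArg rest (hm k l)
    rw [← hd k, ← hd l] at e
    simp only [rest_rest_comp] at e
    rwa [hd, hd] at e
  have hc : ∀ f ∈ Set.range (fun k => d k ≫ m k), ∀ g ∈ Set.range (fun k => d k ≫ m k),
      Compatible f g := by
    rintro _ ⟨k, rfl⟩ _ ⟨l, rfl⟩
    change rest (d l ≫ m l) ≫ d k ≫ m k = rest (d k ≫ m k) ≫ d l ≫ m l
    rw [hr, hr]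
    have e1 : (d l ≫ rest (m l)) ≫ d k ≫ m k = d k ≫ d l ≫ m k := by
      rw [Category.assoc, reassoc_of% hcr k (m l), reassoc_of% hcd l k, reassoc_of% (hsw k l).symm,
        rest_comp]
    have e2 : (d k ≫ rest (m k)) ≫ d l ≫ m l = d k ≫ d l ≫ m l := by
      rw [Category.assoc, reassoc_of% hcr l (m k), reassoc_of% hsw k l, rest_comp]
    rw [e1, e2, hm]
  obtain ⟨n, hn⟩ := IsJoinRestrictionCategory.exists_join _ hc
  refine ⟨n, hn, fun k => ?_⟩
  -- on `d k`, the join of the maps `d l ≫ m l` is `m k`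
  have h1 := isLUB_comp_left hn (d k)
  rw [← Set.range_comp] at h1
  refine h1.unique ⟨?_, fun b hb => hb ⟨k, ?_⟩⟩
  · rintro _ ⟨l, rfl⟩
    change d k ≫ d l ≫ m l ≤ _
    rw [← hm, ← Category.assoc, hcd, Category.assoc, ← hd l]
    exact rest_comp_le _ _
  · change d k ≫ d k ≫ m k = _
    rw [← Category.assoc, ← hd k, rest_idem]

/-- Maps whose values at `a` agree on a cover of the codomain of `a` agree on the domain of `a`. -/
theorem IsCover.ext_along {K : Type*} {Z A Y : C} {e : K → (A ⟶ A)} (h : IsCover e) (a : Z ⟶ A)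
    {m m' : Z ⟶ Y} (hm : ∀ k, rest (a ≫ e k) ≫ m = rest (a ≫ e k) ≫ m') :
    rest a ≫ m = rest a ≫ m' := by
  have h1 := isLUB_rest (isLUB_comp_left h.isLUB a)
  rw [Category.comp_id, ← Set.range_comp, ← Set.range_comp] at h1
  refine eq_of_isLUB h1 ?_
  rintro _ ⟨k, rfl⟩
  exact hm k

end Joins

/-! ### Covers by partial sections -/

section SectionCover

variable {C : Type u} [Category.{v} C] [RestrictionCategory C]

/-- The partial sections `s f` of the total map `p : A ⟶ X` cover `A`: the restriction idempotents
`e f`, which are the images of the `s f`, form an open cover of `A`. Such a `p` is a local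
homeomorphism, with local inverses `e f ≫ p` of the `s f`. -/
structure IsSectionCover {A X : C} {J : Type*} (p : A ⟶ X) (s : J → (X ⟶ A))
    (e : J → (A ⟶ A)) : Prop where
  isTotal : IsTotal p
  sec_comp : ∀ f, s f ≫ p = rest (s f)
  isCover : IsCover e
  image_comp : ∀ f, e f ≫ p ≫ s f = e f
  sec_image : ∀ f, s f ≫ e f = s f

variable {A X Y : C} {J : Type*} {p : A ⟶ X} {s : J → (X ⟶ A)} {e : J → (A ⟶ A)}

namespace IsSectionCover

/-- A map into the image of `s f` is determined by its composite with `p`. -/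
theorem eq_comp_sec (h : IsSectionCover p s e) {Z : C} {a : Z ⟶ A} {f : J} (ha : a ≫ e f = a) :
    a = (a ≫ p) ≫ s f := by
  conv_lhs => rw [← ha, ← h.image_comp f, ← Category.assoc, ha]
  rw [Category.assoc]

theorem comp_image_of_eq (h : IsSectionCover p s e) {Z : C} {a : Z ⟶ A} {x : Z ⟶ X} {f : J}
    (ha : a = x ≫ s f) : a ≫ e f = a := by
  rw [ha, Category.assoc, h.sec_image]

theorem rest_comp_image (h : IsSectionCover p s e) {Z : C} (a : Z ⟶ A) (f : J) :
    rest (a ≫ e f) ≫ a = a ≫ e f := by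
  conv_rhs => rw [← h.isCover.rest_eq f, comp_rest]

theorem rest_comp_image_idem (h : IsSectionCover p s e) {Z : C} (a : Z ⟶ A) (f : J) :
    rest (a ≫ e f) ≫ a ≫ e f = rest (a ≫ e f) ≫ a := by
  rw [h.rest_comp_image, rest_comp]

/-- On the part of `Z` which `a` maps to the image of `s f`, the map `a` factors through `s f`. -/
theorem rest_comp_image_eq (h : IsSectionCover p s e) {Z : C} (a : Z ⟶ A) (f : J) :
    rest (a ≫ e f) ≫ a = (rest (a ≫ e f) ≫ a ≫ p) ≫ s f := by
  rw [← Category.assoc _ a p]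
  refine h.eq_comp_sec ?_
  rw [h.rest_comp_image, Category.assoc, ← h.isCover.rest_eq f, rest_idem]

/-- The sections `s f` and `s g` agree where the values of `s f` lie in the image of `s g`. -/
theorem overlap (h : IsSectionCover p s e) {Z : C} (b : Z ⟶ X) (f g : J) :
    rest (b ≫ s f ≫ e g) ≫ b ≫ s f = rest (b ≫ s f ≫ e g) ≫ b ≫ s g := by
  have h1 := h.rest_comp_image_eq (b ≫ s f) g
  simp only [Category.assoc, reassoc_of% h.sec_comp] at h1
  rw [h1, comp_rest_assoc', ← Category.assoc _ (rest (b ≫ s f))]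
  congr 1
  have h2 := rest_comp_rest_left (b ≫ s f) (e g)
  rwa [Category.assoc] at h2

theorem rest_sec_image_le (h : IsSectionCover p s e) (b : Y ⟶ X) (f g : J) :
    rest (b ≫ s f ≫ e g) ≤ rest (b ≫ s g ≫ e f) := by
  rw [le_rest_iff, ← rest_rest_comp]
  have h1 := congrArg (fun z => z ≫ e f) (h.overlap b f g)
  simp only [Category.assoc, h.sec_image] at h1
  rw [← h1, rest_rest_comp]
  have h2 := rest_comp_rest_left (b ≫ s f) (e g)
  rwa [Category.assoc] at h2

theorem rest_sec_image_comm (h : IsSectionCover p s e) (b : Y ⟶ X) (f g : J) :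
    rest (b ≫ s f ≫ e g) = rest (b ≫ s g ≫ e f) :=
  le_antisymm (h.rest_sec_image_le b f g) (h.rest_sec_image_le b g f)

/-- The local atlas on `Y` which is obtained by pulling back along `b : Y ⟶ X` the local atlas
on `X` which is given by the overlaps of the sections `s f`. -/
def atlas (h : IsSectionCover p s e) (b : Y ⟶ X) : LocalAtlas Y J where
  φ f g := rest (b ≫ s f ≫ e g)
  restIdem f g := isRestIdem_rest _
  symm f g := h.rest_sec_image_comm b f g
  trans f g k := by
    have h1 := congrArg (fun z => z ≫ e k) (h.overlap b f g)
    simp only [Category.assoc] at h1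
    rw [← rest_rest_comp, ← h1, rest_rest_comp]
    exact rest_comp_le _ _

/-- If `a` and `c` agree over `X`, and if the values of `a` lie in the images of `s f` and `s g`,
then those of `c` lie in the overlap of the pullbacks of `s f` and `s g` along `b`. -/
theorem comp_rest_overlap (h : IsSectionCover p s e) {Z : C} {a : Z ⟶ A} {f g : J}
    {b : Y ⟶ X} [IsTotal b] {c : Z ⟶ Y} (hc : a ≫ p = c ≫ b) (hf : a ≫ e f = a) (hg : a ≫ e g = a) :
    c ≫ rest (b ≫ s f ≫ e g) = c := by
  have := h.isTotal
  have h1 := (h.eq_comp_sec hf).symm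
  have h2 : c ≫ b ≫ s f ≫ e g = a := by
    rw [← Category.assoc c b, ← hc, ← Category.assoc, h1, hg]
  rw [comp_rest, h2, ← rest_comp_total a p, hc, rest_comp_total, rest_comp]

end IsSectionCover

variable [IsJoinRestrictionCategory C]

/-- The sections of a glueing cover it; the image of `s f` is the domain of its partial inverse. -/
theorem IsGlueingWith.exists_isSectionCover {φ : LocalAtlas X J} (h : IsGlueingWith φ p s) :
    ∃ e : J → (A ⟶ A), IsSectionCover p s e ∧ ∀ f g, rest (s f ≫ e g) = φ.φ f g := by
  obtain ⟨hp, q, hq, hl, hφ⟩ := h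
  have hle : ∀ f, rest (q f) ≫ p = q f := fun f => rest_comp_of_le (hl.1 ⟨f, rfl⟩)
  refine ⟨fun f => rest (q f), ⟨hp, fun f => ?_, ⟨fun f => rest_rest _, ?_⟩, fun f => ?_,
    fun f => (hq f).comp_eq_right⟩, fun f g => ?_⟩
  · rw [← (hq f).2, ← hle, ← Category.assoc, (hq f).comp_eq_right]
  · have h1 := isLUB_rest hl
    rwa [hp.rest_eq, ← Set.range_comp] at h1
  · rw [← Category.assoc, hle, (hq f).1]
  · rw [rest_comp_rest, ← hφ, (φ.restIdem f g).rest_eq]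

theorem IsSectionCover.isLocalHomeo (h : IsSectionCover p s e) : IsLocalHomeo p := by
  refine ⟨h.isTotal, Set.range fun f => e f ≫ p, ?_, ?_⟩
  · rintro _ ⟨f, rfl⟩
    have := h.isTotal
    refine ⟨s f, ?_, ?_⟩
    · rw [Category.assoc, h.image_comp, rest_comp_total, h.isCover.rest_eq]
    · rw [← Category.assoc, h.sec_image, h.sec_comp]
  · have h1 := isLUB_comp_right h.isCover.isLUB p
    rwa [Category.id_comp, ← Set.range_comp] at h1

/-- All partial sections of a local homeomorphism cover it. The image of the partial section `t` is
the join of the restriction idempotents on which `p ≫ t` is the identity. -/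
theorem IsLocalHomeo.exists_isSectionCover (h : IsLocalHomeo p) :
    ∃ e : PartialSection p → (A ⟶ A), IsSectionCover p (fun t => t.hom) e := by
  obtain ⟨hp, S, hS, hl⟩ := h
  have hj : ∀ t : PartialSection p, ∃ e : A ⟶ A,
      IsLUB {d : A ⟶ A | rest d = d ∧ d ≫ p ≫ t.hom = d} e := fun t =>
    IsJoinRestrictionCategory.exists_join _ fun d hd d' hd' =>
      compatible_of_le (h := 𝟙 A) (by rw [← hd.1]; exact rest_le_id d)
        (by rw [← hd'.1]; exact rest_le_id d')
  choose e he using hj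
  have hle : ∀ t, e t ≤ 𝟙 A := fun t => (he t).2 fun d hd => by
    rw [← hd.1]; exact rest_le_id d
  have hee : ∀ t, rest (e t) = e t := fun t => rest_eq_of_le_id (hle t)
  -- a partial inverse of a member of `S` is a partial section
  have hsec : ∀ q ∈ S, ∀ q', IsPartialInverse q q' → q' ≫ p = rest q' := fun q hq q' hqq => by
    rw [← hqq.2, ← rest_comp_of_le (hl.1 hq), ← Category.assoc, hqq.comp_eq_right]
  have hlr := isLUB_rest hl
  rw [hp.rest_eq] at hlr
  refine ⟨e, hp, fun t => t.comp_eq, ⟨hee, ?_⟩, fun t => ?_, fun t => ?_⟩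
  · refine ⟨by rintro _ ⟨t, rfl⟩; exact hle t, fun b hb => hlr.2 ?_⟩
    rintro _ ⟨q, hq, rfl⟩
    obtain ⟨q', hqq⟩ := hS q hq
    refine le_trans ((he ⟨q', hsec q hq q' hqq⟩).1 ⟨rest_rest q, ?_⟩) (hb ⟨_, rfl⟩)
    change rest q ≫ p ≫ q' = rest q
    rw [← Category.assoc, rest_comp_of_le (hl.1 hq), hqq.1]
  · have h1 := isLUB_comp_right (he t) (p ≫ t.hom)
    refine h1.unique ?_
    rw [Set.image_congr (g := id) fun d hd => hd.2, Set.image_id]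
    exact he t
  · refine le_antisymm ?_ ?_
    · conv_rhs => rw [← Category.comp_id t.hom]
      exact comp_le_comp_left _ (hle t)
    · have h1 := isLUB_comp_left hlr t.hom
      rw [Category.comp_id] at h1
      refine h1.2 ?_
      rintro _ ⟨_, ⟨q, hq, rfl⟩, rfl⟩
      obtain ⟨q', hqq⟩ := hS q hq
      have h0 := rest_comp_of_le (hl.1 hq)
      -- on the domain `d` of `t ≫ q`, the section `t` agrees with `q'`
      have hd : t.hom ≫ q = rest (t.hom ≫ q) := by
        conv_lhs => rw [← h0, comp_rest_assoc', t.comp_eq, rest_comp_rest_left]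
      have hdq : rest (t.hom ≫ q) ≫ q' = t.hom ≫ rest q := by
        rw [← hd, Category.assoc, hqq.1]
      have hdt : rest (t.hom ≫ q) ≫ t.hom = rest (t.hom ≫ q) ≫ q' := by
        rw [hdq, comp_rest]
      have hid : rest (q ≫ t.hom ≫ q) = q ≫ rest (t.hom ≫ q) ≫ q' := by
        rw [comp_rest_assoc', hqq.1, rest_comp_rest_left]
      have hmem : rest (q ≫ t.hom ≫ q) ∈ {d : A ⟶ A | rest d = d ∧ d ≫ p ≫ t.hom = d} := by
        refine ⟨rest_rest _, ?_⟩
        have hdp : rest (q ≫ t.hom ≫ q) ≫ p = q ≫ rest (t.hom ≫ q) := by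
          rw [comp_rest]
          conv_lhs => rw [← rest_comp_rest_left q, Category.assoc, h0]
        rw [← Category.assoc, hdp, Category.assoc, hdt, hid]
      refine le_trans (le_of_eq ?_) (comp_le_comp_left t.hom ((he t).1 hmem))
      change t.hom ≫ rest q = _
      rw [hid, reassoc_of% hd, reassoc_of% rest_idem (t.hom ≫ q), hdq]

namespace IsSectionCover

/-- Maps on `Z` are equal if they agree wherever `a : Z ⟶ A` factors through one of the sections. -/
theorem hom_ext (h : IsSectionCover p s e) {Z W : C} (a : Z ⟶ A) [IsTotal a] {m m' : Z ⟶ W}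
    (hm : ∀ (f : J) (d : Z ⟶ Z) (x : Z ⟶ X), rest d = d → d ≫ a = x ≫ s f → d ≫ m = d ≫ m') :
    m = m' :=
  (h.isCover.pull a).ext fun f => hm f _ _ (rest_rest _) (h.rest_comp_image_eq a f)

variable {A' X' : C} {J' : Type*} {p' : A' ⟶ X'} {s' : J' → (X' ⟶ A')} {e' : J' → (A' ⟶ A')}

/-- A version of `hom_ext` for two covers. -/
theorem hom_ext₂ (h : IsSectionCover p s e) (h' : IsSectionCover p' s' e') {Z W : C} (a : Z ⟶ A)
    (a' : Z ⟶ A') [IsTotal a] [IsTotal a'] {m m' : Z ⟶ W}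
    (hm : ∀ (f : J) (g : J') (d : Z ⟶ Z) (x : Z ⟶ X) (y : Z ⟶ X'), rest d = d →
      d ≫ a = x ≫ s f → d ≫ a' = y ≫ s' g → d ≫ m = d ≫ m') : m = m' := by
  refine h.hom_ext a fun f d x hd hx => h'.hom_ext a' fun g d' y hd' hy => ?_
  rw [← Category.assoc, ← Category.assoc]
  refine hm f g _ (d' ≫ x) (d ≫ y) ?_ ?_ ?_
  · rw [← hd, ← hd', rest_rest_comp, rest_rest]
  · rw [Category.assoc, hx, Category.assoc]
  · rw [← hd, ← hd', ← rest_comm, hd, hd', Category.assoc, hy, Category.assoc]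

/-- A version of `hom_ext` for three covers. -/
theorem hom_ext₃ (h : IsSectionCover p s e) (h' : IsSectionCover p' s' e') {A'' X'' : C}
    {J'' : Type*} {p'' : A'' ⟶ X''} {s'' : J'' → (X'' ⟶ A'')} {e'' : J'' → (A'' ⟶ A'')}
    (h'' : IsSectionCover p'' s'' e'') {Z W : C} (a : Z ⟶ A)
    (a' : Z ⟶ A') (a'' : Z ⟶ A'') [IsTotal a] [IsTotal a'] [IsTotal a''] {m m' : Z ⟶ W}
    (hm : ∀ (f : J) (g : J') (k : J'') (d : Z ⟶ Z) (x : Z ⟶ X) (y : Z ⟶ X') (z : Z ⟶ X''),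
      rest d = d → d ≫ a = x ≫ s f → d ≫ a' = y ≫ s' g → d ≫ a'' = z ≫ s'' k →
        d ≫ m = d ≫ m') : m = m' := by
  refine h.hom_ext₂ h' a a' fun f g d x y hd hx hy => h''.hom_ext a'' fun k d' z hd' hz => ?_
  rw [← Category.assoc, ← Category.assoc]
  refine hm f g k _ (d' ≫ x) (d' ≫ y) (d ≫ z) ?_ ?_ ?_ ?_
  · rw [← hd, ← hd', rest_rest_comp, rest_rest]
  · rw [Category.assoc, hx, Category.assoc]
  · rw [Category.assoc, hy, Category.assoc]
  · rw [← hd, ← hd', ← rest_comm, hd, hd', Category.assoc, hz, Category.assoc]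

end IsSectionCover

variable [HasLocalGlueings C]

/-- The pullback of `p` along `b` is a glueing `p'` of the pulled back atlas; its other projection
`k` is `p' ≫ b ≫ s f` on the image of the section of `p'` attached to `f`. -/
theorem IsSectionCover.hasPullback {J : Type v} {s : J → (X ⟶ A)} {e : J → (A ⟶ A)}
    (h : IsSectionCover p s e) (b : Y ⟶ X) [IsTotal b] : HasPullback p b := by
  have := h.isTotal
  obtain ⟨A', p', s', hs'⟩ := HasLocalGlueings.exists_glueing Y J (h.atlas b)
  obtain ⟨e', h', hφ⟩ := hs'.exists_isSectionCover
  replace hφ : ∀ f g, rest (s' f ≫ e' g) = rest (b ≫ s f ≫ e g) := hφ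
  have := h'.isTotal
  have hr : ∀ f, rest (s' f) = rest (b ≫ s f) := fun f => by
    have h1 := hφ f f
    rwa [h'.sec_image, h.sec_image] at h1
  -- a pair `(a, c)` over the images of `s f` and `s g` factors through `s' f` and `s' g`
  have key : ∀ {Z : C} (a : Z ⟶ A) (c : Z ⟶ Y) (f g : J), a ≫ p = c ≫ b → a ≫ e f = a →
      a ≫ e g = a → c ≫ s' f = c ≫ s' g := by
    intro Z a c f g hc hf hg
    have h1 := h.comp_rest_overlap hc hf hg
    have h2 := h'.overlap (𝟙 Y) f g
    simp only [Category.id_comp, hφ] at h2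
    rw [← h1, Category.assoc, h2, Category.assoc]
  have key' : ∀ {Z : C} (a : Z ⟶ A) (c : Z ⟶ Y) (f : J), a ≫ p = c ≫ b → a ≫ e f = a →
      c ≫ rest (s' f) = c := by
    intro Z a c f hc hf
    rw [hr, ← h.comp_rest_overlap hc hf hf, h.sec_image, Category.assoc, rest_idem]
  have he : ∀ {Z : C} (a : Z ⟶ A') (f : J), a ≫ e' f = a → ∀ g, a ≫ e' g = a →
      a ≫ p' ≫ b ≫ s f = a ≫ p' ≫ b ≫ s g := by
    intro Z a f hf g hg
    have h1 := h'.comp_rest_overlap (b := 𝟙 Y) (c := a ≫ p') (by rw [Category.comp_id]) hf hg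
    rw [Category.id_comp, hφ] at h1
    have h2 := congrArg (fun z => (a ≫ p') ≫ z) (h.overlap b f g)
    simp only [← Category.assoc] at h2
    simp only [← Category.assoc] at h1
    rw [h1] at h2
    simpa only [Category.assoc] using h2
  have hee : ∀ f g, e' f ≫ e' g = e' g ≫ e' f := fun f g => by
    rw [← h'.isCover.rest_eq f, ← h'.isCover.rest_eq g, rest_comm]
  have hid : ∀ f, e' f ≫ e' f = e' f := fun f => by rw [← h'.isCover.rest_eq f, rest_idem]
  -- the projection `k` to `A`, given by `he` independently of the section
  obtain ⟨k, -, hk⟩ := exists_glue h'.isCover.rest_eq (fun f => p' ≫ b ≫ s f) fun f g => by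
    have h1 := he (e' f ≫ e' g) f (by rw [Category.assoc, hee, reassoc_of% hid f]) g
      (by rw [Category.assoc, hid])
    simpa only [Category.assoc] using h1
  have hsk : ∀ f, s' f ≫ k = b ≫ s f := fun f => by
    rw [← h'.sec_image f, Category.assoc, hk, ← Category.assoc, h'.sec_image,
      ← Category.assoc, h'.sec_comp, hr, rest_comp]
  have sq : k ≫ p = p' ≫ b := h'.isCover.ext fun f => by
    have h1 : p' ≫ b ≫ s f ≫ p = p' ≫ rest (s' f) ≫ b := by
      rw [h.sec_comp, comp_rest, hr]
    rw [← Category.assoc, hk, Category.assoc, Category.assoc, Category.assoc, h1]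
    rw [← h'.sec_comp]
    simp only [Category.assoc]
    have h2 := h'.image_comp f
    rw [reassoc_of% h2]
  -- the map induced by `a` and `c` is `c ≫ s' f` where `a` lies in the image of `s f`
  have hlift : ∀ {Z : C} (a : Z ⟶ A) (c : Z ⟶ Y), a ≫ p = c ≫ b →
      ∃ n : Z ⟶ A', n ≫ k = a ∧ n ≫ p' = c := by
    intro Z a c hc
    have hac : rest a = rest c := by rw [← rest_comp_total a p, hc, rest_comp_total]
    have hD : ∀ f g, rest (a ≫ e f) ≫ rest (a ≫ e g) ≫ c ≫ s' f =
        rest (a ≫ e f) ≫ rest (a ≫ e g) ≫ c ≫ s' g := by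
      intro f g
      have h1 := key (rest (a ≫ e f) ≫ rest (a ≫ e g) ≫ a) (rest (a ≫ e f) ≫ rest (a ≫ e g) ≫ c) f g
        (by simp only [Category.assoc, hc])
        (by rw [← Category.assoc, rest_comm, Category.assoc, Category.assoc, Category.assoc,
          h.rest_comp_image_idem])
        (by rw [Category.assoc, Category.assoc, h.rest_comp_image_idem])
      simpa only [Category.assoc] using h1
    obtain ⟨n, hn, hn'⟩ := exists_glue (fun f => rest_rest (a ≫ e f)) (fun f => c ≫ s' f) hD
    have hna : rest n ≤ rest a := by
      refine (isLUB_rest hn).2 ?_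
      rintro _ ⟨_, ⟨f, rfl⟩, rfl⟩
      rw [hac]
      refine le_trans ?_ (rest_le_rest (rest_comp_le (a ≫ e f) c))
      change rest (rest (a ≫ e f) ≫ c ≫ s' f) ≤ _
      rw [← Category.assoc]
      exact rest_comp_le_rest _ _
    have hn1 : rest a ≫ n = n := by
      conv_lhs => rw [← rest_comp n, ← Category.assoc, rest_comm, (le_rest_iff n a).1 hna]
      exact rest_comp n
    have hcf : ∀ f, rest (a ≫ e f) ≫ c ≫ rest (s' f) = rest (a ≫ e f) ≫ c := fun f => by
      have h1 := key' (rest (a ≫ e f) ≫ a) (rest (a ≫ e f) ≫ c) f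
        (by simp only [Category.assoc, hc]) (by rw [Category.assoc, h.rest_comp_image_idem])
      simpa only [Category.assoc] using h1
    refine ⟨n, ?_, ?_⟩
    · rw [← hn1, Category.assoc]
      refine Eq.trans ?_ (rest_comp a)
      refine h.isCover.ext_along a fun f => ?_
      rw [← Category.assoc, hn', Category.assoc, Category.assoc, hsk, ← Category.assoc c, ← hc,
        h.rest_comp_image_eq, Category.assoc, Category.assoc, Category.assoc]
    · rw [← hn1, Category.assoc]
      refine Eq.trans ?_ (rest_comp c)
      rw [← hac]
      refine h.isCover.ext_along a fun f => ?_
      rw [← Category.assoc, hn', Category.assoc, Category.assoc, h'.sec_comp, hcf]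
  -- where `n` lies in the image of `s' f` and `n'` in that of `s' g`, they are determined by their
  -- common composite with `p'`, and the two sections agree there by `key`
  have huniq : ∀ {Z : C} (n n' : Z ⟶ A'), n ≫ k = n' ≫ k → n ≫ p' = n' ≫ p' → n = n' := by
    intro Z n n' hk1 hp1
    have hnn : rest n = rest n' := by rw [← rest_comp_total n p', hp1, rest_comp_total]
    have hke : ∀ {W : C} (x : W ⟶ A') f, x ≫ e' f = x → x ≫ k ≫ e f = x ≫ k := by
      intro W x f hx
      have h1 : x ≫ k = x ≫ p' ≫ b ≫ s f := by
        conv_lhs => rw [← hx, Category.assoc, hk, ← Category.assoc, hx]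
      rw [← Category.assoc, h1]
      simp only [Category.assoc, h.sec_image]
    rw [← rest_comp n, ← rest_comp n', ← hnn]
    refine h'.isCover.ext_along n fun f => ?_
    have h0 : rest (n ≫ e' f) = rest n' ≫ rest (n ≫ e' f) := by
      rw [← hnn, rest_comm, rest_comp_rest_left]
    rw [h0, Category.assoc, Category.assoc]
    refine h'.isCover.ext_along n' fun g => ?_
    have hf : (rest (n' ≫ e' g) ≫ rest (n ≫ e' f) ≫ n) ≫ e' f =
        rest (n' ≫ e' g) ≫ rest (n ≫ e' f) ≫ n := by
      rw [Category.assoc, Category.assoc, h'.rest_comp_image_idem]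
    have hg : (rest (n' ≫ e' g) ≫ rest (n ≫ e' f) ≫ n') ≫ e' g =
        rest (n' ≫ e' g) ≫ rest (n ≫ e' f) ≫ n' := by
      rw [← Category.assoc, rest_comm, Category.assoc, Category.assoc, Category.assoc,
        h'.rest_comp_image_idem]
    have h1 := key (rest (n' ≫ e' g) ≫ rest (n ≫ e' f) ≫ n ≫ k)
      (rest (n' ≫ e' g) ≫ rest (n ≫ e' f) ≫ n ≫ p') f g
      (by simp only [Category.assoc, sq])
      (by
        have h2 := hke _ f hf
        simpa only [Category.assoc] using h2)
      (by
        have h2 := hke _ g hg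
        rw [hk1]
        simpa only [Category.assoc] using h2)
    have h3 := h'.eq_comp_sec hf
    have h4 := h'.eq_comp_sec hg
    rw [h3, h4, Category.assoc, Category.assoc, Category.assoc, Category.assoc (rest (n' ≫ e' g)),
      Category.assoc (rest (n ≫ e' f)), ← hp1]
    simpa only [Category.assoc] using h1
  choose! l hl1 hl2 using @hlift
  exact ⟨⟨⟨PullbackCone.mk k p' sq, PullbackCone.IsLimit.mk sq (fun c => l c.fst c.snd c.condition)
    (fun c => hl1 _ _ _) (fun c => hl2 _ _ _)
    (fun c m h1 h2 => huniq _ _ (h1.trans (hl1 _ _ _).symm) (h2.trans (hl2 _ _ _).symm))⟩⟩⟩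

end SectionCover

/-! ### Cofunctors out of a partite category with enough sections -/

section SectionAction

variable {C : Type u} [Category.{v} C] [RestrictionCategory C]

/-- A choice of partial sections of the source maps of `A` which cover all objects of arrows and
which are closed under identities and composition. -/
structure SectionSystem (A : PartiteCat.{w} C) where
  J : A.G.I → A.G.I → Type v
  sec : ∀ {i j}, J i j → PartialSection (A.G.src i j)
  image : ∀ {i j}, J i j → (A.G.arr i j ⟶ A.G.arr i j)
  isSectionCover : ∀ i j,
    IsSectionCover (A.G.src i j) (fun f : J i j => (sec f).hom) (fun f => image f)
  one : ∀ i, J i i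
  sec_one : ∀ i, (sec (one i)).hom = A.one i
  comp : ∀ {i j k}, J i j → J j k → J i k
  sec_comp : ∀ {i j k} (f : J i j) (g : J j k),
    (sec (comp f g)).hom = A.sectionComp (sec f) (sec g)

/-- The values on objects and on a system of partial sections of a cofunctor from `A` to `B`. The
sections `onSec f` and `onSec g` have to agree on the preimage of the overlap of `sec f` and
`sec g`. -/
structure SectionAction {A : PartiteCat.{w} C} (S : SectionSystem A) (B : PartiteCat.{w} C) where
  onI : A.G.I → B.G.I
  onObj : ∀ i, B.G.obj (onI i) ⟶ A.G.obj i
  onObj_total : ∀ i, IsTotal (onObj i)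
  onSec : ∀ {i j}, S.J i j → PartialSection (B.G.src (onI i) (onI j))
  rest_onSec : ∀ {i j} (f : S.J i j), rest (onSec f).hom = rest (onObj i ≫ (S.sec f).hom)
  onSec_overlap : ∀ {i j} (f g : S.J i j),
    rest (onObj i ≫ (S.sec f).hom ≫ S.image g) ≫ (onSec f).hom =
      rest (onObj i ≫ (S.sec f).hom ≫ S.image g) ≫ (onSec g).hom
  onSec_tgt : ∀ {i j} (f : S.J i j), (onSec f).hom ≫ B.G.tgt _ _ ≫ onObj j =
    onObj i ≫ (S.sec f).hom ≫ A.G.tgt i j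
  onSec_one : ∀ i, (onSec (S.one i)).hom = B.one (onI i)
  onSec_comp : ∀ {i j k} (f : S.J i j) (g : S.J j k),
    (onSec (S.comp f g)).hom = B.sectionComp (onSec f) (onSec g)

attribute [instance] SectionAction.onObj_total

/-- Two cofunctors which agree on objects and on a covering system of sections are equal. -/
theorem Cofunctor.ext_sections [IsJoinRestrictionCategory C] {A B : PartiteCat.{w} C}
    (S : SectionSystem A) {F G : Cofunctor A B}
    (hI : F.onI = G.onI) (hO : ∀ i, HEq (F.onObj i) (G.onObj i))
    (hs : ∀ {i j} (f : S.J i j), HEq (F.sectionMap (S.sec f)) (G.sectionMap (S.sec f))) :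
    F = G := by
  -- the values of a cofunctor on a section determine its action on the arrows in the image
  have key : ∀ (H : Cofunctor A B) {i j} (f : S.J i j),
      rest (pullback.fst (A.G.src i j) (H.onObj i) ≫ S.image f) ≫ H.onArr i j =
        rest (pullback.fst (A.G.src i j) (H.onObj i) ≫ S.image f) ≫ pullback.snd _ _ ≫
          H.sectionMap (S.sec f) := by
    intro H i j f
    have hc := S.isSectionCover i j
    have h1 := hc.rest_comp_image_eq (pullback.fst (A.G.src i j) (H.onObj i)) f
    have h2 := H.comp_sectionMap (rest (pullback.fst (A.G.src i j) (H.onObj i) ≫ S.image f) ≫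
      pullback.snd _ _) (S.sec f)
    have h3 := hc.comp_rest_overlap (f := f) (g := f) (b := H.onObj i)
      (a := rest (pullback.fst (A.G.src i j) (H.onObj i) ≫ S.image f) ≫ pullback.fst _ _)
      (c := rest (pullback.fst (A.G.src i j) (H.onObj i) ≫ S.image f) ≫ pullback.snd _ _)
      (by simp only [Category.assoc, pullback.condition])
      (by rw [Category.assoc, hc.rest_comp_image_idem])
      (by rw [Category.assoc, hc.rest_comp_image_idem])
    rw [hc.sec_image] at h3
    rw [← Category.assoc _ (pullback.snd _ _), h2]
    refine Eq.trans ?_ (H.act_congr (h1.trans ?_) h3.symm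
      (by simp only [Category.assoc, pullback.condition]))
    · rw [Cofunctor.act, lift_fst_snd]
    · simp only [Category.assoc, pullback.condition_assoc]
  obtain ⟨f, o, m, m1, m2, m3, m4, m5⟩ := F
  obtain ⟨f', o', m', m1', m2', m3', m4', m5'⟩ := G
  obtain rfl : f = f' := hI
  obtain rfl : o = o' := funext fun i => eq_of_heq (hO i)
  obtain rfl : m = m' := by
    funext i j
    refine ((S.isSectionCover i j).isCover.pull (pullback.fst _ _)).ext fun g => ?_
    refine (key ⟨f, o, m, m1, m2, m3, m4, m5⟩ g).trans
      (Eq.trans ?_ (key ⟨f, o, m', m1', m2', m3', m4', m5'⟩ g).symm)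
    rw [eq_of_heq (hs g)]
  rfl

namespace SectionAction

variable {A B : PartiteCat.{w} C} {S : SectionSystem A} (D : SectionAction S B)

/-- If the arrow `a` factors through `sec f`, then any `b` over its source lies in the domain of
`onSec f`. -/
theorem comp_rest_onSec {i j : A.G.I} {X : C} {a : X ⟶ A.G.arr i j} {x : X ⟶ A.G.obj i}
    {b : X ⟶ B.G.obj (D.onI i)} {f : S.J i j}
    (h : a ≫ A.G.src i j = b ≫ D.onObj i) (ha : a = x ≫ (S.sec f).hom) :
    b ≫ rest (D.onSec f).hom = b := by
  have hc := S.isSectionCover i j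
  have h1 := hc.comp_rest_overlap (f := f) (g := f) h (hc.comp_image_of_eq ha)
    (hc.comp_image_of_eq ha)
  rwa [hc.sec_image, ← D.rest_onSec] at h1

variable [IsJoinRestrictionCategory C]

/-- On the pairs `(a, b)` with `a` in the image of `sec f`, the action is `b ↦ onSec f b`. -/
theorem exists_onArr (i j : A.G.I) : ∃ m : pullback (A.G.src i j) (D.onObj i) ⟶
    B.G.arr (D.onI i) (D.onI j), ∀ f : S.J i j,
      rest (pullback.fst (A.G.src i j) (D.onObj i) ≫ S.image f) ≫ m =
        rest (pullback.fst (A.G.src i j) (D.onObj i) ≫ S.image f) ≫ pullback.snd _ _ ≫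
          (D.onSec f).hom := by
  have hc := S.isSectionCover i j
  refine (exists_glue
    (fun f : S.J i j => rest_rest (pullback.fst (A.G.src i j) (D.onObj i) ≫ S.image f))
    (fun f => pullback.snd (A.G.src i j) (D.onObj i) ≫ (D.onSec f).hom) ?_).imp
    fun m hm => hm.2
  intro f g
  set a := pullback.fst (A.G.src i j) (D.onObj i)
  set b := pullback.snd (A.G.src i j) (D.onObj i)
  have hab : a ≫ A.G.src i j = b ≫ D.onObj i := pullback.condition
  have h1 := hc.comp_rest_overlap (f := f) (g := g)
    (a := rest (a ≫ S.image f) ≫ rest (a ≫ S.image g) ≫ a)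
    (c := rest (a ≫ S.image f) ≫ rest (a ≫ S.image g) ≫ b)
    (b := D.onObj i) (by simp only [Category.assoc, hab])
    (by
      rw [← Category.assoc (rest _), rest_comm]
      simp only [Category.assoc, hc.rest_comp_image_idem])
    (by rw [Category.assoc, Category.assoc, hc.rest_comp_image_idem])
  have h2 := congrArg (fun z => (rest (a ≫ S.image f) ≫ rest (a ≫ S.image g) ≫ b) ≫ z)
    (D.onSec_overlap f g)
  simp only [← Category.assoc] at h1 h2
  rw [h1] at h2
  simpa only [Category.assoc] using h2

/-- The action on arrows of the cofunctor determined by `D`. -/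
noncomputable def onArr (i j : A.G.I) :
    pullback (A.G.src i j) (D.onObj i) ⟶ B.G.arr (D.onI i) (D.onI j) :=
  (D.exists_onArr i j).choose

/-- The action of `D` on generalised arrows which factor through a section. -/
theorem lift_onArr {i j : A.G.I} {X : C} {a : X ⟶ A.G.arr i j} {b : X ⟶ B.G.obj (D.onI i)}
    (h : a ≫ A.G.src i j = b ≫ D.onObj i) {x : X ⟶ A.G.obj i} {f : S.J i j}
    (ha : a = x ≫ (S.sec f).hom) :
    pullback.lift a b h ≫ D.onArr i j = b ≫ (D.onSec f).hom := by
  have hc := S.isSectionCover i j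
  have h1 := congrArg (fun z => pullback.lift a b h ≫ z) ((D.exists_onArr i j).choose_spec f)
  have h2 : rest (pullback.lift a b h) = rest a := by
    rw [← rest_comp_total _ (pullback.fst (A.G.src i j) (D.onObj i)), pullback.lift_fst]
  simp only [comp_rest_assoc', pullback.lift_fst_assoc, pullback.lift_snd_assoc,
    hc.comp_image_of_eq ha] at h1
  rw [← h2, rest_comp_assoc'] at h1
  refine h1.trans ?_
  rw [h2, ← rest_comp_total a (A.G.src i j), h, rest_comp_total, rest_comp_assoc']

theorem comp_onArr {i j : A.G.I} {X : C} (d : X ⟶ pullback (A.G.src i j) (D.onObj i))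
    {x : X ⟶ A.G.obj i} {f : S.J i j} (hd : d ≫ pullback.fst _ _ = x ≫ (S.sec f).hom) :
    d ≫ D.onArr i j = (d ≫ pullback.snd _ _) ≫ (D.onSec f).hom := by
  rw [← D.lift_onArr (by simp only [Category.assoc, pullback.condition]) hd, lift_fst_snd]

theorem onArr_src (i j : A.G.I) : D.onArr i j ≫ B.G.src _ _ = pullback.snd _ _ := by
  refine (S.isSectionCover i j).hom_ext (pullback.fst (A.G.src i j) (D.onObj i))
    fun f d x _ hx => ?_
  rw [← Category.assoc, D.comp_onArr d hx, Category.assoc, (D.onSec f).comp_eq]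
  exact D.comp_rest_onSec (by simp only [Category.assoc, pullback.condition]) hx

theorem onArr_tgt (i j : A.G.I) : D.onArr i j ≫ B.G.tgt _ _ ≫ D.onObj j =
    pullback.fst _ _ ≫ A.G.tgt i j := by
  have hc := S.isSectionCover i j
  refine hc.hom_ext (pullback.fst (A.G.src i j) (D.onObj i)) fun f d x _ hx => ?_
  have h1 := hc.eq_comp_sec (hc.comp_image_of_eq hx)
  rw [← Category.assoc, D.comp_onArr d hx, Category.assoc, D.onSec_tgt, ← Category.assoc d, h1]
  simp only [Category.assoc, pullback.condition_assoc]

/-- Compatibility of the action with composition, for arrows which factor through sections. -/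
theorem lift_mul_onArr {i j k : A.G.I} {X : C} {a' : X ⟶ A.G.arr j k} {a : X ⟶ A.G.arr i j}
    {b : X ⟶ B.G.obj (D.onI i)} (h : a' ≫ A.G.src j k = a ≫ A.G.tgt i j)
    (h' : a ≫ A.G.src i j = b ≫ D.onObj i) {x : X ⟶ A.G.obj i} {y : X ⟶ A.G.obj j}
    {f : S.J i j} {g : S.J j k} (ha : a = x ≫ (S.sec f).hom) (ha' : a' = y ≫ (S.sec g).hom)
    {u : X ⟶ B.G.arr (D.onI i) (D.onI j)} (hu : u = b ≫ (D.onSec f).hom)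
    {v : X ⟶ B.G.arr (D.onI j) (D.onI k)} (hv : v = (u ≫ B.G.tgt _ _) ≫ (D.onSec g).hom)
    (hvu : v ≫ B.G.src _ _ = u ≫ B.G.tgt _ _) :
    pullback.lift (A.mul a' a h) b (by rw [A.mul_src, h']) ≫ D.onArr i k = B.mul v u hvu := by
  have hc := S.isSectionCover i j
  have hc' := S.isSectionCover j k
  have e1 := hc.eq_comp_sec (hc.comp_image_of_eq ha)
  have e2 := hc'.eq_comp_sec (hc'.comp_image_of_eq ha')
  rw [h'] at e1
  rw [h] at e2
  have hr : rest a' = rest a := by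
    rw [← rest_comp_total a' (A.G.src j k), h, rest_comp_total]
  have hr' : rest v = rest u := by
    rw [← rest_comp_total v (B.G.src _ _), hvu, rest_comp_total]
  have e3 : b ≫ D.onObj i ≫ (S.sec f).hom ≫ A.G.tgt i j ≫ (S.sec g).hom = a' := by
    conv_rhs => rw [e2, e1]
    simp only [Category.assoc]
  have e4 : b ≫ (D.onSec f).hom ≫ B.G.tgt _ _ ≫ (D.onSec g).hom = v := by
    rw [hv, hu]
    simp only [Category.assoc]
  rw [D.lift_onArr _ (f := S.comp f g) (x := b ≫ D.onObj i), D.onSec_comp, B.comp_sectionComp]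
  · refine B.mul_congr e4 ?_ _
    rw [e4, ← hu, hr', rest_comp]
  · rw [S.sec_comp, A.comp_sectionComp]
    refine A.mul_congr ?_ ?_ _
    · rw [Category.assoc, e3]
    · rw [Category.assoc, e3, hr, ← e1, rest_comp]

theorem onArr_comp (i j k : A.G.I) {X : C} (a' : X ⟶ A.G.arr j k) (a : X ⟶ A.G.arr i j)
    (b : X ⟶ B.G.obj (D.onI i)) (h : a' ≫ A.G.src j k = a ≫ A.G.tgt i j)
    (h' : a ≫ A.G.src i j = b ≫ D.onObj i) [IsTotal a] [IsTotal a'] :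
    B.mul (pullback.lift a' (pullback.lift a b h' ≫ D.onArr i j ≫ B.G.tgt _ _)
        (by rw [h, Category.assoc, Category.assoc, D.onArr_tgt, pullback.lift_fst_assoc]) ≫
          D.onArr j k)
        (pullback.lift a b h' ≫ D.onArr i j)
        (by rw [Category.assoc, D.onArr_src, pullback.lift_snd, Category.assoc]) =
      pullback.lift (A.mul a' a h) b (by rw [A.mul_src, h']) ≫ D.onArr i k := by
  refine (S.isSectionCover i j).hom_ext₂ (S.isSectionCover j k) a a' fun f g d x y _ hx hy => ?_
  have e : d ≫ pullback.lift (A.mul a' a h) b (by rw [A.mul_src, h']) ≫ D.onArr i k =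
      pullback.lift (A.mul (d ≫ a') (d ≫ a) (by simp only [Category.assoc, h])) (d ≫ b)
        (by rw [A.mul_src, Category.assoc, h', Category.assoc]) ≫ D.onArr i k := by
    simp only [comp_lift_assoc, A.comp_mul]
  refine (B.comp_mul d _ _ _).trans (Eq.trans (Eq.symm ?_) e.symm)
  refine D.lift_mul_onArr _ (by simp only [Category.assoc, h']) hx hy ?_ ?_ _
  · rw [comp_lift_assoc]
    exact D.lift_onArr _ hx
  · rw [comp_lift_assoc]
    refine (D.lift_onArr _ hy).trans ?_
    simp only [Category.assoc]

/-- The cofunctor determined by its values on objects and on a system of sections. -/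
noncomputable def toCofunctor : Cofunctor A B where
  onI := D.onI
  onObj := D.onObj
  onArr := D.onArr
  onArr_total i j := by
    refine IsTotal.of_comp _ (B.G.src _ _) ?_
    rw [D.onArr_src]
    infer_instance
  onArr_src := D.onArr_src
  onArr_tgt := D.onArr_tgt
  onArr_one i := by
    rw [D.lift_onArr _ (f := S.one i) (x := D.onObj i) (by rw [S.sec_one]), D.onSec_one,
      Category.id_comp]
  onArr_comp i j k := by
    have h := D.onArr_comp i j k
      (pullback.fst (A.G.src j k) (pullback.fst (A.G.src i j) (D.onObj i) ≫ A.G.tgt i j))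
      (pullback.snd (A.G.src j k) (pullback.fst (A.G.src i j) (D.onObj i) ≫ A.G.tgt i j) ≫
        pullback.fst (A.G.src i j) (D.onObj i))
      (pullback.snd (A.G.src j k) (pullback.fst (A.G.src i j) (D.onObj i) ≫ A.G.tgt i j) ≫
        pullback.snd (A.G.src i j) (D.onObj i))
      (by rw [pullback.condition, Category.assoc])
      (by simp only [Category.assoc, pullback.condition])
    simp only [lift_fst_snd] at h
    exact h

theorem toCofunctor_sectionMap {i j : A.G.I} (f : S.J i j) :
    D.toCofunctor.sectionMap (S.sec f) = (D.onSec f).hom := by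
  refine (D.lift_onArr _ (f := f) (x := D.onObj i) rfl).trans ?_
  exact (congrArg (fun z => z ≫ (D.onSec f).hom) (D.rest_onSec f).symm).trans (rest_comp _)

end SectionAction

end SectionAction

/-! ### Partite categories with prescribed sections -/

section GraphSections

variable {C : Type u} [Category.{v} C] [RestrictionCategory C]

/-- Partial sections covering the source maps of a partite graph, indexed by the maps of a category
on its set of components, whose composition is a local operation on sections: by `sec_comp_congr`,
the section of a composite depends only on the germs of the sections of the factors. -/
structure GraphSections (G : PartiteGraph.{w} C) where
  J : G.I → G.I → Type v
  sec : ∀ {i j}, J i j → (G.obj i ⟶ G.arr i j)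
  image : ∀ {i j}, J i j → (G.arr i j ⟶ G.arr i j)
  isSectionCover : ∀ i j, IsSectionCover (G.src i j) (fun f : J i j => sec f) (fun f => image f)
  one : ∀ i, J i i
  comp : ∀ {i j k}, J i j → J j k → J i k
  one_comp : ∀ {i j} (f : J i j), comp (one i) f = f
  comp_one : ∀ {i j} (f : J i j), comp f (one j) = f
  assoc : ∀ {i j k l} (f : J i j) (g : J j k) (h : J k l), comp (comp f g) h = comp f (comp g h)
  rest_sec_one : ∀ i, rest (sec (one i)) = 𝟙 (G.obj i)
  sec_one_tgt : ∀ i, sec (one i) ≫ G.tgt i i = 𝟙 (G.obj i)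
  rest_sec_comp : ∀ {i j k} (f : J i j) (g : J j k),
    rest (sec (comp f g)) = rest (sec f ≫ G.tgt i j ≫ sec g)
  sec_comp_tgt : ∀ {i j k} (f : J i j) (g : J j k),
    sec (comp f g) ≫ G.tgt i k = sec f ≫ G.tgt i j ≫ sec g ≫ G.tgt j k
  sec_comp_congr : ∀ {i j k} {Z : C} {x : Z ⟶ G.obj i} {f f' : J i j} {g g' : J j k},
    x ≫ rest (sec f ≫ image f') = x →
      (x ≫ sec f ≫ G.tgt i j) ≫ rest (sec g ≫ image g') = x ≫ sec f ≫ G.tgt i j →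
        x ≫ sec (comp f g) = x ≫ sec (comp f' g')

namespace GraphSections

variable {G : PartiteGraph.{w} C} (S : GraphSections G) {i j k l : G.I}

section

variable {Z : C} {a : Z ⟶ G.arr i j} {x : Z ⟶ G.obj i} {f : S.J i j}

theorem eq_src_sec (ha : a = x ≫ S.sec f) : a = (a ≫ G.src i j) ≫ S.sec f :=
  (S.isSectionCover i j).eq_comp_sec ((S.isSectionCover i j).comp_image_of_eq ha)

theorem tgt_eq (ha : a = x ≫ S.sec f) :
    a ≫ G.tgt i j = (a ≫ G.src i j) ≫ S.sec f ≫ G.tgt i j := by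
  conv_lhs => rw [S.eq_src_sec ha]
  simp only [Category.assoc]

/-- A composable pair of arrows in the images of `sec f` and `sec g` lies over the domain of
`sec (comp f g)`. -/
theorem comp_rest_sec {b : Z ⟶ G.arr j k} (h : b ≫ G.src j k = a ≫ G.tgt i j)
    (ha : a = x ≫ S.sec f) {y : Z ⟶ G.obj j} {g : S.J j k} (hb : b = y ≫ S.sec g) :
    (a ≫ G.src i j) ≫ rest (S.sec (S.comp f g)) = a ≫ G.src i j := by
  have h1 : (a ≫ G.src i j) ≫ S.sec f ≫ G.tgt i j ≫ S.sec g = b := by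
    conv_rhs => rw [S.eq_src_sec hb, h, S.tgt_eq ha]
    simp only [Category.assoc]
  rw [S.rest_sec_comp, comp_rest, h1, ← rest_comp_total b (G.src j k), h, rest_comp_total,
    rest_comp_assoc']

end

variable [IsJoinRestrictionCategory C]

/-- On composable pairs in the images of `sec f` and `sec g`, composition is given by the section
`sec (comp f g)`. -/
theorem exists_mul (i j k : G.I) :
    ∃ m : pullback (G.src j k) (G.tgt i j) ⟶ G.arr i k,
      ∀ p : S.J i j × S.J j k,
        (rest (pullback.snd (G.src j k) (G.tgt i j) ≫ S.image p.1) ≫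
          rest (pullback.fst (G.src j k) (G.tgt i j) ≫ S.image p.2)) ≫ m =
        (rest (pullback.snd (G.src j k) (G.tgt i j) ≫ S.image p.1) ≫
          rest (pullback.fst (G.src j k) (G.tgt i j) ≫ S.image p.2)) ≫
            (pullback.snd _ _ ≫ G.src i j) ≫ S.sec (S.comp p.1 p.2) := by
  have hc := S.isSectionCover i j
  have hc' := S.isSectionCover j k
  refine (exists_glue (fun p : S.J i j × S.J j k =>
    (by rw [rest_rest_comp, rest_rest] : rest
      (rest (pullback.snd (G.src j k) (G.tgt i j) ≫ S.image p.1) ≫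
        rest (pullback.fst (G.src j k) (G.tgt i j) ≫ S.image p.2)) = _))
    (fun p => (pullback.snd _ _ ≫ G.src i j) ≫ S.sec (S.comp p.1 p.2)) ?_).imp
      fun m hm => hm.2
  rintro ⟨f, g⟩ ⟨f', g'⟩
  dsimp only
  set a := pullback.snd (G.src j k) (G.tgt i j)
  set b := pullback.fst (G.src j k) (G.tgt i j)
  have hab : b ≫ G.src j k = a ≫ G.tgt i j := pullback.condition
  -- `D` is the overlap of the domains on which two such values are prescribed
  obtain ⟨D, hD⟩ : ∃ D, D = (rest (a ≫ S.image f) ≫ rest (b ≫ S.image g)) ≫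
      rest (a ≫ S.image f') ≫ rest (b ≫ S.image g') := ⟨_, rfl⟩
  have hsw : ∀ {W W' : C} (u : pullback (G.src j k) (G.tgt i j) ⟶ W)
      (v : pullback (G.src j k) (G.tgt i j) ⟶ W'), rest u ≫ rest v = rest v ≫ rest u :=
    fun u v => (rest_comm u v).symm
  have hDa : ∀ {Y : C} (c : pullback (G.src j k) (G.tgt i j) ⟶ Y) (e : Y ⟶ Y), rest e = e →
      D ≫ rest (c ≫ e) = D → (D ≫ c) ≫ e = D ≫ c := by
    intro Y c e he hDc
    rw [Category.assoc, ← he, comp_rest, ← Category.assoc, hDc]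
  have hmv : ∀ {W W' : C} (u : pullback (G.src j k) (G.tgt i j) ⟶ W)
      (v : pullback (G.src j k) (G.tgt i j) ⟶ W') {V : C}
      (t : pullback (G.src j k) (G.tgt i j) ⟶ V), rest u ≫ rest v ≫ t = rest v ≫ rest u ≫ t :=
    fun u v _ t => by rw [← Category.assoc, hsw, Category.assoc]
  have h1 : (D ≫ a) ≫ S.image f = D ≫ a := hDa a _ (hc.isCover.rest_eq f) (by
    simp only [hD, Category.assoc]
    rw [hsw (b ≫ S.image g'), hmv (a ≫ S.image f'), hmv (b ≫ S.image g),
      reassoc_of% rest_idem (a ≫ S.image f)])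
  have h2 : (D ≫ b) ≫ S.image g = D ≫ b := hDa b _ (hc'.isCover.rest_eq g) (by
    simp only [hD, Category.assoc]
    rw [hsw (b ≫ S.image g'), hmv (a ≫ S.image f'), reassoc_of% rest_idem (b ≫ S.image g)])
  have h3 : (D ≫ a) ≫ S.image f' = D ≫ a := hDa a _ (hc.isCover.rest_eq f') (by
    simp only [hD, Category.assoc]
    rw [hsw (b ≫ S.image g'), reassoc_of% rest_idem (a ≫ S.image f')])
  have h4 : (D ≫ b) ≫ S.image g' = D ≫ b := hDa b _ (hc'.isCover.rest_eq g') (by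
    simp only [hD, Category.assoc, rest_idem])
  have e1 := hc.comp_rest_overlap (b := 𝟙 _) (c := (D ≫ a) ≫ G.src i j)
    (by rw [Category.comp_id]) h1 h3
  have e2 := hc'.comp_rest_overlap (b := 𝟙 _) (c := (D ≫ b) ≫ G.src j k)
    (by rw [Category.comp_id]) h2 h4
  have e3 := hc.eq_comp_sec h1
  have e4 : (D ≫ b) ≫ G.src j k = ((D ≫ a) ≫ G.src i j) ≫ S.sec f ≫ G.tgt i j := by
    rw [← S.tgt_eq e3, Category.assoc, hab, Category.assoc]
  rw [Category.id_comp] at e1 e2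
  have e5 := S.sec_comp_congr (g := g) (g' := g') e1 (by rw [← e4]; exact e2)
  rw [← Category.assoc, ← Category.assoc _ _ ((a ≫ _) ≫ S.sec (S.comp f' g')), ← hD]
  simpa only [Category.assoc] using e5

/-- The composition which is determined by that of the sections. -/
noncomputable def mul (i j k : G.I) : pullback (G.src j k) (G.tgt i j) ⟶ G.arr i k :=
  (S.exists_mul i j k).choose

/-- The composite of generalised arrows which factor through sections. -/
theorem lift_mul {Z : C} {b : Z ⟶ G.arr j k} {a : Z ⟶ G.arr i j}
    (h : b ≫ G.src j k = a ≫ G.tgt i j) {x : Z ⟶ G.obj i} {y : Z ⟶ G.obj j} {f : S.J i j}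
    {g : S.J j k} (ha : a = x ≫ S.sec f) (hb : b = y ≫ S.sec g) :
    pullback.lift b a h ≫ S.mul i j k = (a ≫ G.src i j) ≫ S.sec (S.comp f g) := by
  have hc := S.isSectionCover i j
  have hc' := S.isSectionCover j k
  have e : pullback.lift b a h ≫ (_ ≫ S.mul i j k) = _ :=
    congrArg (fun z => pullback.lift b a h ≫ z) ((S.exists_mul i j k).choose_spec (f, g))
  have h2 : rest (pullback.lift b a h) = rest a := by
    rw [← rest_comp_total _ (pullback.snd (G.src j k) (G.tgt i j)), pullback.lift_snd]
  have h3 : rest b = rest a := by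
    rw [← rest_comp_total b (G.src j k), h, rest_comp_total]
  have hw1 : pullback.lift b a h ≫ rest (pullback.snd (G.src j k) (G.tgt i j) ≫ S.image f) =
      pullback.lift b a h := by
    rw [comp_rest, pullback.lift_snd_assoc, hc.comp_image_of_eq ha, ← h2, rest_comp]
  have hw2 : pullback.lift b a h ≫ rest (pullback.fst (G.src j k) (G.tgt i j) ≫ S.image g) =
      pullback.lift b a h := by
    rw [comp_rest, pullback.lift_fst_assoc, hc'.comp_image_of_eq hb, h3, ← h2, rest_comp]
  simp only [← Category.assoc] at e
  rw [hw1, hw2, pullback.lift_snd] at e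
  exact e

theorem mul_src (i j k : G.I) : S.mul i j k ≫ G.src i k = pullback.snd _ _ ≫ G.src i j := by
  refine (S.isSectionCover i j).hom_ext₂ (S.isSectionCover j k)
    (pullback.snd (G.src j k) (G.tgt i j)) (pullback.fst (G.src j k) (G.tgt i j))
    fun f g d x y _ hx hy => ?_
  have h : (d ≫ pullback.fst (G.src j k) (G.tgt i j)) ≫ G.src j k =
      (d ≫ pullback.snd (G.src j k) (G.tgt i j)) ≫ G.tgt i j := by
    simp only [Category.assoc, pullback.condition]
  have e := S.lift_mul h hx hy
  rw [lift_fst_snd] at e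
  rw [← Category.assoc, e, Category.assoc, (S.isSectionCover i k).sec_comp,
    S.comp_rest_sec h hx hy, Category.assoc]

theorem mul_tgt (i j k : G.I) : S.mul i j k ≫ G.tgt i k = pullback.fst _ _ ≫ G.tgt j k := by
  refine (S.isSectionCover i j).hom_ext₂ (S.isSectionCover j k)
    (pullback.snd (G.src j k) (G.tgt i j)) (pullback.fst (G.src j k) (G.tgt i j))
    fun f g d x y _ hx hy => ?_
  have h : (d ≫ pullback.fst (G.src j k) (G.tgt i j)) ≫ G.src j k =
      (d ≫ pullback.snd (G.src j k) (G.tgt i j)) ≫ G.tgt i j := by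
    simp only [Category.assoc, pullback.condition]
  have e := S.lift_mul h hx hy
  rw [lift_fst_snd] at e
  rw [← Category.assoc, e, ← Category.assoc d, S.tgt_eq hy, h, S.tgt_eq hx, Category.assoc,
    S.sec_comp_tgt]
  simp only [Category.assoc]

/-- Associativity of `mul`, for generalised arrows. -/
theorem mul_mul {Z : C} {c : Z ⟶ G.arr k l} {b : Z ⟶ G.arr j k} {a : Z ⟶ G.arr i j}
    (h : b ≫ G.src j k = a ≫ G.tgt i j) (h' : c ≫ G.src k l = b ≫ G.tgt j k)
    [IsTotal a] [IsTotal b] [IsTotal c] (h1) (h2) :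
    pullback.lift (f := G.src k l) (g := G.tgt i k) c (pullback.lift b a h ≫ S.mul i j k) h1 ≫
        S.mul i k l =
      pullback.lift (f := G.src j l) (g := G.tgt i j) (pullback.lift c b h' ≫ S.mul j k l) a h2 ≫
        S.mul i j l := by
  refine (S.isSectionCover i j).hom_ext₃ (S.isSectionCover j k) (S.isSectionCover k l) a b c
    fun f g h₀ d x y z _ hx hy hz => ?_
  have e1 := S.lift_mul (by simp only [Category.assoc, h]) hx hy
  have e2 := S.lift_mul (by simp only [Category.assoc, h']) hy hz
  rw [← comp_lift _ _ d b a h] at e1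
  rw [← comp_lift _ _ d c b h'] at e2
  refine (comp_lift_assoc _ _ d _ _ h1 _).trans (Eq.trans ?_ (comp_lift_assoc _ _ d _ _ h2 _).symm)
  rw [S.lift_mul _ ((Category.assoc _ _ _).symm.trans e1) hz,
    S.lift_mul _ hx ((Category.assoc _ _ _).symm.trans e2), S.assoc]
  congr 1
  simp only [Category.assoc, mul_src, pullback.lift_snd_assoc]

/-- The partite internal category with underlying graph `G` whose identities and composition are
determined by those of the sections. -/
noncomputable def toPartiteCat : PartiteCat.{w} C where
  G := G
  one i := S.sec (S.one i)
  one_src i := by rw [(S.isSectionCover i i).sec_comp, S.rest_sec_one]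
  one_tgt := S.sec_one_tgt
  comp := S.mul
  comp_src := S.mul_src
  comp_tgt := S.mul_tgt
  comp_one i j := by
    refine (S.isSectionCover i j).hom_ext (𝟙 _) fun f d x _ hx => ?_
    rw [Category.comp_id] at hx
    rw [comp_lift_assoc, S.lift_mul _ (f := S.one i) (x := d ≫ G.src i j)
      (Category.assoc _ _ _).symm ((Category.comp_id d).trans hx), S.one_comp, Category.comp_id]
    conv_rhs => rw [S.eq_src_sec hx]
    simp only [Category.assoc, (S.isSectionCover i i).sec_comp, S.rest_sec_one, Category.comp_id]
  one_comp i j := by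
    refine (S.isSectionCover i j).hom_ext (𝟙 _) fun f d x _ hx => ?_
    rw [Category.comp_id] at hx
    rw [comp_lift_assoc, S.lift_mul _ (g := S.one j) (y := d ≫ G.tgt i j)
      ((Category.comp_id d).trans hx) (Category.assoc _ _ _).symm, S.comp_one, Category.comp_id]
    exact (S.eq_src_sec hx).symm
  assoc i j k l := by
    have h := S.mul_mul
      (c := pullback.fst (G.src k l) (pullback.fst (G.src j k) (G.tgt i j) ≫ G.tgt j k))
      (b := pullback.snd (G.src k l) (pullback.fst (G.src j k) (G.tgt i j) ≫ G.tgt j k) ≫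
        pullback.fst (G.src j k) (G.tgt i j))
      (a := pullback.snd (G.src k l) (pullback.fst (G.src j k) (G.tgt i j) ≫ G.tgt j k) ≫
        pullback.snd (G.src j k) (G.tgt i j))
      (by simp only [Category.assoc, pullback.condition])
      (by rw [pullback.condition, Category.assoc])
      (by simp only [lift_fst_snd, Category.assoc, mul_tgt, pullback.condition])
      (by simp only [Category.assoc, mul_src, pullback.lift_snd_assoc, pullback.condition])
    simp only [lift_fst_snd] at h
    exact h

/-- The composition of the externalisation restricts to that of the index category. -/
theorem sec_comp_eq {i j k : G.I} (f : S.J i j) (g : S.J j k) :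
    S.sec (S.comp f g) = S.toPartiteCat.sectionComp ⟨S.sec f, (S.isSectionCover i j).sec_comp f⟩
      ⟨S.sec g, (S.isSectionCover j k).sec_comp g⟩ := by
  refine Eq.trans ?_ (S.toPartiteCat.sectionComp_eq _ _).symm
  refine Eq.trans ?_ (S.lift_mul (f := f) (g := g)
    (S.toPartiteCat.sectionComp_cond ⟨S.sec f, (S.isSectionCover i j).sec_comp f⟩
      ⟨S.sec g, (S.isSectionCover j k).sec_comp g⟩) rfl (Category.assoc _ _ _).symm).symm
  change _ = ((rest (S.sec f ≫ G.tgt i j ≫ S.sec g) ≫ S.sec f) ≫ G.src i j) ≫ _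
  rw [Category.assoc (rest _), (S.isSectionCover i j).sec_comp, rest_comp_rest_left,
    ← S.rest_sec_comp, rest_comp]

/-- The given sections, as sections of the partite internal category which they determine. -/
noncomputable def toSectionSystem : SectionSystem S.toPartiteCat where
  J := S.J
  sec {i j} f := ⟨S.sec f, (S.isSectionCover i j).sec_comp f⟩
  image f := S.image f
  isSectionCover := S.isSectionCover
  one := S.one
  sec_one _ := rfl
  comp := S.comp
  sec_comp := S.sec_comp_eq

end GraphSections

end GraphSections

/-! ### The equality of parallel maps with values in restriction idempotents -/

namespace RCatOver

variable {C : Type u} [Category.{v} C] [RestrictionCategory C]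
variable (P : RCatOver.{w} C) {i j : P.carrier}

theorem map_rest_eq (f : i ⟶ j) : rest (P.proj.map f) = P.proj.map (rest f) := (P.map_rest f).symm

/-- The set of the `P e`, for `e` a restriction idempotent on which `f` and `g` are defined and
agree. -/
def eqSet (f g : i ⟶ j) : Set (P.proj.obj i ⟶ P.proj.obj i) :=
  {y | ∃ e : i ⟶ i, IsRestIdem e ∧ e ≤ rest f ≫ rest g ∧ e ≫ f = e ≫ g ∧ P.proj.map e = y}

theorem map_mem_eqSet {f g : i ⟶ j} {e : i ⟶ i} (he : rest e = e) (hf : e ≫ rest f = e)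
    (hfg : e ≫ f = e ≫ g) (hg : e ≫ rest g = e) : P.proj.map e ∈ P.eqSet f g := by
  refine ⟨e, ⟨_, e, he⟩, ?_, hfg, rfl⟩
  rw [hom_le_iff, he, ← Category.assoc, hf, hg]

theorem exists_of_mem_eqSet {f g : i ⟶ j} {y : P.proj.obj i ⟶ P.proj.obj i}
    (hy : y ∈ P.eqSet f g) : ∃ e : i ⟶ i, rest e = e ∧ e ≫ rest f = e ∧ e ≫ rest g = e ∧
      e ≫ f = e ≫ g ∧ y = P.proj.map e := by
  obtain ⟨e, he, hle, hfg, rfl⟩ := hy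
  rw [hom_le_iff, he.rest_eq] at hle
  refine ⟨e, he.rest_eq, ?_, ?_, hfg, rfl⟩
  · conv_lhs => rw [hle, Category.assoc, Category.assoc, rest_comm, reassoc_of% rest_idem f]
    exact hle.symm
  · conv_lhs => rw [hle, Category.assoc, Category.assoc, rest_idem]
    exact hle.symm

theorem rest_eq_of_mem_eqSet {f g : i ⟶ j} {y : P.proj.obj i ⟶ P.proj.obj i}
    (hy : y ∈ P.eqSet f g) : rest y = y := by
  obtain ⟨e, he, -, -, -, rfl⟩ := P.exists_of_mem_eqSet hy
  rw [map_rest_eq, he]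

theorem eqSet_comm (f g : i ⟶ j) : P.eqSet f g = P.eqSet g f := by
  have h : ∀ f g : i ⟶ j, P.eqSet f g ⊆ P.eqSet g f := by
    intro f g y hy
    obtain ⟨e, he, hf, hg, hfg, rfl⟩ := P.exists_of_mem_eqSet hy
    exact P.map_mem_eqSet he hg hfg.symm hf
  exact (h f g).antisymm (h g f)

variable [IsJoinRestrictionCategory C]

theorem exists_isLUB_eqSet (f g : i ⟶ j) : ∃ x, IsLUB (P.eqSet f g) x := by
  refine IsJoinRestrictionCategory.exists_join _ fun x hx y hy =>
    compatible_of_le (h := 𝟙 _) ?_ ?_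
  · rw [← P.rest_eq_of_mem_eqSet hx]
    exact rest_le_id _
  · rw [← P.rest_eq_of_mem_eqSet hy]
    exact rest_le_id _

/-- The equality `⟦f = g⟧` of the parallel maps `f` and `g`. -/
noncomputable def eqVal (f g : i ⟶ j) : P.proj.obj i ⟶ P.proj.obj i :=
  (P.exists_isLUB_eqSet f g).choose

theorem isLUB_eqVal (f g : i ⟶ j) : IsLUB (P.eqSet f g) (P.eqVal f g) :=
  (P.exists_isLUB_eqSet f g).choose_spec

theorem rest_eqVal (f g : i ⟶ j) : rest (P.eqVal f g) = P.eqVal f g := by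
  refine rest_eq_of_le_id ((P.isLUB_eqVal f g).2 fun y hy => ?_)
  rw [← P.rest_eq_of_mem_eqSet hy]
  exact rest_le_id _

theorem eqVal_comm (f g : i ⟶ j) : P.eqVal f g = P.eqVal g f :=
  (P.isLUB_eqVal f g).unique (P.eqSet_comm f g ▸ P.isLUB_eqVal g f)

theorem eqVal_trans (f g h : i ⟶ j) : P.eqVal f g ≫ P.eqVal g h ≤ P.eqVal f h := by
  refine (isLUB_comp_left (P.isLUB_eqVal g h) _).2 ?_
  rintro _ ⟨y, hy, rfl⟩
  refine (isLUB_comp_right (P.isLUB_eqVal f g) _).2 ?_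
  rintro _ ⟨x, hx, rfl⟩
  obtain ⟨d, hd, hdg, hdh, hgh, rfl⟩ := P.exists_of_mem_eqSet hy
  obtain ⟨e, he, hef, heg, hfg, rfl⟩ := P.exists_of_mem_eqSet hx
  refine (P.isLUB_eqVal f h).1 ?_
  change P.proj.map e ≫ P.proj.map d ∈ _
  have hde : e ≫ d = d ≫ e := by rw [← hd, ← he, rest_comm]
  rw [← P.proj.map_comp]
  refine P.map_mem_eqSet ?_ ?_ ?_ ?_
  · rw [← he, rest_rest_comp, hd]
  · rw [hde, Category.assoc, hef]
  · rw [hde, Category.assoc, hfg, ← Category.assoc, ← hde, Category.assoc, hgh, Category.assoc]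
  · rw [Category.assoc, hdh]

theorem eqVal_self (f : i ⟶ j) : P.eqVal f f = rest (P.proj.map f) := by
  refine (P.isLUB_eqVal f f).unique ⟨?_, fun b hb => hb ?_⟩
  · intro y hy
    obtain ⟨e, he, hf, -, -, rfl⟩ := P.exists_of_mem_eqSet hy
    rw [← hf, ← he, P.proj.map_comp, ← map_rest_eq, ← map_rest_eq]
    exact rest_comp_le _ _
  · rw [map_rest_eq]
    exact P.map_mem_eqSet (rest_rest f) (rest_idem f) rfl (rest_idem f)

theorem eqVal_comp_map (f g : i ⟶ j) :
    P.eqVal f g ≫ P.proj.map f = P.eqVal f g ≫ P.proj.map g := by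
  refine eq_of_isLUB (P.isLUB_eqVal f g) fun y hy => ?_
  obtain ⟨e, -, -, -, h, rfl⟩ := P.exists_of_mem_eqSet hy
  rw [← P.proj.map_comp, h, P.proj.map_comp]

theorem eqVal_comp_rest (f g : i ⟶ j) : P.eqVal f g ≫ rest (P.proj.map f) = P.eqVal f g := by
  conv_rhs => rw [← Category.comp_id (P.eqVal f g)]
  refine eq_of_isLUB (P.isLUB_eqVal f g) fun y hy => ?_
  obtain ⟨e, -, h, -, -, rfl⟩ := P.exists_of_mem_eqSet hy
  rw [map_rest_eq, ← P.proj.map_comp, h, Category.comp_id]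

theorem map_rest_le_eqVal {f g : i ⟶ j} (h : f ≤ g) : rest (P.proj.map f) ≤ P.eqVal f g := by
  refine (P.isLUB_eqVal f g).1 ?_
  rw [map_rest_eq]
  refine P.map_mem_eqSet (rest_rest f) (rest_idem f) ?_ ((le_rest_iff f g).1 (rest_le_rest h))
  rw [rest_comp, rest_comp_of_le h]

/-- The local atlas on `P i` which is given by the equalities of maps from `i` to `j`. -/
noncomputable def eqAtlas (i j : P.carrier) : LocalAtlas (P.proj.obj i) (i ⟶ j) where
  φ f g := P.eqVal f g
  restIdem f g := ⟨_, _, P.rest_eqVal f g⟩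
  symm f g := P.eqVal_comm f g
  trans f g h := P.eqVal_trans f g h

/-! ### The internalisation of a restriction category over `C` -/

/-- A glueing of the atlas `eqAtlas P i j`, together with the images of its sections. -/
structure ArrowGlueing (i j : P.carrier) where
  arr : C
  src : arr ⟶ P.proj.obj i
  sec : (i ⟶ j) → (P.proj.obj i ⟶ arr)
  image : (i ⟶ j) → (arr ⟶ arr)
  isGlueing : IsGlueingWith (P.eqAtlas i j) src sec
  isSectionCover : IsSectionCover src sec image
  rest_sec_image : ∀ f g, rest (sec f ≫ image g) = P.eqVal f g

variable [HasLocalGlueings C]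

theorem nonempty_arrowGlueing (i j : P.carrier) : Nonempty (P.ArrowGlueing i j) := by
  obtain ⟨A, p, s, h⟩ := HasLocalGlueings.exists_glueing _ _ (P.eqAtlas i j)
  obtain ⟨e, he, hφ⟩ := h.exists_isSectionCover
  exact ⟨⟨A, p, s, e, h, he, hφ⟩⟩

/-- The object of arrows from `i` to `j` of the internalisation, with its sections. -/
noncomputable def glueing (i j : P.carrier) : P.ArrowGlueing i j :=
  Classical.choice (P.nonempty_arrowGlueing i j)

theorem rest_sec (f : i ⟶ j) : rest ((P.glueing i j).sec f) = rest (P.proj.map f) := by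
  rw [← eqVal_self, ← (P.glueing i j).rest_sec_image, (P.glueing i j).isSectionCover.sec_image]

/-- Over an arrow in the images of the sections of `f` and `g`, the maps `f` and `g` are equal. -/
theorem comp_eqVal {Z : C} {a : Z ⟶ (P.glueing i j).arr} {f g : i ⟶ j}
    (hf : a ≫ (P.glueing i j).image f = a) (hg : a ≫ (P.glueing i j).image g = a) :
    (a ≫ (P.glueing i j).src) ≫ P.eqVal f g = a ≫ (P.glueing i j).src := by
  have h := (P.glueing i j).isSectionCover.comp_rest_overlap (b := 𝟙 _)
    (c := a ≫ (P.glueing i j).src) (by rw [Category.comp_id]) hf hg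
  rwa [Category.id_comp, (P.glueing i j).rest_sec_image] at h

/-- The prescriptions `s_f ≫ τ = P f` for the target map `τ` are compatible. -/
theorem exists_tgt (i j : P.carrier) : ∃ t : (P.glueing i j).arr ⟶ P.proj.obj j,
    ∀ f, (P.glueing i j).image f ≫ t =
      (P.glueing i j).image f ≫ (P.glueing i j).src ≫ P.proj.map f := by
  have hc := (P.glueing i j).isSectionCover
  refine (exists_glue hc.isCover.rest_eq
    (fun f => (P.glueing i j).src ≫ P.proj.map f) fun f g => ?_).imp fun t ht => ht.2
  have hcomm : (P.glueing i j).image f ≫ (P.glueing i j).image g =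
      (P.glueing i j).image g ≫ (P.glueing i j).image f := by
    rw [← hc.isCover.rest_eq f, ← hc.isCover.rest_eq g, rest_comm]
  have hid : ∀ f, (P.glueing i j).image f ≫ (P.glueing i j).image f = (P.glueing i j).image f :=
    fun f => by rw [← hc.isCover.rest_eq f, rest_idem]
  have h1 := P.comp_eqVal (a := (P.glueing i j).image f ≫ (P.glueing i j).image g) (f := f) (g := g)
    (by rw [Category.assoc, ← hcomm, reassoc_of% hid f]) (by rw [Category.assoc, hid])
  simp only [← Category.assoc]
  rw [← h1, Category.assoc, P.eqVal_comp_map]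
  simp only [Category.assoc]

/-- The target map of the internalisation. -/
noncomputable def tgt (i j : P.carrier) : (P.glueing i j).arr ⟶ P.proj.obj j :=
  (P.exists_tgt i j).choose

theorem comp_tgt {Z : C} {a : Z ⟶ (P.glueing i j).arr} {f : i ⟶ j}
    (h : a ≫ (P.glueing i j).image f = a) :
    a ≫ P.tgt i j = (a ≫ (P.glueing i j).src) ≫ P.proj.map f := by
  rw [← h]
  simp only [Category.assoc]
  rw [tgt, (P.exists_tgt i j).choose_spec]

theorem tgt_total (i j : P.carrier) : IsTotal (P.tgt i j) := by
  have hc := (P.glueing i j).isSectionCover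
  have := hc.isTotal
  refine hc.isCover.isTotal_of_le fun f => ?_
  have hid : (P.glueing i j).image f ≫ (P.glueing i j).image f = (P.glueing i j).image f := by
    rw [← hc.isCover.rest_eq f, rest_idem]
  have h1 := P.comp_eqVal hid hid
  rw [eqVal_self] at h1
  have h2 : rest ((P.glueing i j).image f ≫ P.tgt i j) = (P.glueing i j).image f := by
    rw [P.comp_tgt hid, ← rest_comp_rest, h1, rest_comp_total, hc.isCover.rest_eq]
  rw [← hc.isCover.rest_eq f, rest_rest_comp, hc.isCover.rest_eq] at h2
  rw [hom_le_iff, hc.isCover.rest_eq, h2]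

/-- The underlying graph of the internalisation. -/
noncomputable def graph : PartiteGraph.{w} C where
  I := P.carrier
  obj := P.proj.obj
  arr i j := (P.glueing i j).arr
  src i j := (P.glueing i j).src
  tgt := P.tgt
  src_total i j := (P.glueing i j).isSectionCover.isTotal
  tgt_total := P.tgt_total
  hasPullback i j _ f _ := (P.glueing i j).isSectionCover.hasPullback f

end RCatOver

namespace RCatOver

/-! ### Maps into externalisations -/

variable {C : Type u} [Category.{v} C] [RestrictionCategory C]

/-- The component at `i` of the natural transformation underlying a map from `P` to the
externalisation of `B`. -/
def Hom.onObj {P : RCatOver.{w} C} {B : PartiteCat.{w} C}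
    (F : Hom P B.externalisation) (i : P.carrier) :
    B.G.obj (F.functor.obj i).idx ⟶ P.proj.obj i := F.trans.app i

/-- The value at `f` of the functor underlying a map from `P` to the externalisation of `B`. -/
def Hom.onSec {P : RCatOver.{w} C} {B : PartiteCat.{w} C} (F : Hom P B.externalisation)
    {i j : P.carrier} (f : i ⟶ j) :
    PartialSection (B.G.src (F.functor.obj i).idx (F.functor.obj j).idx) := F.functor.map f

instance {P : RCatOver.{w} C} {B : PartiteCat.{w} C}
    (F : Hom P B.externalisation) (i : P.carrier) :
    IsTotal (F.onObj i) := F.isTotal i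

section

variable {P : RCatOver.{w} C} {i j : P.carrier} {B : PartiteCat.{w} C}
  (F : Hom P B.externalisation)

theorem Hom.onSec_rest_comp {e : i ⟶ i} (he : rest e = e) (f : i ⟶ j) :
    (F.onSec (e ≫ f)).hom = rest (F.onSec e).hom ≫ (F.onSec f).hom := by
  have h : F.functor.map e = rest (F.functor.map e) := by rw [← F.map_rest, he]
  have h' : F.functor.map (e ≫ f) = rest (F.functor.map e) ≫ F.functor.map f := by
    rw [F.functor.map_comp, ← h]
  exact (congrArg PartialSection.hom h').trans (B.extRest_comp _ _)

theorem Hom.onSec_tgt (f : i ⟶ j) :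
    (F.onSec f).hom ≫ B.G.tgt _ _ ≫ F.onObj j = F.onObj i ≫ P.proj.map f :=
  (Category.assoc _ _ _).symm.trans (F.trans.naturality f)

theorem Hom.rest_onSec (f : i ⟶ j) :
    rest (F.onSec f).hom = rest (F.onObj i ≫ P.proj.map f) := by
  rw [← F.onSec_tgt, rest_comp_total]

theorem Hom.heq_onObj {F F' : Hom P B.externalisation} (h : F = F') (i : P.carrier) :
    HEq (F.onObj i) (F'.onObj i) := by rw [h]

theorem Hom.heq_onSec {F F' : Hom P B.externalisation} (h : F = F') (f : i ⟶ j) :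
    HEq (F.onSec f).hom (F'.onSec f).hom := by rw [h]

end

/-! ### The sections of the internalisation -/

variable (P : RCatOver.{w} C) {i j k : P.carrier}
  [IsJoinRestrictionCategory C] [HasLocalGlueings C]

/-- The section of the internalisation of `P` which is attached to a map `f`. -/
noncomputable def sec (f : i ⟶ j) : P.proj.obj i ⟶ (P.glueing i j).arr := (P.glueing i j).sec f

/-- The image of the section `P.sec f`. -/
noncomputable def image (f : i ⟶ j) : (P.glueing i j).arr ⟶ (P.glueing i j).arr :=
  (P.glueing i j).image f

theorem isSectionCover (i j : P.carrier) : IsSectionCover (P.glueing i j).src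
    (fun f : i ⟶ j => P.sec f) (fun f => P.image f) := (P.glueing i j).isSectionCover

theorem rest_sec_image (f g : i ⟶ j) : rest (P.sec f ≫ P.image g) = P.eqVal f g :=
  (P.glueing i j).rest_sec_image f g

theorem rest_sec_eq (f : i ⟶ j) : rest (P.sec f) = rest (P.proj.map f) := P.rest_sec f

theorem sec_le_sec {f g : i ⟶ j} (h : f ≤ g) : P.sec f ≤ P.sec g := by
  have h1 := (P.isSectionCover i j).overlap (𝟙 _) f g
  rw [Category.id_comp, Category.id_comp, Category.id_comp, rest_sec_image] at h1
  have h2 : rest (P.sec f) ≤ P.eqVal f g := by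
    rw [rest_sec_eq]
    exact P.map_rest_le_eqVal h
  have h3 : rest (P.sec f) ≫ P.eqVal f g = rest (P.sec f) := by
    have := rest_comp_of_le h2
    rwa [rest_rest] at this
  rw [hom_le_iff]
  conv_lhs => rw [← rest_comp (P.sec f), ← h3, Category.assoc, h1, ← Category.assoc, h3]

/-- The assignment of sections to maps preserves restriction to smaller domains. -/
theorem sec_rest_comp {e : i ⟶ i} (he : rest e = e) (f : i ⟶ j) :
    P.sec (e ≫ f) = P.proj.map e ≫ P.sec f := by
  have h1 : e ≫ f ≤ f := by
    rw [← he]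
    exact rest_comp_le e f
  have hr : rest (e ≫ f) = e ≫ rest f := by rw [← he, rest_rest_comp, he]
  rw [← rest_comp_of_le (P.sec_le_sec h1), rest_sec_eq, P.map_rest_eq, hr, P.proj.map_comp,
    ← P.map_rest_eq f, ← rest_sec_eq, Category.assoc, rest_comp]

/-- Where `f` equals `f'`, and `g` equals `g'` at the values of `f`, the sections of `f ≫ g` and
`f' ≫ g'` agree. -/
theorem sec_comp_congr {Z : C} {x : Z ⟶ P.proj.obj i} {f f' : i ⟶ j} {g g' : j ⟶ k}
    (hf : x ≫ P.eqVal f f' = x)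
    (hg : (x ≫ P.proj.map f) ≫ P.eqVal g g' = x ≫ P.proj.map f) :
    x ≫ P.sec (f ≫ g) = x ≫ P.sec (f' ≫ g') := by
  have hx1 : x ≫ rest (P.proj.map f) = x := by
    conv_lhs => rw [← hf, Category.assoc, eqVal_comp_rest, hf]
  have hx2 : x ≫ rest (P.proj.map f ≫ P.eqVal g g') = x := by
    rw [comp_rest, ← Category.assoc, hg, ← comp_rest, hx1]
  -- by distributivity, `⟦f = f'⟧` and `⟦g = g'⟧` may be replaced by restriction idempotents `e`
  -- and `d` on which these maps agree
  have key : P.eqVal f f' ≫ rest (P.proj.map f ≫ P.eqVal g g') ≫ P.sec (f ≫ g) =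
      P.eqVal f f' ≫ rest (P.proj.map f ≫ P.eqVal g g') ≫ P.sec (f' ≫ g') := by
    refine eq_of_isLUB (P.isLUB_eqVal f f') fun y hy => ?_
    obtain ⟨e, he, hef, -, hff, rfl⟩ := P.exists_of_mem_eqSet hy
    have hc : ∀ z : P.proj.obj i ⟶ (P.glueing i k).arr,
        P.proj.map e ≫ rest (P.proj.map f ≫ P.eqVal g g') ≫ z =
          rest (P.proj.map f ≫ P.eqVal g g') ≫ P.proj.map e ≫ z := fun z => by
      rw [← Category.assoc, ← he, ← P.map_rest_eq, ← rest_comm, Category.assoc]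
    rw [hc, hc]
    refine eq_of_isLUB (isLUB_rest (isLUB_comp_left (P.isLUB_eqVal g g') (P.proj.map f))) ?_
    rintro _ ⟨_, ⟨y, hy, rfl⟩, rfl⟩
    obtain ⟨d, hd, hdg, hdg', hgg, rfl⟩ := P.exists_of_mem_eqSet hy
    dsimp only
    rw [← P.proj.map_comp, P.map_rest_eq, ← sec_rest_comp P he, ← sec_rest_comp P he,
      ← sec_rest_comp P (rest_rest _), ← sec_rest_comp P (rest_rest _)]
    congr 1
    have h1 : ∀ g : j ⟶ k, rest (f ≫ d) ≫ e ≫ f ≫ g = e ≫ f ≫ d ≫ g := fun g => by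
      rw [← he, ← Category.assoc, ← rest_comm, he, Category.assoc, ← comp_rest_assoc' f d, hd]
    have h2 : e ≫ f' ≫ g' = e ≫ f ≫ g' := by rw [← Category.assoc, ← hff, Category.assoc]
    rw [h2, h1, h1, hgg]
  conv_lhs => rw [← hx2, ← hf]
  conv_rhs => rw [← hx2, ← hf]
  simp only [Category.assoc]
  rw [key]

theorem sec_tgt (f : i ⟶ j) : P.sec f ≫ P.tgt i j = P.proj.map f := by
  rw [P.comp_tgt ((P.isSectionCover i j).sec_image f)]
  rw [(P.isSectionCover i j).sec_comp, rest_sec_eq, rest_comp]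

theorem rest_sec_id (i : P.carrier) : rest (P.sec (𝟙 i)) = 𝟙 (P.proj.obj i) := by
  rw [rest_sec_eq, P.proj.map_id, rest_id]

theorem sec_id_tgt (i : P.carrier) : P.sec (𝟙 i) ≫ P.tgt i i = 𝟙 (P.proj.obj i) := by
  rw [sec_tgt, P.proj.map_id]

theorem rest_sec_comp (f : i ⟶ j) (g : j ⟶ k) :
    rest (P.sec (f ≫ g)) = rest (P.sec f ≫ P.tgt i j ≫ P.sec g) := by
  rw [← Category.assoc (P.sec f), sec_tgt, rest_sec_eq, P.proj.map_comp, ← rest_comp_rest,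
    ← rest_comp_rest _ (P.sec g), rest_sec_eq]

theorem sec_comp_tgt (f : i ⟶ j) (g : j ⟶ k) :
    P.sec (f ≫ g) ≫ P.tgt i k = P.sec f ≫ P.tgt i j ≫ P.sec g ≫ P.tgt j k := by
  rw [sec_tgt, ← Category.assoc (P.sec f), sec_tgt, sec_tgt, P.proj.map_comp]

/-- `sec_comp_congr`, with the equalities expressed by the overlaps of sections. -/
theorem sec_comp_congr' {Z : C} {x : Z ⟶ P.proj.obj i} {f f' : i ⟶ j} {g g' : j ⟶ k}
    (hf : x ≫ rest (P.sec f ≫ P.image f') = x)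
    (hg : (x ≫ P.sec f ≫ P.tgt i j) ≫ rest (P.sec g ≫ P.image g') = x ≫ P.sec f ≫ P.tgt i j) :
    x ≫ P.sec (f ≫ g) = x ≫ P.sec (f' ≫ g') := by
  rw [rest_sec_image] at hf hg
  rw [sec_tgt] at hg
  exact P.sec_comp_congr hf hg

/-- The sections of the internalisation are indexed by the maps of the restriction category. -/
noncomputable def graphSections : GraphSections P.graph where
  J i j := @Quiver.Hom P.carrier _ i j
  sec f := P.sec f
  image f := P.image f
  isSectionCover := P.isSectionCover
  one i := @CategoryStruct.id P.carrier _ i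
  comp f g := @CategoryStruct.comp P.carrier _ _ _ _ f g
  one_comp f := Category.id_comp f
  comp_one f := Category.comp_id f
  assoc f g h := Category.assoc f g h
  rest_sec_one := P.rest_sec_id
  sec_one_tgt := P.sec_id_tgt
  rest_sec_comp := P.rest_sec_comp
  sec_comp_tgt := P.sec_comp_tgt
  sec_comp_congr := P.sec_comp_congr'

/-- The internalisation of a restriction category over `C`. -/
noncomputable def internalisation : PartiteCat.{w} C := P.graphSections.toPartiteCat

/-- The sections `P.sec f` of the internalisation. -/
noncomputable def sections : SectionSystem P.internalisation := P.graphSections.toSectionSystem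

/-- The map of restriction categories over `C` which sends a map `f` to the section `P.sec f` of
the internalisation. -/
noncomputable def toExternalisation : Hom P P.internalisation.externalisation where
  functor :=
    { obj := fun i => ⟨i⟩
      map := fun f => P.sections.sec f
      map_id := fun _ => rfl
      map_comp := fun f g => PartialSection.ext (P.sections.sec_comp f g) }
  map_rest {i j} f := PartialSection.ext <| by
    change P.sec (rest f) = rest (P.sec f) ≫ P.sec (𝟙 i)
    rw [rest_sec_eq, P.map_rest_eq, ← sec_rest_comp P (rest_rest f), Category.comp_id]
  trans :=
    { app := fun i => 𝟙 (P.proj.obj i)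
      naturality := fun i j f => by
        change (P.sec f ≫ P.tgt i j) ≫ 𝟙 _ = 𝟙 _ ≫ P.proj.map f
        rw [sec_tgt, Category.comp_id, Category.id_comp] }
  isTotal i := isTotal_id _

/-! ### The universal property of the internalisation -/

variable {P}

section

variable {B : PartiteCat.{w} C} (F : Hom P B.externalisation)

/-- The sections `onSec f` and `onSec g` agree over the overlap `⟦f = g⟧`, because `F` preserves
restriction idempotents on which `f` and `g` agree. -/
theorem Hom.onSec_overlap (f g : i ⟶ j) :
    rest (F.onObj i ≫ P.sec f ≫ P.image g) ≫ (F.onSec f).hom =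
      rest (F.onObj i ≫ P.sec f ≫ P.image g) ≫ (F.onSec g).hom := by
  rw [← rest_comp_rest (F.onObj i), rest_sec_image]
  refine eq_of_isLUB (isLUB_rest (isLUB_comp_left (P.isLUB_eqVal f g) (F.onObj i))) ?_
  rintro _ ⟨_, ⟨y, hy, rfl⟩, rfl⟩
  obtain ⟨e, he, -, -, hfg, rfl⟩ := P.exists_of_mem_eqSet hy
  dsimp only
  rw [← F.rest_onSec, ← F.onSec_rest_comp he, ← F.onSec_rest_comp he, hfg]

theorem Hom.rest_onSec_eq (f : i ⟶ j) :
    rest (F.onSec f).hom = rest (F.onObj i ≫ P.sec f) := by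
  rw [F.rest_onSec, ← rest_comp_rest, ← rest_comp_rest _ (P.sec f), ← P.rest_sec_eq]

theorem Hom.onSec_tgt_eq (f : i ⟶ j) : (F.onSec f).hom ≫ B.G.tgt _ _ ≫ F.onObj j =
    F.onObj i ≫ P.sec f ≫ P.tgt i j := by
  rw [F.onSec_tgt, sec_tgt]

/-- The action on sections of a map from `P` to the externalisation of `B`. -/
noncomputable def Hom.sectionAction : SectionAction P.sections B where
  onI i := (F.functor.obj i).idx
  onObj i := F.onObj i
  onObj_total i := F.isTotal i
  onSec f := F.onSec f
  rest_onSec := F.rest_onSec_eq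
  onSec_overlap := F.onSec_overlap
  onSec_tgt := F.onSec_tgt_eq
  onSec_one i := congrArg PartialSection.hom (F.functor.map_id i)
  onSec_comp f g := congrArg PartialSection.hom (F.functor.map_comp f g)

end

/-- The map `P.toExternalisation`, as a morphism to a value of `Phi C`. -/
noncomputable def toPhi (P : RCatOver.{w} C) : P ⟶ (Phi C).obj P.internalisation :=
  P.toExternalisation

/-- The section functor `P.toExternalisation` is a universal arrow from `P` to `Phi C`. -/
theorem bijective_toPhi_comp (P : RCatOver.{w} C) (B : PartiteCat.{w} C) :
    Function.Bijective fun G : P.internalisation ⟶ B => P.toPhi ≫ (Phi C).map G := by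
  constructor
  · intro G G' h
    refine Cofunctor.ext_sections P.sections
      (funext fun i => congrArg (fun F : Hom P B.externalisation => (F.functor.obj i).idx) h)
      (fun i => ?_) fun {i j} f => Hom.heq_onSec h (i := i) (j := j) f
    exact (heq_of_eq (Category.comp_id (G.onObj i)).symm).trans
      ((Hom.heq_onObj h i).trans (heq_of_eq (Category.comp_id (G'.onObj i))))
  · intro F
    refine ⟨(Hom.sectionAction F).toCofunctor, RCatOver.Hom.ext_of
      (Functor.hext (fun _ => rfl) fun i j f => heq_of_eq (PartialSection.ext ?_)) fun i => ?_⟩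
    · exact (Hom.sectionAction F).toCofunctor_sectionMap f
    · exact heq_of_eq (Category.comp_id (Hom.onObj F i))

end RCatOver

section

variable (C : Type u) [Category.{v} C] [RestrictionCategory C]
    [IsJoinRestrictionCategory C] [HasLocalGlueings C]

/-- Cofunctors out of the internalisation of `P` are maps from `P` to an externalisation. -/
noncomputable def homEquiv (P : RCatOver.{w} C) (B : PartiteCat.{w} C) :
    (P.internalisation ⟶ B) ≃ (P ⟶ (Phi C).obj B) :=
  Equiv.ofBijective _ (P.bijective_toPhi_comp B)

theorem homEquiv_naturality (P : RCatOver.{w} C) (B B' : PartiteCat.{w} C) (g : B ⟶ B')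
    (h : P.internalisation ⟶ B) :
    homEquiv C P B' (h ≫ g) = homEquiv C P B h ≫ (Phi C).map g := by
  simp only [homEquiv, Equiv.ofBijective_apply, Functor.map_comp, Category.assoc]

/-- The internalisation functor `Ψ`, left adjoint to `Phi C`. -/
noncomputable def Psi : RCatOver.{w} C ⥤ PartiteCat.{w} C :=
  Adjunction.leftAdjointOfEquiv (G := Phi C) (homEquiv C) (homEquiv_naturality C)

/-- The adjunction between internalisation and externalisation. -/
noncomputable def psiAdj : Psi.{w} C ⊣ Phi C :=
  Adjunction.adjunctionOfEquivLeft (homEquiv C) (homEquiv_naturality C)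

theorem psiAdj_unit_app (P : RCatOver.{w} C) : (psiAdj C).unit.app P = P.toPhi := by
  have h : (psiAdj C).unit.app P = homEquiv C P _ (𝟙 _) := rfl
  refine h.trans ?_
  change P.toPhi ≫ (Phi C).map (𝟙 _) = _
  rw [(Phi C).map_id, Category.comp_id]

end

/-! ### Externalisations are hyperconnected join restriction categories -/

section Ext

variable {C : Type u} [Category.{v} C] [RestrictionCategory C]

namespace PartiteCat

variable (A : PartiteCat.{w} C) {i j k : A.Ext}

theorem Ext.rest_comp_hom (s : i ⟶ j) (t : i ⟶ k) :
    PartialSection.hom (rest s ≫ t) = rest (PartialSection.hom s) ≫ PartialSection.hom t :=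
  A.extRest_comp s t

theorem Ext.le_iff (s t : i ⟶ j) : s ≤ t ↔ PartialSection.hom s ≤ PartialSection.hom t := by
  rw [hom_le_iff, hom_le_iff, ← Ext.rest_comp_hom]
  exact ⟨fun h => congrArg PartialSection.hom h, fun h => Ext.hom_ext A h⟩

theorem Ext.compatible_iff (s t : i ⟶ j) :
    Compatible s t ↔ Compatible (PartialSection.hom s) (PartialSection.hom t) := by
  unfold Compatible
  rw [← Ext.rest_comp_hom, ← Ext.rest_comp_hom]
  exact ⟨fun h => congrArg PartialSection.hom h, fun h => Ext.hom_ext A h⟩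

theorem Ext.rest_hom_comp (s : i ⟶ j) (t : j ⟶ k) :
    rest (PartialSection.hom (s ≫ t)) =
      rest (PartialSection.hom s ≫ A.G.tgt i.idx j.idx ≫ PartialSection.hom t) :=
  A.rest_sectionComp s t

/-- A map of the externalisation is a join if the underlying map of `C` is. -/
theorem Ext.isLUB_of_hom {S : Set (i ⟶ j)} {h : i ⟶ j}
    (hS : IsLUB ((fun s : i ⟶ j => PartialSection.hom s) '' S) (PartialSection.hom h)) :
    IsLUB S h := by
  refine ⟨fun s hs => (Ext.le_iff A s h).2 (hS.1 ⟨s, hs, rfl⟩), fun b hb => ?_⟩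
  rw [Ext.le_iff]
  refine hS.2 ?_
  rintro _ ⟨s, hs, rfl⟩
  exact (Ext.le_iff A s b).1 (hb hs)

theorem extProj_map_rest (s : i ⟶ i) (hs : rest s = s) :
    A.extProj.map s = rest (PartialSection.hom s) := by
  have h : PartialSection.hom s = rest (PartialSection.hom s) ≫ A.one i.idx :=
    congrArg PartialSection.hom hs.symm
  change PartialSection.hom s ≫ A.G.tgt i.idx i.idx = _
  conv_lhs => rw [h]
  rw [Category.assoc, A.one_tgt, Category.comp_id]

/-- The restriction idempotent on `i` which corresponds to `e ∈ 𝒪(A_i)` is `e ≫ η_i`. -/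
theorem Ext.bijective_extProj (i : A.Ext) :
    Function.Bijective (mapRestIdem A.extProj A.externalisation.map_rest i) := by
  refine ⟨?_, ?_⟩
  · intro e e' h
    have h1 : A.extProj.map e.1 = A.extProj.map e'.1 := congrArg Subtype.val h
    rw [A.extProj_map_rest _ e.2.rest_eq, A.extProj_map_rest _ e'.2.rest_eq] at h1
    have h2 : rest e.1 = rest e'.1 := Ext.hom_ext A (congrArg (fun z => z ≫ A.one i.idx) h1)
    exact Subtype.ext (e.2.rest_eq.symm.trans (h2.trans e'.2.rest_eq))
  · rintro ⟨e, he⟩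
    replace he : rest (C := C) (A := A.G.obj i.idx) e = e := he.rest_eq
    have := A.isTotal_one i.idx
    have hr : rest (C := C) (A := A.G.obj i.idx) (e ≫ A.one i.idx) = e :=
      (@rest_comp_total C _ _ _ _ _ e (A.one i.idx) this).trans he
    let s : i ⟶ i := PartialSection.mk (C := C) (X := A.G.obj i.idx) (e ≫ A.one i.idx) (by
      refine Eq.trans ?_ hr.symm
      exact (Category.assoc _ _ _).trans
        ((congrArg (fun z => e ≫ z) (A.one_src i.idx)).trans (Category.comp_id _)))
    have hs : rest s = s := Ext.hom_ext A (congrArg (fun z => z ≫ A.one i.idx) hr)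
    exact ⟨⟨s, ⟨_, s, hs⟩⟩, Subtype.ext ((A.extProj_map_rest s hs).trans hr)⟩

variable [IsJoinRestrictionCategory C]

/-- Compatible families of partial sections have joins, computed in `C`. -/
theorem Ext.exists_isLUB {S : Set (i ⟶ j)} (hS : ∀ s ∈ S, ∀ t ∈ S, Compatible s t) :
    ∃ h : i ⟶ j,
      IsLUB ((fun s : i ⟶ j => PartialSection.hom s) '' S) (PartialSection.hom h) := by
  obtain ⟨h, hh⟩ := IsJoinRestrictionCategory.exists_join
    ((fun s : i ⟶ j => PartialSection.hom s) '' S) (by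
      rintro _ ⟨s, hs, rfl⟩ _ ⟨t, ht, rfl⟩
      exact (Ext.compatible_iff A s t).1 (hS s hs t ht))
  have h1 : h ≫ A.G.src i.idx j.idx = rest h := by
    refine (isLUB_comp_right hh (A.G.src i.idx j.idx)).unique ?_
    have h2 := isLUB_rest hh
    rw [Set.image_image] at h2 ⊢
    rwa [Set.image_congr (g := fun s : i ⟶ j => rest (PartialSection.hom s))
      fun s _ => PartialSection.comp_eq s]
  exact ⟨⟨h, h1⟩, hh⟩

/-- Conversely to `Ext.isLUB_of_hom`, joins of compatible families have joins as underlying maps. -/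
theorem Ext.isLUB_hom {S : Set (i ⟶ j)} {h : i ⟶ j} (hS : ∀ s ∈ S, ∀ t ∈ S, Compatible s t)
    (hh : IsLUB S h) :
    IsLUB ((fun s : i ⟶ j => PartialSection.hom s) '' S) (PartialSection.hom h) := by
  obtain ⟨h', hh'⟩ := Ext.exists_isLUB A hS
  rwa [hh.unique (Ext.isLUB_of_hom A hh')]

instance : IsJoinRestrictionCategory A.Ext where
  exists_join S hS := (Ext.exists_isLUB A hS).imp fun h hh => Ext.isLUB_of_hom A hh
  precomp_join {i j k} s S h hS hh := by
    have h1 := Ext.isLUB_hom A hS hh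
    refine Ext.isLUB_of_hom A (isLUB_of_rest ?_ ?_)
    · rintro _ ⟨_, ⟨t, ht, rfl⟩, rfl⟩
      exact (Ext.le_iff A _ _).1 (comp_le_comp_left s (hh.1 ht))
    · rw [Ext.rest_hom_comp, ← Category.assoc]
      have h2 := isLUB_rest (isLUB_comp_left h1 (PartialSection.hom s ≫ A.G.tgt _ _))
      rw [Set.image_image, Set.image_image] at h2
      rw [Set.image_image, Set.image_image]
      convert h2 using 2
      rw [Ext.rest_hom_comp, Category.assoc]

end PartiteCat

theorem isHyperconnectedJoin_externalisation [IsJoinRestrictionCategory C]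
    (A : PartiteCat.{w} C) : isHyperconnectedJoin C A.externalisation :=
  ⟨inferInstanceAs (IsJoinRestrictionCategory A.Ext), PartiteCat.Ext.bijective_extProj A⟩

end Ext

/-! ### Fully faithful restriction functors -/

section FullyFaithful

universe w' v'

variable {A : Type w} [Category.{v} A] [RestrictionCategory A]
  {B : Type w'} [Category.{v} B] [RestrictionCategory B] {F : A ⥤ B}

theorem IsRestrictionFunctor.map_le_iff (hF : IsRestrictionFunctor F) [F.Faithful] {X Y : A}
    {f g : X ⟶ Y} : F.map f ≤ F.map g ↔ f ≤ g := by
  rw [hom_le_iff, hom_le_iff, ← hF, ← F.map_comp]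
  exact F.map_injective.eq_iff

theorem IsRestrictionFunctor.compatible_iff (hF : IsRestrictionFunctor F) [F.Faithful] {X Y : A}
    {f g : X ⟶ Y} : Compatible (F.map f) (F.map g) ↔ Compatible f g := by
  unfold Compatible
  rw [← hF, ← hF, ← F.map_comp, ← F.map_comp]
  exact F.map_injective.eq_iff

theorem IsRestrictionFunctor.isLUB_iff (hF : IsRestrictionFunctor F) [F.Full] [F.Faithful]
    {X Y : A} {S : Set (X ⟶ Y)} {h : X ⟶ Y} :
    IsLUB ((fun f => F.map f) '' S) (F.map h) ↔ IsLUB S h := by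
  constructor
  · refine fun H => ⟨fun f hf => hF.map_le_iff.1 (H.1 ⟨f, hf, rfl⟩), fun b hb => ?_⟩
    refine hF.map_le_iff.1 (H.2 ?_)
    rintro _ ⟨f, hf, rfl⟩
    exact hF.map_le_iff.2 (hb hf)
  · refine fun H => ⟨?_, fun b hb => ?_⟩
    · rintro _ ⟨f, hf, rfl⟩
      exact hF.map_le_iff.2 (H.1 hf)
    · obtain ⟨b, rfl⟩ := F.map_surjective b
      exact hF.map_le_iff.2 (H.2 fun f hf => hF.map_le_iff.1 (hb ⟨f, hf, rfl⟩))

theorem IsRestrictionFunctor.isJoinRestrictionCategory (hF : IsRestrictionFunctor F) [F.Full]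
    [F.Faithful] [IsJoinRestrictionCategory B] : IsJoinRestrictionCategory A where
  exists_join S hS := by
    obtain ⟨h, hh⟩ := IsJoinRestrictionCategory.exists_join ((fun f => F.map f) '' S) (by
      rintro _ ⟨f, hf, rfl⟩ _ ⟨g, hg, rfl⟩
      exact hF.compatible_iff.2 (hS f hf g hg))
    obtain ⟨h, rfl⟩ := F.map_surjective h
    exact ⟨h, hF.isLUB_iff.1 hh⟩
  precomp_join g S h _ hh := by
    have h1 := isLUB_comp_left (hF.isLUB_iff.2 hh) (F.map g)
    rw [← hF.isLUB_iff, F.map_comp]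
    rw [Set.image_image] at h1 ⊢
    simpa only [F.map_comp] using h1

theorem IsRestrictionFunctor.bijective_mapRestIdem (hF : IsRestrictionFunctor F) [F.Full]
    [F.Faithful] (X : A) : Function.Bijective (mapRestIdem F hF X) := by
  constructor
  · intro e e' h
    exact Subtype.ext (F.map_injective (congrArg Subtype.val h))
  · rintro ⟨e, he⟩
    obtain ⟨e, rfl⟩ := F.map_surjective e
    have h : rest e = e := F.map_injective (by rw [hF, he.rest_eq])
    exact ⟨⟨e, ⟨_, e, h⟩⟩, rfl⟩

end FullyFaithful

/-! ### Invertibility of the unit -/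

namespace RCatOver

variable {C : Type u} [Category.{v} C] [RestrictionCategory C]
  [IsJoinRestrictionCategory C] [HasLocalGlueings C] {P : RCatOver.{w} C}

/-- The two properties of externalisations are inherited along the unit. -/
theorem isHyperconnectedJoin_of_fullyFaithful
    [P.toExternalisation.functor.Full] [P.toExternalisation.functor.Faithful] :
    isHyperconnectedJoin C P := by
  have hE := isHyperconnectedJoin_externalisation P.internalisation
  have := hE.1
  have hU : IsRestrictionFunctor P.toExternalisation.functor := P.toExternalisation.map_rest
  refine ⟨IsRestrictionFunctor.isJoinRestrictionCategory hU, fun i => ?_⟩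
  have h := (hE.2 (P.toExternalisation.functor.obj i)).comp
    (IsRestrictionFunctor.bijective_mapRestIdem hU i)
  have he : mapRestIdem P.proj P.map_rest i =
      mapRestIdem P.internalisation.externalisation.proj P.internalisation.externalisation.map_rest
        (P.toExternalisation.functor.obj i) ∘ mapRestIdem P.toExternalisation.functor hU i :=
    funext fun e => Subtype.ext (P.sec_tgt e.1).symm
  rw [he]
  exact h

theorem isHyperconnectedJoin_of_isIso (h : IsIso P.toPhi) : isHyperconnectedJoin C P := by
  obtain ⟨G, h1, h2⟩ := h
  have e1 : 𝟭 P.carrier = P.toExternalisation.functor ⋙ Hom.functor G :=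
    (congrArg Hom.functor h1).symm
  have e2 : Hom.functor G ⋙ P.toExternalisation.functor = 𝟭 _ := congrArg Hom.functor h2
  let e := CategoryTheory.Equivalence.mk P.toExternalisation.functor (Hom.functor G)
    (eqToIso e1) (eqToIso e2)
  have : P.toExternalisation.functor.IsEquivalence := e.isEquivalence_functor
  exact isHyperconnectedJoin_of_fullyFaithful

variable {i j : P.carrier}

/-- If `f` and `g` have the same section, then `⟦f = g⟧` is the image under `P` of their common
domain. As `P` is hyperconnected, this domain is the join of the restriction idempotents on which
`f` and `g` agree. -/
theorem sec_injective (hP : isHyperconnectedJoin C P) {f g : i ⟶ j} (h : P.sec f = P.sec g) :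
    f = g := by
  have := hP.1
  have hinj : ∀ {e e' : i ⟶ i}, rest e = e → rest e' = e' → P.proj.map e = P.proj.map e' →
      e = e' := fun {e e'} he he' hee =>
    congrArg Subtype.val ((hP.2 i).1 (a₁ := ⟨e, .of_rest_eq he⟩) (a₂ := ⟨e', .of_rest_eq he'⟩)
      (Subtype.ext hee))
  have h1 : P.eqVal f g = rest (P.proj.map f) := by
    rw [← rest_sec_image, h, (P.isSectionCover i j).sec_image, ← rest_sec_eq, h]
  have hr : rest f = rest g := hinj (rest_rest f) (rest_rest g) (by
    rw [← P.map_rest_eq, ← P.map_rest_eq, ← rest_sec_eq, h, rest_sec_eq])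
  -- the join in `P.carrier` of the restriction idempotents on which `f` and `g` agree
  let E : Set (i ⟶ i) := {e | rest e = e ∧ e ≫ rest f = e ∧ e ≫ rest g = e ∧ e ≫ f = e ≫ g}
  have hle : ∀ e ∈ E, e ≤ rest f := fun e he => by
    rw [hom_le_iff, he.1, he.2.1]
  obtain ⟨x, hx⟩ := IsJoinRestrictionCategory.exists_join E
    fun e he e' he' => compatible_of_le (hle e he) (hle e' he')
  have hxf : x ≤ rest f := hx.2 hle
  have hxr : rest x = x := rest_eq_of_le_id (hxf.trans (rest_le_id f))
  have hmono : ∀ {e e' : i ⟶ i}, e ≤ e' → P.proj.map e ≤ P.proj.map e' := fun {e e'} he => by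
    rw [hom_le_iff, P.map_rest_eq, ← P.proj.map_comp, rest_comp_of_le he]
  have h2 : x = rest f := hinj hxr (rest_rest f) (by
    refine le_antisymm (hmono hxf) ?_
    rw [← P.map_rest_eq, ← h1]
    refine (P.isLUB_eqVal f g).2 fun y hy => ?_
    obtain ⟨e, he, hf, hg, hfg, rfl⟩ := P.exists_of_mem_eqSet hy
    exact hmono (hx.1 ⟨he, hf, hg, hfg⟩))
  have h3 : x ≫ f = x ≫ g := eq_of_isLUB hx fun e he => he.2.2.2
  rwa [h2, rest_comp, hr, rest_comp] at h3

/-- A partial section `t` agrees with the section of `f` on a restriction idempotent `P (e f)`. By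
`sec_injective` the maps `e f ≫ f` are compatible, and `t` is the section of their join. -/
theorem sec_surjective (hP : isHyperconnectedJoin C P)
    (t : P.proj.obj i ⟶ (P.glueing i j).arr) (ht : t ≫ (P.glueing i j).src = rest t) :
    ∃ f : i ⟶ j, P.sec f = t := by
  have := hP.1
  have hc := P.isSectionCover i j
  have hsurj : ∀ d : P.proj.obj i ⟶ P.proj.obj i, rest d = d →
      ∃ e : i ⟶ i, rest e = e ∧ P.proj.map e = d := fun d hd => by
    obtain ⟨e, he⟩ := (hP.2 i).2 ⟨d, .of_rest_eq hd⟩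
    exact ⟨e.1, e.2.rest_eq, congrArg Subtype.val he⟩
  have hinj : ∀ {e e' : i ⟶ i}, rest e = e → rest e' = e' → P.proj.map e = P.proj.map e' →
      e = e' := fun {e e'} he he' hee =>
    congrArg Subtype.val ((hP.2 i).1 (a₁ := ⟨e, .of_rest_eq he⟩) (a₂ := ⟨e', .of_rest_eq he'⟩)
      (Subtype.ext hee))
  -- the part of `P i` on which `t` agrees with the section of `f`
  choose e he hPe using fun f : i ⟶ j => hsurj (rest (t ≫ P.image f)) (rest_rest _)
  have hts : ∀ f, rest (t ≫ P.image f) ≫ P.sec f = rest (t ≫ P.image f) ≫ t := fun f => by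
    rw [hc.rest_comp_image_eq t f, ht, rest_comp_rest_left]
  obtain ⟨h, hh, hef⟩ := exists_glue he (fun f => f) (fun f g => sec_injective hP (by
    rw [sec_rest_comp P (he f), sec_rest_comp P (he f), sec_rest_comp P (he g),
      sec_rest_comp P (he g), hPe, hPe, hts g, ← Category.assoc, ← rest_comm, Category.assoc,
      hts f, ← Category.assoc, rest_comm, Category.assoc]))
  have h1 : rest t ≫ P.sec h = t := by
    refine Eq.trans ?_ (rest_comp t)
    refine hc.isCover.ext_along t fun f => ?_
    rw [← hPe, ← sec_rest_comp P (he f), hef, sec_rest_comp P (he f), hPe, hts]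
  -- the domain of `h` is contained in that of `t`
  obtain ⟨x, hx, hPx⟩ := hsurj (rest t) (rest_rest t)
  have hex : ∀ f, e f ≤ x := fun f => by
    have h2 : e f ≫ x = e f := by
      refine hinj ?_ (he f) ?_
      · rw [← he f, rest_rest_comp, hx]
      · rw [P.proj.map_comp, hPe, hPx, rest_comp_rest_left]
    rw [hom_le_iff, he, h2]
  have hhx : rest h ≤ x := by
    refine (isLUB_rest hh).2 ?_
    rintro _ ⟨_, ⟨f, rfl⟩, rfl⟩
    refine le_trans ?_ (hex f)
    have h2 := rest_comp_le_rest (e f) f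
    rwa [he] at h2
  have h2 : rest (P.sec h) ≤ rest t := by
    rw [rest_sec_eq, P.map_rest_eq, ← hPx]
    rw [hom_le_iff, P.map_rest_eq, ← P.proj.map_comp, rest_comp_of_le hhx]
  refine ⟨h, (eq_of_le_of_rest_eq (le_of_eq_rest_comp t h1.symm) (le_antisymm ?_ h2)).symm⟩
  exact rest_le_rest (le_of_eq_rest_comp t h1.symm)

/-- The functor underlying the unit is fully faithful and bijective on objects. -/
theorem isIso_toPhi (hP : isHyperconnectedJoin C P) : IsIso P.toPhi := by
  have hfaith : P.toExternalisation.functor.Faithful :=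
    ⟨fun {i j f g} h => sec_injective hP (congrArg PartialSection.hom h)⟩
  have hfull : P.toExternalisation.functor.Full := ⟨fun {i j} t => by
    obtain ⟨f, hf⟩ := sec_surjective hP (PartialSection.hom t) (PartialSection.comp_eq t)
    exact ⟨f, PartialSection.ext hf⟩⟩
  let U := P.toExternalisation.functor
  let o : P.internalisation.externalisation.carrier → P.carrier := fun x => x.idx
  have hU : ∀ {i j : P.carrier} (f : i ⟶ j), U.map (rest f) = rest (U.map f) := fun f =>
    P.toExternalisation.map_rest f
  let pre : ∀ {x y : P.internalisation.externalisation.carrier}, (x ⟶ y) → (o x ⟶ o y) :=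
    fun {x y} t => U.preimage (X := o x) (Y := o y) t
  have hpre : ∀ {x y : P.internalisation.externalisation.carrier} (t : x ⟶ y),
      U.map (pre t) = t := fun {x y} t => U.map_preimage (X := o x) (Y := o y) t
  let V : Hom P.internalisation.externalisation P :=
    { functor :=
        { obj := o
          map := pre
          map_id := fun x => U.map_injective ((hpre (𝟙 x)).trans (U.map_id (o x)).symm)
          map_comp := fun s t => U.map_injective <| by
            rw [U.map_comp, hpre, hpre, hpre]
            rfl }
      map_rest := fun t => U.map_injective <| by
        dsimp only
        rw [hU, hpre, hpre]
        rfl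
      trans :=
        { app := fun x => 𝟙 (P.proj.obj (o x))
          naturality := fun x y t => by
            have h : P.sec (pre t) = PartialSection.hom t :=
              congrArg PartialSection.hom (hpre t)
            refine (Category.comp_id _).trans (Eq.trans ?_ (Category.id_comp _).symm)
            exact (P.sec_tgt (pre t)).symm.trans
              (congrArg (fun z => z ≫ P.tgt (o x) (o y)) h) }
      isTotal := fun x => isTotal_id _ }
  refine ⟨V, ?_, ?_⟩
  · refine RCatOver.Hom.ext_of (Functor.hext (fun _ => rfl) fun i j f =>
      heq_of_eq (U.preimage_map f)) fun i => heq_of_eq (Category.comp_id _)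
  · refine RCatOver.Hom.ext_of (Functor.hext (fun _ => rfl) fun i j f =>
      heq_of_eq (hpre f)) fun i => heq_of_eq (Category.comp_id _)

end RCatOver

/-! ### Source-étale partite internal categories -/

section Etale

variable {C : Type u} [Category.{v} C] [RestrictionCategory C]

/-- The values of `F` on the partial sections `s` and `t` agree over a restriction idempotent `d` on
which `s` and `t` agree. -/
theorem RCatOver.Hom.onSec_congr {A B : PartiteCat.{w} C}
    (F : RCatOver.Hom A.externalisation B.externalisation) {i j : A.G.I}
    {d : A.G.obj i ⟶ A.G.obj i} (s t : PartialSection (A.G.src i j))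
    (hd : d ≫ rest s.hom = d) (hd' : rest d = d) (h : d ≫ s.hom = d ≫ t.hom)
    {z : B.G.obj (F.functor.obj ⟨i⟩).idx ⟶ B.G.obj (F.functor.obj ⟨i⟩).idx}
    (hz : z = rest (F.onObj ⟨i⟩ ≫ d)) :
    z ≫ (F.onSec (i := (⟨i⟩ : A.Ext)) (j := (⟨j⟩ : A.Ext)) s).hom =
      z ≫ (F.onSec (i := (⟨i⟩ : A.Ext)) (j := (⟨j⟩ : A.Ext)) t).hom := by
  subst hz
  -- the restriction idempotent `e` of the externalisation which corresponds to `d`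
  have hds : rest (d ≫ s.hom) = d := by rw [← hd', rest_rest_comp, hd', hd]
  let x : A.Ext := ⟨i⟩
  let y : A.Ext := ⟨j⟩
  let r : x ⟶ y := (⟨d ≫ s.hom, by rw [Category.assoc, s.comp_eq, hds, hd]⟩ :
    PartialSection (A.G.src i j))
  have e1 : ∀ q : x ⟶ y, PartialSection.hom (rest r ≫ q) = d ≫ PartialSection.hom q := fun q =>
    (A.extRest_comp r q).trans (congrArg (fun z => z ≫ PartialSection.hom q) hds)
  have e2 : rest r ≫ (show x ⟶ y from s) = rest r ≫ (show x ⟶ y from t) :=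
    PartialSection.ext ((e1 _).trans (h.trans (e1 _).symm))
  have e3 : A.externalisation.proj.map (rest r) = d := by
    refine (A.externalisation.map_rest r).trans ?_
    refine (rest_comp_total (d ≫ s.hom) (A.G.tgt i j)).trans hds
  have e4 : rest (F.onSec (i := x) (j := x) (rest r)).hom = rest (F.onObj x ≫ d) :=
    (F.rest_onSec (i := x) (j := x) (rest r)).trans
      (congrArg (fun z => rest (F.onObj x ≫ z)) e3)
  have e5 : ∀ q : x ⟶ y, (F.onSec (i := x) (j := y) (rest r ≫ q)).hom =
      rest (F.onObj x ≫ d) ≫ (F.onSec (i := x) (j := y) q).hom := fun q =>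
    (F.onSec_rest_comp (i := x) (j := y) (rest_rest r) q).trans
      (congrArg (fun z => z ≫ (F.onSec (i := x) (j := y) q).hom) e4)
  refine (e5 s).symm.trans (Eq.trans ?_ (e5 t))
  exact congrArg (fun q => (F.onSec (i := x) (j := y) q).hom) e2

variable [IsJoinRestrictionCategory C]

namespace isSourceEtale

variable {A B : PartiteCat.{w} C}

theorem exists_isSectionCover (hA : isSourceEtale C A) (i j : A.G.I) :
    ∃ e, IsSectionCover (A.G.src i j) (fun t : PartialSection (A.G.src i j) => t.hom) e :=
  (hA i j).exists_isSectionCover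

/-- All partial sections of the source maps of a source-étale partite internal category. -/
noncomputable def sectionSystem (hA : isSourceEtale C A) : SectionSystem A where
  J i j := PartialSection (A.G.src i j)
  sec s := s
  image {i j} := (hA.exists_isSectionCover i j).choose
  isSectionCover i j := (hA.exists_isSectionCover i j).choose_spec
  one := A.extId
  sec_one _ := rfl
  comp s t := A.extComp s t
  sec_comp _ _ := rfl

/-- The action on sections of a map between externalisations. -/
noncomputable def sectionAction (hA : isSourceEtale C A)
    (F : RCatOver.Hom A.externalisation B.externalisation) :
    SectionAction hA.sectionSystem B where
  onI i := (F.functor.obj ⟨i⟩).idx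
  onObj i := F.onObj ⟨i⟩
  onObj_total i := F.isTotal ⟨i⟩
  onSec {i j} s := F.onSec (i := (⟨i⟩ : A.Ext)) (j := (⟨j⟩ : A.Ext)) s
  rest_onSec {i j} s := by
    refine (F.rest_onSec (i := (⟨i⟩ : A.Ext)) (j := (⟨j⟩ : A.Ext)) s).trans ?_
    refine Eq.trans ?_ (rest_comp_total (F.onObj ⟨i⟩ ≫ s.hom) (A.G.tgt i j))
    exact congrArg rest (Category.assoc _ _ _).symm
  onSec_overlap {i j} s t := by
    have hc := hA.sectionSystem.isSectionCover i j
    refine RCatOver.Hom.onSec_congr F s t (d := rest (s.hom ≫ hA.sectionSystem.image t)) ?_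
      (rest_rest _) ?_
      (rest_comp_rest _ _).symm
    · exact rest_comp_rest_left s.hom (hA.sectionSystem.image t)
    · have h := hc.overlap (𝟙 _) s t
      simp only [Category.id_comp] at h
      exact h
  onSec_tgt {i j} s := F.onSec_tgt (i := (⟨i⟩ : A.Ext)) (j := (⟨j⟩ : A.Ext)) s
  onSec_one i := congrArg PartialSection.hom (F.functor.map_id ⟨i⟩)
  onSec_comp {i j k} s t := congrArg PartialSection.hom
    (F.functor.map_comp (X := ⟨i⟩) (Y := ⟨j⟩) (Z := ⟨k⟩) s t)

/-- Externalisation is fully faithful on maps out of a source-étale partite internal category. -/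
theorem bijective_map (hA : isSourceEtale C A) (B : PartiteCat.{w} C) :
    Function.Bijective fun G : A ⟶ B => (Phi C).map G := by
  constructor
  · intro G G' h
    refine Cofunctor.ext_sections hA.sectionSystem
      (funext fun i => congrArg (fun F : RCatOver.Hom A.externalisation B.externalisation =>
        (F.functor.obj ⟨i⟩).idx) h)
      (fun i => RCatOver.Hom.heq_onObj h ⟨i⟩) fun {i j} f =>
        RCatOver.Hom.heq_onSec (P := A.externalisation) h (i := ⟨i⟩) (j := ⟨j⟩) f
  · intro F
    refine ⟨(hA.sectionAction F).toCofunctor, RCatOver.Hom.ext_of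
      (Functor.hext (fun _ => rfl) fun i j f => heq_of_eq (PartialSection.ext ?_))
      fun i => HEq.rfl⟩
    exact (hA.sectionAction F).toCofunctor_sectionMap f

end isSourceEtale

end Etale

/-! ### Étaleness is invariant under isomorphism -/

section Iso

variable {C : Type u} [Category.{v} C] [RestrictionCategory C]

instance isTotal_of_isIso {X Y : C} (a : X ⟶ Y) [IsIso a] : IsTotal a :=
  IsTotal.of_comp a (inv a) (by rw [IsIso.hom_inv_id]; infer_instance)

theorem IsLocalHomeo.iso_comp_iso [IsJoinRestrictionCategory C] {X A B Y : C} {p : A ⟶ B}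
    (hp : IsLocalHomeo p) (a : X ⟶ A) (b : B ⟶ Y) [IsIso a] [IsIso b] :
    IsLocalHomeo (a ≫ p ≫ b) := by
  obtain ⟨hp, S, hS, hl⟩ := hp
  refine ⟨inferInstance, _, ?_, isLUB_comp_left (isLUB_comp_right hl b) a⟩
  rintro _ ⟨_, ⟨q, hq, rfl⟩, rfl⟩
  obtain ⟨s, h1, h2⟩ := hS q hq
  refine ⟨inv b ≫ s ≫ inv a, ?_, ?_⟩
  · simp only [Category.assoc, IsIso.hom_inv_id_assoc, reassoc_of% h1]
    rw [comp_rest_assoc', IsIso.hom_inv_id, Category.comp_id]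
    rw [← Category.assoc a, rest_comp_total (a ≫ q)]
  · simp only [Category.assoc, IsIso.inv_hom_id_assoc, reassoc_of% h2]
    rw [comp_rest_assoc', IsIso.inv_hom_id, Category.comp_id]
    rw [← Category.assoc (inv b), rest_comp_total (inv b ≫ s)]

namespace Cofunctor

variable {A B : PartiteCat.{w} C}

theorem isIso_of_eq_id {X : Cofunctor A A} (h : X = Cofunctor.id A) (i j : A.G.I) :
    IsIso (X.onObj i) ∧ IsIso (X.onArr i j) := by
  subst h
  refine ⟨inferInstanceAs (IsIso (𝟙 _)), ?_⟩
  change IsIso (pullback.fst (A.G.src i j) (𝟙 (A.G.obj i)))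
  infer_instance

/-- An invertible cofunctor is invertible on objects of objects and on arrows. -/
theorem isIso_onObj_onArr {F : Cofunctor A B} {G : Cofunctor B A}
    (h : F.comp G = Cofunctor.id A) (h' : G.comp F = Cofunctor.id B) (i j : A.G.I) :
    IsIso (F.onObj i) ∧ IsIso (F.onArr i j) := by
  have hG : ∀ i, ∃ p, G.onI p = i := fun i => ⟨F.onI i, congrFun (congrArg Cofunctor.onI h) i⟩
  have hF : ∀ p, ∃ i, F.onI i = p := fun p => ⟨G.onI p, congrFun (congrArg Cofunctor.onI h') p⟩
  have hFG : ∀ i, IsIso (G.onObj (F.onI i) ≫ F.onObj i) := fun i => (isIso_of_eq_id h i i).1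
  have hGF : ∀ p, IsIso (F.onObj (G.onI p) ≫ G.onObj p) := fun p => (isIso_of_eq_id h' p p).1
  have hFo : ∀ i, IsIso (F.onObj i) := fun i => by
    obtain ⟨p, rfl⟩ := hG i
    have := hGF p
    have := hFG (G.onI p)
    have h1 : IsSplitMono (F.onObj (G.onI p)) :=
      ⟨⟨⟨G.onObj p ≫ inv (F.onObj (G.onI p) ≫ G.onObj p), by
        rw [← Category.assoc, IsIso.hom_inv_id]⟩⟩⟩
    have h2 : Epi (F.onObj (G.onI p)) := epi_of_epi (G.onObj (F.onI (G.onI p))) _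
    exact isIso_of_epi_of_isSplitMono _
  have hGo : ∀ p, IsIso (G.onObj p) := fun p => by
    obtain ⟨i, rfl⟩ := hF p
    have := hFG i
    have := hFo i
    exact IsIso.of_isIso_comp_right (G.onObj (F.onI i)) (F.onObj i)
  refine ⟨hFo i, ?_⟩
  -- by `h`, the action on arrows of `F` is a monomorphism
  have hm : ∀ i j, Mono (F.onArr i j) := fun i j => ⟨fun {Z} x y hxy => by
    have hs : x ≫ pullback.snd _ _ = y ≫ pullback.snd _ _ := by
      rw [← F.onArr_src, reassoc_of% hxy]
    have := hGo (F.onI i)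
    have key : ∀ z : Z ⟶ pullback (A.G.src i j) (F.onObj i),
        pullback.lift (f := A.G.src i j) (g := G.onObj (F.onI i) ≫ F.onObj i)
          (z ≫ pullback.fst _ _) (z ≫ pullback.snd _ _ ≫ inv (G.onObj (F.onI i)))
          (by simp only [Category.assoc, IsIso.inv_hom_id_assoc, pullback.condition]) ≫
            compArr F G i j =
        G.act (z ≫ F.onArr i j) (z ≫ pullback.snd _ _ ≫ inv (G.onObj (F.onI i)))
          (by simp only [Category.assoc, IsIso.inv_hom_id, Category.comp_id, F.onArr_src]) := by
      intro z
      rw [lift_compArr]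
      refine G.act_congr ?_ rfl _
      refine (F.act_congr rfl (b' := z ≫ pullback.snd _ _) ?_ _).trans ?_
      · simp only [Category.assoc, IsIso.inv_hom_id, Category.comp_id]
      · rw [act, lift_fst_snd]
    have hc : IsIso (compArr F G i j) := (isIso_of_eq_id h i j).2
    have h1 := (cancel_mono (compArr F G i j)).1 ((key x).trans (Eq.trans
      (G.act_congr hxy (by rw [← Category.assoc, hs, Category.assoc]) _) (key y).symm))
    have h2 := congrArg (fun z => z ≫ pullback.fst _ _) h1
    simp only [pullback.lift_fst] at h2
    exact pullback.hom_ext h2 hs⟩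
  -- by `h'`, it is a split epimorphism
  have he : ∀ p q, IsSplitEpi (F.onArr (G.onI p) (G.onI q)) := fun p q => by
    have hc : IsIso (compArr G F p q) := (isIso_of_eq_id h' p q).2
    exact ⟨⟨⟨inv (compArr G F p q) ≫ pullback.lift _ _ _, by
      rw [Category.assoc]
      exact IsIso.inv_hom_id (compArr G F p q)⟩⟩⟩
  obtain ⟨p, rfl⟩ := hG i
  obtain ⟨q, rfl⟩ := hG j
  have := hm (G.onI p) (G.onI q)
  have := he p q
  exact isIso_of_mono_of_isSplitEpi _

end Cofunctor

theorem isSourceEtale.of_iso [IsJoinRestrictionCategory C] {A B : PartiteCat.{w} C}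
    (hB : isSourceEtale C B) (e : A ≅ B) : isSourceEtale C A := fun i j => by
  obtain ⟨h1, h2⟩ := Cofunctor.isIso_onObj_onArr (F := e.hom) (G := e.inv) e.hom_inv_id
    e.inv_hom_id i j
  let F : Cofunctor A B := e.hom
  have h1 : IsIso (F.onObj i) := h1
  have h2 : IsIso (F.onArr i j) := h2
  have h3 : A.G.src i j = (inv (pullback.fst (A.G.src i j) (F.onObj i)) ≫ F.onArr i j) ≫
      B.G.src _ _ ≫ F.onObj i := by
    rw [Category.assoc, reassoc_of% F.onArr_src, ← pullback.condition, IsIso.inv_hom_id_assoc]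
  rw [h3]
  exact (hB _ _).iso_comp_iso _ _

end Iso

/-! ### Fixed points of an adjunction -/

section Adjunction

universe v₁ v₂ u₁ u₂

variable {𝒳 : Type u₁} [Category.{v₁} 𝒳] {𝒴 : Type u₂} [Category.{v₂} 𝒴] {L : 𝒳 ⥤ 𝒴}
  {R : 𝒴 ⥤ 𝒳} (adj : L ⊣ R)

theorem isIso_counit_app_of_bijective_map (A : 𝒴)
    (h : ∀ B : 𝒴, Function.Bijective fun G : A ⟶ B => R.map G) : IsIso (adj.counit.app A) := by
  refine isIso_of_coyoneda_map_bijective _ fun B => ?_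
  have h1 : (fun G : A ⟶ B => adj.counit.app A ≫ G) =
      (adj.homEquiv (R.obj A) B).symm ∘ fun G : A ⟶ B => R.map G := by
    funext G
    rw [Function.comp_apply, adj.homEquiv_counit]
    exact (adj.counit.naturality G).symm
  exact h1 ▸ (adj.homEquiv (R.obj A) B).symm.bijective.comp (h B)

/-- If the values of `R ∘ L` lie in `p`, and the units at the objects in `p` are invertible, then
`p` is a reflective subcategory, with the unit of `L ⊣ R` as reflection. -/
theorem exists_reflection (p : ObjectProperty 𝒳) (hp : ∀ X, p (R.obj (L.obj X)))
    (h : ∀ X, p X → IsIso (adj.unit.app X)) :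
    ∃ r : p.lift (L ⋙ R) hp ⊣ p.ι, ∀ X, r.unit.app X = adj.unit.app X := by
  have := fun Y : p.FullSubcategory => h Y.obj Y.property
  refine ⟨{
    unit := { app := fun X => adj.unit.app X, naturality := fun _ _ f => adj.unit.naturality f }
    counit :=
      { app := fun Y => ObjectProperty.homMk (inv (adj.unit.app Y.obj))
        naturality := fun Y Z f => ObjectProperty.hom_ext _ <| by
          change R.map (L.map f.hom) ≫ inv (adj.unit.app Z.obj) =
            inv (adj.unit.app Y.obj) ≫ f.hom
          rw [IsIso.comp_inv_eq, Category.assoc, IsIso.eq_inv_comp]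
          exact (adj.unit.naturality f.hom).symm }
    left_triangle_components := fun X => ObjectProperty.hom_ext _ <| by
      have := h _ (hp X)
      -- by a triangle identity, `R` maps the counit at `L X` to the inverse of the unit at `R L X`
      have h1 : inv (adj.unit.app (R.obj (L.obj X))) = R.map (adj.counit.app (L.obj X)) := by
        rw [IsIso.inv_eq_of_hom_inv_id]
        exact adj.right_triangle_components (L.obj X)
      change R.map (L.map (adj.unit.app X)) ≫ inv (adj.unit.app (R.obj (L.obj X))) = 𝟙 _
      rw [h1, ← R.map_comp]
      exact (congrArg R.map (adj.left_triangle_components X)).trans (R.map_id _)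
    right_triangle_components := fun Y => IsIso.hom_inv_id (adj.unit.app Y.obj) }, fun X => rfl⟩

/-- If the values of `L ∘ R` lie in `q`, and the counits at the objects in `q` are invertible,
then `q` is a coreflective subcategory, with the counit of `L ⊣ R` as coreflection. -/
theorem exists_coreflection (q : ObjectProperty 𝒴) (hq : ∀ A, q (L.obj (R.obj A)))
    (h : ∀ A, q A → IsIso (adj.counit.app A)) :
    ∃ r : q.ι ⊣ q.lift (R ⋙ L) hq, ∀ A, r.counit.app A = adj.counit.app A := by
  have := fun Y : q.FullSubcategory => h Y.obj Y.property
  refine ⟨{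
    unit :=
      { app := fun Y => ObjectProperty.homMk (inv (adj.counit.app Y.obj))
        naturality := fun Y Z f => ObjectProperty.hom_ext _ <| by
          change f.hom ≫ inv (adj.counit.app Z.obj) =
            inv (adj.counit.app Y.obj) ≫ L.map (R.map f.hom)
          rw [IsIso.comp_inv_eq, Category.assoc, IsIso.eq_inv_comp]
          exact (adj.counit.naturality f.hom).symm }
    counit :=
      { app := fun A => adj.counit.app A, naturality := fun _ _ f => adj.counit.naturality f }
    left_triangle_components := fun Y => IsIso.inv_hom_id (adj.counit.app Y.obj)
    right_triangle_components := fun A => ObjectProperty.hom_ext _ <| by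
      have := h _ (hq A)
      -- by a triangle identity, `L` maps the unit at `R A` to the inverse of the counit at `L R A`
      have h1 : inv (adj.counit.app (L.obj (R.obj A))) = L.map (adj.unit.app (R.obj A)) := by
        rw [IsIso.inv_eq_of_inv_hom_id]
        exact adj.left_triangle_components (R.obj A)
      change inv (adj.counit.app (L.obj (R.obj A))) ≫ L.map (R.map (adj.counit.app A)) = 𝟙 _
      rw [h1, ← L.map_comp]
      exact (congrArg L.map (adj.right_triangle_components A)).trans (L.map_id _) }, fun A => rfl⟩

/-- An adjunction restricts to an equivalence between full subcategories at whose objects the unit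
and the counit are invertible. -/
theorem exists_equivalence (p : ObjectProperty 𝒳) (q : ObjectProperty 𝒴)
    (hL : ∀ X, q (L.obj X)) (hR : ∀ A, p (R.obj A))
    (h : ∀ X, p X → IsIso (adj.unit.app X)) (h' : ∀ A, q A → IsIso (adj.counit.app A)) :
    ∃ e : p.FullSubcategory ≌ q.FullSubcategory,
      e.functor = q.lift (p.ι ⋙ L) (fun X => hL X.obj) ∧
      e.inverse = p.lift (q.ι ⋙ R) (fun A => hR A.obj) ∧
      (∀ X, HEq (e.unit.app X).hom (adj.unit.app X.obj)) ∧
      (∀ A, HEq (e.counit.app A).hom (adj.counit.app A.obj)) := by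
  let a : q.lift (p.ι ⋙ L) (fun X => hL X.obj) ⊣ p.lift (q.ι ⋙ R) (fun A => hR A.obj) :=
    { unit :=
        { app := fun X => ObjectProperty.homMk (adj.unit.app X.obj)
          naturality := fun _ _ f => ObjectProperty.hom_ext _ (adj.unit.naturality f.hom) }
      counit :=
        { app := fun A => ObjectProperty.homMk (adj.counit.app A.obj)
          naturality := fun _ _ f => ObjectProperty.hom_ext _ (adj.counit.naturality f.hom) }
      left_triangle_components := fun X =>
        ObjectProperty.hom_ext _ (adj.left_triangle_components X.obj)
      right_triangle_components := fun A =>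
        ObjectProperty.hom_ext _ (adj.right_triangle_components A.obj) }
  have h1 : ∀ X, IsIso (a.unit.app X) := fun X => by
    have : IsIso (p.ι.map (a.unit.app X)) := h X.obj X.property
    exact isIso_of_reflects_iso _ p.ι
  have h2 : ∀ A, IsIso (a.counit.app A) := fun A => by
    have : IsIso (q.ι.map (a.counit.app A)) := h' A.obj A.property
    exact isIso_of_reflects_iso _ q.ι
  exact ⟨a.toEquivalence, rfl, rfl, fun _ => HEq.rfl, fun _ => HEq.rfl⟩

end Adjunction

/-! ### The values of the two functors -/

section

variable {C : Type u} [Category.{v} C] [RestrictionCategory C] [IsJoinRestrictionCategory C]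
  [HasLocalGlueings C]

theorem isSourceEtale_internalisation (P : RCatOver.{w} C) :
    isSourceEtale C P.internalisation := fun i j => (P.isSectionCover i j).isLocalHomeo

theorem isInternalisation_toExternalisation (P : RCatOver.{w} C) :
    IsInternalisation P P.internalisation P.toExternalisation where
  bijective_obj := Function.bijective_id
  isIso_trans i := inferInstanceAs (IsIso (𝟙 (P.proj.obj i)))
  glueing i j := by
    refine ⟨P.eqAtlas i j, fun f g => P.isLUB_eqVal f g, ?_⟩
    have h := (P.glueing i j).isGlueing
    have h1 : P.internalisation.G.src i j ≫ 𝟙 (P.proj.obj i) = (P.glueing i j).src :=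
      Category.comp_id _
    have h2 : (fun f : i ⟶ j => inv (𝟙 (P.proj.obj i)) ≫ P.sec f) = (P.glueing i j).sec :=
      funext fun f => by
        rw [IsIso.inv_id]
        exact Category.id_comp _
    rw [← h1, ← h2] at h
    exact h

end

end JoinRestriction

theorem mainTheorem1 (C : Type u) [Category.{v} C] [RestrictionCategory C]
    [IsJoinRestrictionCategory C] [HasLocalGlueings C] :
    ∃ (Ψ : RCatOver.{w} C ⥤ PartiteCat.{w} C) (adj : Ψ ⊣ Phi C),
      -- the value of `Ψ` at `P` is the internalisation of `P`
      (∀ P, IsInternalisation P (Ψ.obj P) (adj.unit.app P)) ∧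
      -- the fixpoints of the adjunction
      (∀ P, IsIso (adj.unit.app P) ↔ isHyperconnectedJoin C P) ∧
      (∀ A, IsIso (adj.counit.app A) ↔ isSourceEtale C A) ∧
      ∃ (hΨ : ∀ P, isSourceEtale C (Ψ.obj P)) (hΦ : ∀ A, isHyperconnectedJoin C ((Phi C).obj A)),
        -- the adjunction restricts to an equivalence
        (∃ e : (isHyperconnectedJoin.{w} C).FullSubcategory ≌ (isSourceEtale.{w} C).FullSubcategory,
          e.functor = (isSourceEtale C).lift ((isHyperconnectedJoin C).ι ⋙ Ψ) (fun P => hΨ P.obj) ∧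
          e.inverse = (isHyperconnectedJoin C).lift ((isSourceEtale C).ι ⋙ Phi C)
            (fun A => hΦ A.obj) ∧
          (∀ P, HEq (e.unit.app P).hom (adj.unit.app P.obj)) ∧
          (∀ A, HEq (e.counit.app A).hom (adj.counit.app A.obj))) ∧
        -- the adjunction is Galois
        (∀ P, IsIso (adj.counit.app (Ψ.obj P))) ∧
        (∀ A, IsIso (adj.unit.app ((Phi C).obj A))) ∧
        (∃ r : (isHyperconnectedJoin C).lift (Ψ ⋙ Phi C) (fun P => hΦ (Ψ.obj P)) ⊣
            (isHyperconnectedJoin C).ι, ∀ P, r.unit.app P = adj.unit.app P) ∧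
        (∃ r : (isSourceEtale C).ι ⊣
            (isSourceEtale C).lift (Phi C ⋙ Ψ) (fun A => hΨ ((Phi C).obj A)),
          ∀ A, r.counit.app A = adj.counit.app A) := by
  have hη : ∀ P, IsIso ((psiAdj C).unit.app P) ↔ isHyperconnectedJoin C P := fun P => by
    rw [psiAdj_unit_app]
    exact ⟨RCatOver.isHyperconnectedJoin_of_isIso, RCatOver.isIso_toPhi⟩
  have hΨ : ∀ P, isSourceEtale C ((Psi C).obj P) := isSourceEtale_internalisation
  have hΦ : ∀ A, isHyperconnectedJoin C ((Phi C).obj A) := isHyperconnectedJoin_externalisation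
  have hε : ∀ A, IsIso ((psiAdj C).counit.app A) ↔ isSourceEtale C A := fun A =>
    ⟨fun _ => (hΨ _).of_iso (asIso ((psiAdj C).counit.app A)).symm,
      fun hA => isIso_counit_app_of_bijective_map (psiAdj C) A hA.bijective_map⟩
  refine ⟨Psi C, psiAdj C, fun P => ?_, hη, hε, hΨ, hΦ, ?_, fun P => (hε _).2 (hΨ P),
    fun A => (hη _).2 (hΦ A), ?_, ?_⟩
  · rw [psiAdj_unit_app]
    exact isInternalisation_toExternalisation P
  · exact exists_equivalence (psiAdj C) _ _ hΨ hΦ (fun P => (hη P).2) fun A => (hε A).2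
  · exact exists_reflection (psiAdj C) _ _ fun P => (hη P).2
  · exact exists_coreflection (psiAdj C) _ _ fun A => (hε A).2
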